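/- \textbf{Setting.} Let $(X_i,Z_i,\mathcal E_i)$, $i\ge 1$, be i.i.d. with values in $\mathbb R^{p_x}\times\mathbb R^{p_z}\times\mathbb R$ and $\mathbb E[\mathcal E_i\mid Z_i]=0$. Let $\mathcal B\subset\mathbb R^k$ be compact, $g(x;\beta)$ a real regression function, $K:\mathbb R^{p_z}\to\mathbb R$ an even measurable kernel, $a(x,z)$ a real function and $\mathcal V(u,z)\in\mathbb R^{p_v}$ (all functions Borel measurable). For sample size $n$ the data follow the Pitman local alternative $$\mathbb H_{an}:\quad Y_i=g(X_i;\beta_o)+n^{-1/2}a(X_i,Z_i)+\mathcal E_i,\qquad i=1,\dots,n,$$ and $\mathbb H_o$ means $Y_i=g(X_i;\beta_o)+\mathcal E_i$. Put $U_i=Y_i-g(X_i;\beta_o)$, $V_i=\mathcal V(U_i,Z_i)$ and, for an estimator $\widehat\beta_n$ of $\beta_o$, $\widehat U_i=Y_i-g(X_i;\widehat\beta_n)$, $\widehat V_i=\mathcal V(\widehat U_i,Z_i)$, $$\widehat\delta_n=\frac1{n(n-1)}\sum_{i=1}^n\sum_{j\ne i}K(Z_i-Z_j)\,\widehat U_i\,\widehat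 V_j .$$ Write $V_i^{(t)}=\mathcal V(\mathcal E_i+t\,a(X_i,Z_i),Z_i)$, so that $V_i=V_i^{(n^{-1/2})}$ under $\mathbb H_{an}$ and $V_i=V_i^{(0)}$ under $\mathbb H_o$. Drop the index for a generic observation and let $\dagger$ denote an independent copy. Let $r=\partial g(X;\beta_o)/\partial\beta$, $\bar g=\sup_{\beta\in\mathcal B}\|\partial g(X;\beta)/\partial\beta\|$, $a=a(X,Z)$, and $$\psi^{(t)}(D,D^\dagger)=\tfrac12K(Z-Z^\dagger)\big(\mathcal E V^{(t)\dagger}+\mathcal E^\dagger V^{(t)}\big).$$ \textbf{Conditions.} (1) $\mathbb E K^2(Z-Z^\dagger)<\infty$ and $\mathbb E(\mathcal E+n^{-1/2}a)^2<\infty$ for all $n\ge1$. (2) For almost every value $x$ of $X$, $g(x;\cdot)$ has a gradient that is continuous on $\mathcal B$, and $\mathbb E\,\bar g<\infty$. (3) $\beta_o$ is an interior point of $\mathcal B$, and $\widehat\beta_n$ is consistent with $$\sqrt n(\widehat\beta_n-\beta_o)=\zeta_a+\frac1{\sqrt n}\sum_{i=1}^n\varphi_i\mathcal E_i+o_p(1),\qquad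 \zeta_a=\mathbb E[a\varphi],\quad \varphi_i=\varphi(X_i,Z_i;\beta_o)\in\mathbb R^k,$$ where $a\varphi$ is integrable, $\mathbb E[\mathcal E\varphi]=0$, and $\Xi_0=\mathbb E[\varphi\varphi'\mathcal E^2]$ exists and is positive definite. (4) $\widehat V_i=V_i+\xi_i'(\widehat\beta_n-\beta_o)+R_{n,i}$ with $\xi_i=\xi(X_i,Z_i;\beta_o)\in\mathbb R^{k\times p_v}$, $\mathbb E\|\xi\|^2<\infty$, where $R_{n,i}=o_p(n^{-1/2})$ in root mean square over $i\le n$, i.e. $\sum_{i\le n}\|R_{n,i}\|^2\to0$ in probability (in particular if $\max_{i\le n}\|R_{n,i}\|=o_p(n^{-1/2})$); and $\mathbb E[V^{(0)}\mid Z]$ is not a.s. zero. (5) $V^{(0)}$ and all $V^{(n^{-1/2})}$ are integrable, $\mathbb E\|\psi^{(0)}(D,D^\dagger)\|^2<\infty$, and $K(Z-Z^\dagger)\,a\,V^{(0)\dagger}$ and $K(Z-Z^\dagger)\,\bar g\,V^{(0)\dagger}$ are integrable; moreover, as $n\to\infty$, $\mathbb E\|\psi^{(n^{-1/2})}(D,D^\dagger)-\psi^{(0)}(D,D^\dagger)\|^2\to0$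 and $\mathbb E\big[|K(Z-Z^\dagger)|\,(|a|+\bar g)\,\|V^{(n^{-1/2})\dagger}-V^{(0)\dagger}\|\big]\to0$ (these two limits are trivial if $a=0$). \textbf{Constants.} With $V=V^{(0)}$, $\psi=\psi^{(0)}$ and $\psi^{(1)}(D)=\mathbb E[\psi(D,D^\dagger)\mid D]$, let $\Omega_V=4\,\mathrm{Var}(\psi^{(1)}(D))$, $$\Xi_1=\mathbb E[K(Z-Z^\dagger)(\mathcal E\xi^{\dagger\prime}-V^\dagger r')],\quad \Xi_2=\mathbb E[\psi^{(1)}(D)\mathcal E\varphi'],\quad \Xi_a=\mathbb E[K(Z-Z^\dagger)\,a\,V^\dagger],$$ $$\Omega_\delta=\Omega_V+\Xi_1\Xi_0\Xi_1'+2\Xi_1\Xi_2'+2\Xi_2\Xi_1'.$$ \textbf{Theorem.} Under conditions (1)--(5) and $\mathbb H_{an}$, $\Omega_\delta$ is positive semidefinite and $$\sqrt n\,\widehat\delta_n\overset{d}{\to}\mathcal N(\Xi_a+\Xi_1\zeta_a,\ \Omega_\delta).$$ In particular, under $\mathbb H_o$, $\sqrt n\,\widehat\delta_n\overset{d}{\to}\mathcal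 N(0,\Omega_\delta)$. -/

import Mathlib

open MeasureTheory ProbabilityTheory Filter Topology
open scoped ENNReal Matrix

noncomputable section

namespace SpecTest

/-- `ℝ^p` with its Euclidean norm. -/
abbrev Vec (p : ℕ) := EuclideanSpace ℝ (Fin p)

/-- The values `(x, z, e)` of one observation `(X, Z, ℰ)`: regressor, instrument, error. -/
abbrev Obs (px pz : ℕ) := Vec px × Vec pz × ℝ

/-- The primitives of the testing problem.  This is bare data: all that is required of it is in
the conditions below.  -/
structure Model (px pz pv k : ℕ) where
  /-- the common law of the observations `(X_i, Z_i, ℰ_i)` -/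
  P : Measure (Obs px pz)
  /-- the kernel -/
  K : Vec pz → ℝ
  /-- the parameter space -/
  B : Set (Vec k)
  /-- the true parameter -/
  β₀ : Vec k
  /-- the regression function `g(x; β)` -/
  g : Vec px → Vec k → ℝ
  /-- the gradient `∂g(x; β)/∂β` -/
  dg : Vec px → Vec k → Vec k
  /-- the direction of misspecification `a(x, z)` -/
  a : Vec px → Vec pz → ℝ
  /-- the map `(u, z) ↦ 𝒱(u, z)` that forms the auxiliary variable `V` -/
  V : ℝ → Vec pz → Vec pv
  /-- the influence function `φ(x, z; β)` of the estimator -/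
  φ : Vec px → Vec pz → Vec k → Vec k
  /-- the coefficient `ξ(x, z; β)` of the expansion of `V` -/
  ξ : Vec px → Vec pz → Vec k → Matrix (Fin k) (Fin pv) ℝ

/-- `n^{-1/2}` (used for `n ≥ 1`). -/
def rate (n : ℕ) : ℝ := (√(n : ℝ))⁻¹

namespace Model

variable {px pz pv k : ℕ} (M : Model px pz pv k)

/-- The law of two independent observations `(D, D†)`. -/
def P2 : Measure (Obs px pz × Obs px pz) := M.P.prod M.P

/-- `K(Z - Z†)`. -/
def Kpair (w w' : Obs px pz) : ℝ := M.K (w.2.1 - w'.2.1)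

/-- `a(X, Z)`. -/
def aObs (w : Obs px pz) : ℝ := M.a w.1 w.2.1

/-- The model error `U = ℰ + t a(X, Z)`; `t = n^{-1/2}` under the local alternative with sample
size `n`, and `t = 0` under the null hypothesis. -/
def UObs (t : ℝ) (w : Obs px pz) : ℝ := w.2.2 + t * M.aObs w

/-- `V = 𝒱(U, Z)` with `U = ℰ + t a(X, Z)`. -/
def VObs (t : ℝ) (w : Obs px pz) : Vec pv := M.V (M.UObs t w) w.2.1

/-- `r = ∂g(X; β₀)/∂β`. -/
def rObs (w : Obs px pz) : Vec k := M.dg w.1 M.β₀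

/-- `φ(X, Z; β₀)`. -/
def φObs (w : Obs px pz) : Vec k := M.φ w.1 w.2.1 M.β₀

/-- `ξ(X, Z; β₀)`. -/
def ξObs (w : Obs px pz) : Matrix (Fin k) (Fin pv) ℝ := M.ξ w.1 w.2.1 M.β₀

/-- `sup_{β ∈ B} ‖∂g(X; β)/∂β‖`. -/
def env (w : Obs px pz) : ℝ≥0∞ := ⨆ b ∈ M.B, ‖M.dg w.1 b‖ₑ

/-- The symmetrized kernel `ψ(D, D†) = K(Z - Z†) (ℰ V† + ℰ† V) / 2`, with `V = 𝒱(ℰ + t a, Z)`. -/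
def ψ (t : ℝ) (w w' : Obs px pz) : Vec pv :=
  (M.Kpair w w' / 2) • (w.2.2 • M.VObs t w' + w'.2.2 • M.VObs t w)

/-- `ψ⁽¹⁾(D) = E[ψ(D, D†) | D]`, at the null value `V = 𝒱(ℰ, Z)`. -/
def ψ1 (w : Obs px pz) : Vec pv := ∫ w', M.ψ 0 w w' ∂M.P

/-- `ζ_a = E[a(X, Z) φ]`. -/
def ζa : Vec k := ∫ w, M.aObs w • M.φObs w ∂M.P

/-- `Ξ₀ = E[φ φ' ℰ²]`. -/
def Ξ0 : Matrix (Fin k) (Fin k) ℝ :=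
  Matrix.of fun l m => ∫ w, M.φObs w l * M.φObs w m * w.2.2 ^ 2 ∂M.P

/-- `Ξ₁ = E[K(Z - Z†) (ℰ ξ†' - V† r')]`. -/
def Ξ1 : Matrix (Fin pv) (Fin k) ℝ :=
  Matrix.of fun l m => ∫ p, M.Kpair p.1 p.2 *
    (p.1.2.2 * M.ξObs p.2 m l - M.VObs 0 p.2 l * M.rObs p.1 m) ∂M.P2

/-- `Ξ₂ = E[ψ⁽¹⁾(D) ℰ φ']`. -/
def Ξ2 : Matrix (Fin pv) (Fin k) ℝ :=
  Matrix.of fun l m => ∫ w, M.ψ1 w l * w.2.2 * M.φObs w m ∂M.P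

/-- `Ξ_a = E[K(Z - Z†) a(X, Z) V†]`. -/
def Ξa : Vec pv := ∫ p, (M.Kpair p.1 p.2 * M.aObs p.1) • M.VObs 0 p.2 ∂M.P2

/-- `Ω_V = 4 Var(ψ⁽¹⁾(D))`. -/
def ΩV : Matrix (Fin pv) (Fin pv) ℝ :=
  Matrix.of fun l m => 4 * cov[fun w => M.ψ1 w l, fun w => M.ψ1 w m; M.P]

/-- `Ω_δ = Ω_V + Ξ₁ Ξ₀ Ξ₁' + 2 Ξ₁ Ξ₂' + 2 Ξ₂ Ξ₁'`. -/
def Ωδ : Matrix (Fin pv) (Fin pv) ℝ :=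
  M.ΩV + M.Ξ1 * M.Ξ0 * M.Ξ1ᵀ + (2 : ℝ) • (M.Ξ1 * M.Ξ2ᵀ) + (2 : ℝ) • (M.Ξ2 * M.Ξ1ᵀ)

/-- The limit mean `Ξ_a + Ξ₁ ζ_a`. -/
def limitMean : Vec pv := M.Ξa + WithLp.toLp 2 (M.Ξ1 *ᵥ M.ζa.ofLp)

/-- Standing conventions: Borel measurability of the primitives, an even kernel, a compact
parameter space, and errors with `E[ℰ | Z] = 0`. -/
structure Standing : Prop where
  measurable_K : Measurable M.K
  K_even : ∀ z, M.K (-z) = M.K z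
  isCompact_B : IsCompact M.B
  measurable_g : Measurable (Function.uncurry M.g)
  measurable_dg : Measurable (Function.uncurry M.dg)
  measurable_a : Measurable (Function.uncurry M.a)
  measurable_V : Measurable (Function.uncurry M.V)
  measurable_φ : Measurable fun q : Vec px × Vec pz => M.φ q.1 q.2 M.β₀
  measurable_ξ : ∀ m l, Measurable fun q : Vec px × Vec pz => M.ξ q.1 q.2 M.β₀ m l
  error_mean_zero :
    M.P[fun w : Obs px pz => w.2.2 |
      MeasurableSpace.comap (fun w : Obs px pz => w.2.1) inferInstance] =ᵐ[M.P] 0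

/-- `E U² + E K²(Z - Z†) < ∞`, for the error `U = ℰ + n^{-1/2} a(X, Z)` at every sample size. -/
structure MomentCondition : Prop where
  U_sq : ∀ n : ℕ, 1 ≤ n → MemLp (M.UObs (rate n)) 2 M.P
  K_sq : MemLp (fun p : Obs px pz × Obs px pz => M.Kpair p.1 p.2) 2 M.P2

/-- On the support of `X`, `g(x; ·)` has the continuous gradient `dg x` on `B`, and
`E[sup_{β ∈ B} ‖∂g(X; β)/∂β‖] < ∞`. -/
structure SmoothCondition : Prop where
  gradient : ∀ᵐ w ∂M.P, ∀ b ∈ M.B, HasGradientWithinAt (M.g w.1) (M.dg w.1 b) M.B b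
  continuous_gradient : ∀ᵐ w ∂M.P, ContinuousOn (M.dg w.1) M.B
  integrable_env : ∫⁻ w, M.env w ∂M.P < ∞

/-- Existence of the kernel-weighted moments that enter the limit, and their continuity along the
local alternatives: `V` depends on `n` through `U = ℰ + n^{-1/2} a(X, Z)`.  If `a = 0` then the
two limits are trivial. -/
structure DominanceCondition : Prop where
  V_integrable : Integrable (M.VObs 0) M.P ∧ ∀ n : ℕ, 1 ≤ n → Integrable (M.VObs (rate n)) M.P
  ψ_sq : MemLp (fun p : Obs px pz × Obs px pz => M.ψ 0 p.1 p.2) 2 M.P2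
  KaV_integrable : Integrable (fun p : Obs px pz × Obs px pz =>
    (M.Kpair p.1 p.2 * M.aObs p.1) • M.VObs 0 p.2) M.P2
  KgV_integrable : ∫⁻ p, ‖M.Kpair p.1 p.2‖ₑ * M.env p.1 * ‖M.VObs 0 p.2‖ₑ ∂M.P2 < ∞
  ψ_tendsto : Tendsto (fun n : ℕ => eLpNorm (fun p : Obs px pz × Obs px pz =>
    M.ψ (rate n) p.1 p.2 - M.ψ 0 p.1 p.2) 2 M.P2) atTop (𝓝 0)
  KV_tendsto : Tendsto (fun n : ℕ => ∫⁻ p, ‖M.Kpair p.1 p.2‖ₑ * (‖M.aObs p.1‖ₑ + M.env p.1) *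
    ‖M.VObs (rate n) p.2 - M.VObs 0 p.2‖ₑ ∂M.P2) atTop (𝓝 0)

end Model

variable {px pz pv k : ℕ} {Ω : Type*} [MeasurableSpace Ω]

/-- The sample: `(X_i, Z_i, ℰ_i)`, `i = 0, 1, 2, …`, are i.i.d. with law `M.P`. -/
structure Sampling (M : Model px pz pv k) (μ : Measure Ω)
    (X : ℕ → Ω → Vec px) (Z : ℕ → Ω → Vec pz) (e : ℕ → Ω → ℝ) : Prop where
  hasLaw : ∀ i, HasLaw (fun ω => (X i ω, Z i ω, e i ω)) M.P μ
  indep : iIndepFun (fun i ω => (X i ω, Z i ω, e i ω)) μ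

/-- The Pitman local alternatives: `Y_i = g(X_i; β₀) + n^{-1/2} a(X_i, Z_i) + ℰ_i` for the `n`
observations of the sample of size `n`. -/
def LocalAlternative (M : Model px pz pv k) (μ : Measure Ω)
    (X : ℕ → Ω → Vec px) (Z : ℕ → Ω → Vec pz) (e : ℕ → Ω → ℝ) (Y : ℕ → ℕ → Ω → ℝ) : Prop :=
  ∀ n : ℕ, ∀ i < n, ∀ᵐ ω ∂μ,
    Y n i ω = M.g (X i ω) M.β₀ + rate n * M.a (X i ω) (Z i ω) + e i ω

/-- The null hypothesis: `Y_i = g(X_i; β₀) + ℰ_i`, that is, `U_i = ℰ_i`. -/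
def NullHypothesis (M : Model px pz pv k) (μ : Measure Ω)
    (X : ℕ → Ω → Vec px) (e : ℕ → Ω → ℝ) (Y : ℕ → ℕ → Ω → ℝ) : Prop :=
  ∀ n : ℕ, ∀ i < n, ∀ᵐ ω ∂μ, Y n i ω = M.g (X i ω) M.β₀ + e i ω

/-- `U_i(b) = Y_i - g(X_i; b)` for a possibly random `b`; the residual `Û_i` is the case
`b = β̂_n`, and the error `U_i` is the case `b = β₀`. -/
def resid (M : Model px pz pv k) (X : ℕ → Ω → Vec px) (Y : ℕ → ℕ → Ω → ℝ)
    (b : ℕ → Ω → Vec k) (n i : ℕ) (ω : Ω) : ℝ :=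
  Y n i ω - M.g (X i ω) (b n ω)

/-- `V_i(b) = 𝒱(U_i(b), Z_i)`; `V̂_i` is the case `b = β̂_n`, and `V_i` is the case `b = β₀`. -/
def auxV (M : Model px pz pv k) (X : ℕ → Ω → Vec px) (Z : ℕ → Ω → Vec pz) (Y : ℕ → ℕ → Ω → ℝ)
    (b : ℕ → Ω → Vec k) (n i : ℕ) (ω : Ω) : Vec pv :=
  M.V (resid M X Y b n i ω) (Z i ω)

/-- `δ̂_n = (n (n-1))⁻¹ ∑_{i ≠ j} K(Z_i - Z_j) Û_i V̂_j`. -/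
def δhat (M : Model px pz pv k) (X : ℕ → Ω → Vec px) (Z : ℕ → Ω → Vec pz) (Y : ℕ → ℕ → Ω → ℝ)
    (βhat : ℕ → Ω → Vec k) (n : ℕ) (ω : Ω) : Vec pv :=
  ((n : ℝ) * ((n : ℝ) - 1))⁻¹ • ∑ i ∈ Finset.range n, ∑ j ∈ (Finset.range n).erase i,
    (M.K (Z i ω - Z j ω) * resid M X Y βhat n i ω) • auxV M X Z Y βhat n j ω

/-- The Bahadur representation of a consistent estimator of the interior point `β₀` of `B`. -/
structure BahadurCondition (M : Model px pz pv k) (μ : Measure Ω)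
    (X : ℕ → Ω → Vec px) (Z : ℕ → Ω → Vec pz) (e : ℕ → Ω → ℝ)
    (βhat : ℕ → Ω → Vec k) : Prop where
  interior : M.β₀ ∈ interior M.B
  measurable : ∀ n, AEMeasurable (βhat n) μ
  consistent : TendstoInMeasure μ βhat atTop fun _ => M.β₀
  expansion : TendstoInMeasure μ (fun (n : ℕ) ω => √(n : ℝ) • (βhat n ω - M.β₀) -
    (M.ζa + rate n • ∑ i ∈ Finset.range n, e i ω • M.φ (X i ω) (Z i ω) M.β₀)) atTop fun _ => 0
  aφ_integrable : Integrable (fun w => M.aObs w • M.φObs w) M.P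
  eφ_sq : MemLp (fun w : Obs px pz => w.2.2 • M.φObs w) 2 M.P
  eφ_mean_zero : ∫ w : Obs px pz, w.2.2 • M.φObs w ∂M.P = 0
  Ξ0_posDef : M.Ξ0.PosDef

/-- The linear expansion `V̂_i = V_i + ξ_i' (β̂_n - β₀) + o_p(n^{-1/2})`, where the remainders are
`o_p(n^{-1/2})` in root mean square over `i ≤ n` (so in particular if uniformly in `i ≤ n`), with
`E‖ξ‖² < ∞`, and with `V` first-order non-degenerate under the null hypothesis. -/
structure VExpansionCondition (M : Model px pz pv k) (μ : Measure Ω)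
    (X : ℕ → Ω → Vec px) (Z : ℕ → Ω → Vec pz) (Y : ℕ → ℕ → Ω → ℝ)
    (βhat : ℕ → Ω → Vec k) : Prop where
  expansion : TendstoInMeasure μ (fun (n : ℕ) ω => ∑ i ∈ Finset.range n,
    ‖auxV M X Z Y βhat n i ω - auxV M X Z Y (fun _ _ => M.β₀) n i ω -
      WithLp.toLp 2 ((M.ξ (X i ω) (Z i ω) M.β₀)ᵀ *ᵥ (βhat n ω - M.β₀).ofLp)‖ ^ 2) atTop
    fun _ => 0
  nondegenerate : ¬ (M.P[M.VObs 0 |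
    MeasurableSpace.comap (fun w : Obs px pz => w.2.1) inferInstance] =ᵐ[M.P] 0)
  ξ_sq : ∀ m l, MemLp (fun w => M.ξObs w m l) 2 M.P

end SpecTest

end

/-!
The statistic is shown to be asymptotically linear: up to `o_p(1)`, `√n δ̂_n` equals
`Ξ_a + Ξ₁ ζ_a` plus the normalized sum `n^{-1/2} ∑ W(D_i)` of the i.i.d. influence function
`W = 2 ψ⁽¹⁾ + Ξ₁ φ ℰ` (`influence`, `isLittleOP_δhat_apply`).  This `W` is centred and square
integrable, and its second-moment matrix is `Ω_δ` (`Ωδ_apply`).  Hence `Ω_δ` is positive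
semidefinite, and the central limit theorem, which is reduced to dimension one by characteristic
functions (`tendstoInDistribution_inv_sqrt_smul_sum_add`), gives the limit law.  If the null
hypothesis holds as well, then `a(X, Z) = 0` almost surely and the limit mean vanishes.

The asymptotic linearity is proved for one coordinate at a time and has two ingredients.

* The plug-in expansion (`isLittleOP_plugIn`).  The residual is `ℰ + n^{-1/2} a - Δ` with
  `Δ = g(X; β̂_n) - g(X; β₀)`, and the auxiliary variable is `V + ξ' (β̂_n - β₀) + R`.  The terms of
  first order in the perturbations are U-statistics multiplied by `n^{-1/2}` or by `β̂_n - β₀`; a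
  weak law for U-statistics with merely integrable kernels replaces them by their means, which are
  `Ξ_a` and the two halves of `Ξ₁`.  All products of two perturbations, and `R`, are removed by
  the Cauchy–Schwarz inequality; here `n⁻² ∑ H(D_i)² → 0` in probability for integrable `H`
  (`isLittleOP_inv_sq_mul_sum_sq`) takes the place of square integrability of the gradient of `g`.
  The error of the linearization of `g` is controlled by a measurable modulus `ω_m(X)`, the
  supremum of the difference quotients over a ball of radius `ε_m` about `β₀`, which has an
  integrable envelope and tends to zero almost surely (`exists_modulus`).
* The Hájek projection (`isLittleOP_uavg_sub_projection`).  After symmetrization the remaining term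
  is the U-statistic with kernel `ψ`, which has mean zero because `E[ℰ | Z] = 0`
  (`integral_symmetrized_eq_zero`).  Replacing the kernel at `t = n^{-1/2}` by the kernel at `t = 0`
  costs `o_p(1)`, since mean-zero U-statistics have a variance of order `n⁻¹ E h²`; and the
  degenerate part that is left after the projection has a variance of order `n⁻²`.

The estimates of variances are elementary: the square of the double sum is expanded, and the pairs
of index pairs with a nonzero expectation are counted (`integral_sq_usum_le`).
-/

/-! ### Stochastic order symbols -/

namespace SpecTest

section StochasticOrder

variable {Ω : Type*} [MeasurableSpace Ω] {μ : Measure Ω} {f g : ℕ → Ω → ℝ}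

/-- `f_n = o_p(1)`: the sequence converges to `0` in probability. -/
def IsLittleOP (μ : Measure Ω) (f : ℕ → Ω → ℝ) : Prop :=
  TendstoInMeasure μ f atTop fun _ => 0

/-- `f_n = O_p(1)`: the sequence is eventually bounded, up to events of small outer measure. -/
def IsBigOP (μ : Measure Ω) (f : ℕ → Ω → ℝ) : Prop :=
  ∀ ε : ℝ≥0∞, 0 < ε → ∃ C : ℝ, 0 < C ∧ ∀ᶠ n in atTop, μ {ω | C < |f n ω|} ≤ ε

lemma isLittleOP_iff :
    IsLittleOP μ f ↔ ∀ η : ℝ, 0 < η → ∀ ε : ℝ≥0∞, 0 < ε →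
      ∀ᶠ n in atTop, μ {ω | η ≤ |f n ω|} ≤ ε := by
  unfold IsLittleOP
  rw [tendstoInMeasure_iff_norm]
  simp only [sub_zero, Real.norm_eq_abs, ENNReal.tendsto_nhds_zero]

/-- Domination on the complement of events of vanishing probability transfers `o_p(1)`. -/
lemma IsLittleOP.of_bound_of_measure (hg : IsLittleOP μ g) (s : ℕ → Set Ω)
    (hs : Tendsto (fun n => μ (s n)) atTop (𝓝 0))
    (h : ∀ᶠ n in atTop, ∀ᵐ ω ∂μ, ω ∉ s n → |f n ω| ≤ |g n ω|) : IsLittleOP μ f := by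
  rw [isLittleOP_iff] at hg ⊢
  intro η hη ε hε
  have hε2 : 0 < ε / 2 := ENNReal.half_pos hε.ne'
  filter_upwards [hg η hη _ hε2, ENNReal.tendsto_nhds_zero.1 hs _ hε2, h] with n h1 h2 h3
  calc μ {ω | η ≤ |f n ω|} ≤ μ ({ω | η ≤ |g n ω|} ∪ s n) := by
        apply measure_mono_ae
        filter_upwards [h3] with ω h3 hω
        by_cases hs : ω ∈ s n
        · exact Or.inr hs
        · exact Or.inl (le_trans hω (h3 hs))
    _ ≤ _ := measure_union_le _ _
    _ ≤ ε / 2 + ε / 2 := add_le_add h1 h2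
    _ = ε := ENNReal.add_halves ε

lemma IsLittleOP.of_bound (hg : IsLittleOP μ g)
    (h : ∀ᶠ n in atTop, ∀ᵐ ω ∂μ, |f n ω| ≤ |g n ω|) : IsLittleOP μ f :=
  hg.of_bound_of_measure (fun _ => ∅) (by simp) (by simpa using h)

lemma IsLittleOP.congr (hg : IsLittleOP μ g)
    (h : ∀ᶠ n in atTop, ∀ᵐ ω ∂μ, f n ω = g n ω) : IsLittleOP μ f :=
  hg.of_bound (h.mono fun n hn => hn.mono fun ω hω => by rw [hω])

lemma IsBigOP.of_bound (hg : IsBigOP μ g)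
    (h : ∀ᶠ n in atTop, ∀ᵐ ω ∂μ, |f n ω| ≤ |g n ω|) : IsBigOP μ f := by
  intro ε hε
  obtain ⟨C, hC, h1⟩ := hg ε hε
  refine ⟨C, hC, ?_⟩
  filter_upwards [h1, h] with n h1 h2
  refine le_trans (measure_mono_ae ?_) h1
  filter_upwards [h2] with ω h2 (hω : C < |f n ω|)
  exact lt_of_lt_of_le hω h2

lemma IsLittleOP.add (hf : IsLittleOP μ f) (hg : IsLittleOP μ g) :
    IsLittleOP μ fun n ω => f n ω + g n ω := by
  rw [isLittleOP_iff] at hf hg ⊢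
  intro η hη ε hε
  have hε2 : 0 < ε / 2 := ENNReal.half_pos hε.ne'
  filter_upwards [hf (η / 2) (by positivity) _ hε2, hg (η / 2) (by positivity) _ hε2] with n h1 h2
  calc μ {ω | η ≤ |f n ω + g n ω|} ≤ μ ({ω | η / 2 ≤ |f n ω|} ∪ {ω | η / 2 ≤ |g n ω|}) := by
        apply measure_mono
        intro ω (hω : η ≤ |f n ω + g n ω|)
        by_contra hcon
        simp only [Set.mem_union, Set.mem_ofPred_eq, not_or, not_le] at hcon
        linarith [abs_add_le (f n ω) (g n ω)]
    _ ≤ _ := measure_union_le _ _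
    _ ≤ ε / 2 + ε / 2 := add_le_add h1 h2
    _ = ε := ENNReal.add_halves ε

lemma IsBigOP.add (hf : IsBigOP μ f) (hg : IsBigOP μ g) :
    IsBigOP μ fun n ω => f n ω + g n ω := by
  intro ε hε
  have hε2 : 0 < ε / 2 := ENNReal.half_pos hε.ne'
  obtain ⟨C, hC, h1⟩ := hf _ hε2
  obtain ⟨C', hC', h2⟩ := hg _ hε2
  refine ⟨C + C', by positivity, ?_⟩
  filter_upwards [h1, h2] with n h1 h2
  calc μ {ω | C + C' < |f n ω + g n ω|} ≤ μ ({ω | C < |f n ω|} ∪ {ω | C' < |g n ω|}) := by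
        apply measure_mono
        intro ω (hω : C + C' < |f n ω + g n ω|)
        by_contra hcon
        simp only [Set.mem_union, Set.mem_ofPred_eq, not_or, not_lt] at hcon
        linarith [abs_add_le (f n ω) (g n ω)]
    _ ≤ _ := measure_union_le _ _
    _ ≤ ε / 2 + ε / 2 := add_le_add h1 h2
    _ = ε := ENNReal.add_halves ε

lemma IsLittleOP.mul_isBigOP (hf : IsLittleOP μ f) (hg : IsBigOP μ g) :
    IsLittleOP μ fun n ω => f n ω * g n ω := by
  rw [isLittleOP_iff] at hf ⊢
  intro η hη ε hε
  have hε2 : 0 < ε / 2 := ENNReal.half_pos hε.ne'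
  obtain ⟨C, hC, h2⟩ := hg _ hε2
  filter_upwards [hf (η / C) (by positivity) _ hε2, h2] with n h1 h2
  calc μ {ω | η ≤ |f n ω * g n ω|} ≤ μ ({ω | η / C ≤ |f n ω|} ∪ {ω | C < |g n ω|}) := by
        apply measure_mono
        intro ω (hω : η ≤ |f n ω * g n ω|)
        by_contra hcon
        simp only [Set.mem_union, Set.mem_ofPred_eq, not_or, not_le, not_lt] at hcon
        rw [lt_div_iff₀ hC] at hcon
        rw [abs_mul] at hω
        nlinarith [mul_le_mul_of_nonneg_left hcon.2 (abs_nonneg (f n ω))]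
    _ ≤ _ := measure_union_le _ _
    _ ≤ ε / 2 + ε / 2 := add_le_add h1 h2
    _ = ε := ENNReal.add_halves ε

lemma isBigOP_const (c : ℝ) : IsBigOP μ fun _ _ => c := by
  intro ε _
  exact ⟨|c| + 1, by positivity, Eventually.of_forall fun n => by
    simp [not_lt.2 (le_add_of_nonneg_right zero_le_one)]⟩

lemma IsLittleOP.isBigOP (hf : IsLittleOP μ f) : IsBigOP μ f := by
  rw [isLittleOP_iff] at hf
  intro ε hε
  refine ⟨1, one_pos, (hf 1 one_pos ε hε).mono fun n hn => le_trans (measure_mono ?_) hn⟩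
  intro ω (hω : 1 < |f n ω|)
  exact hω.le

lemma IsLittleOP.const_mul (hf : IsLittleOP μ f) (c : ℝ) : IsLittleOP μ fun n ω => c * f n ω := by
  simpa only [mul_comm] using hf.mul_isBigOP (isBigOP_const c)

lemma IsLittleOP.neg (hf : IsLittleOP μ f) : IsLittleOP μ fun n ω => -f n ω :=
  hf.of_bound (Eventually.of_forall fun n => Eventually.of_forall fun ω => by rw [abs_neg])

lemma IsLittleOP.sub (hf : IsLittleOP μ f) (hg : IsLittleOP μ g) :
    IsLittleOP μ fun n ω => f n ω - g n ω := by
  simpa only [sub_eq_add_neg] using hf.add hg.neg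

lemma isLittleOP_zero : IsLittleOP μ fun _ _ => (0 : ℝ) := by
  rw [isLittleOP_iff]
  intro η hη ε hε
  exact Eventually.of_forall fun n => by simp [not_le.2 hη]

lemma isLittleOP_of_tendsto {c : ℕ → ℝ} (hc : Tendsto c atTop (𝓝 0)) :
    IsLittleOP μ fun n _ => c n := by
  rw [isLittleOP_iff]
  intro η hη ε hε
  filter_upwards [hc.eventually (Metric.ball_mem_nhds 0 hη)] with n hn
  have hn' : |c n| < η := by simpa only [dist_zero_right, Real.norm_eq_abs] using hn
  simp only [not_le.2 hn', Set.ofPred_false, measure_empty, zero_le]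

lemma isLittleOP_inv_sqrt : IsLittleOP μ fun n _ => (√(n : ℝ))⁻¹ :=
  isLittleOP_of_tendsto (tendsto_inv_atTop_zero.comp (Real.tendsto_sqrt_atTop.comp
    (tendsto_natCast_atTop_atTop (R := ℝ))))

lemma IsLittleOP.sum {ι : Type*} (s : Finset ι) {f : ι → ℕ → Ω → ℝ}
    (hf : ∀ i ∈ s, IsLittleOP μ (f i)) : IsLittleOP μ fun n ω => ∑ i ∈ s, f i n ω := by
  classical
  induction s using Finset.induction_on with
  | empty => simpa using isLittleOP_zero
  | insert i s hi ih =>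
    simp only [Finset.sum_insert hi]
    exact (hf i (by simp)).add (ih fun j hj => hf j (by simp [hj]))

lemma IsBigOP.sum {ι : Type*} (s : Finset ι) {f : ι → ℕ → Ω → ℝ}
    (hf : ∀ i ∈ s, IsBigOP μ (f i)) : IsBigOP μ fun n ω => ∑ i ∈ s, f i n ω := by
  classical
  induction s using Finset.induction_on with
  | empty => simpa using isBigOP_const 0
  | insert i s hi ih =>
    simp only [Finset.sum_insert hi]
    exact (hf i (by simp)).add (ih fun j hj => hf j (by simp [hj]))

lemma IsLittleOP.isBigOP_of_sub {c : ℝ} (hf : IsLittleOP μ fun n ω => f n ω - c) :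
    IsBigOP μ f := by
  simpa using hf.isBigOP.add (isBigOP_const c)

lemma IsLittleOP.sqrt (hf : IsLittleOP μ f) : IsLittleOP μ fun n ω => √(f n ω) := by
  rw [isLittleOP_iff] at hf ⊢
  intro η hη ε hε
  filter_upwards [hf (η ^ 2) (by positivity) ε hε] with n hn
  refine le_trans (measure_mono fun ω (hω : η ≤ |√(f n ω)|) => ?_) hn
  rw [abs_of_nonneg (Real.sqrt_nonneg _), Real.le_sqrt' hη] at hω
  exact le_trans hω (le_abs_self _)

lemma IsBigOP.sqrt (hf : IsBigOP μ f) : IsBigOP μ fun n ω => √(f n ω) := by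
  intro ε hε
  obtain ⟨C, hC, h1⟩ := hf ε hε
  refine ⟨√C, by positivity, ?_⟩
  filter_upwards [h1] with n hn
  refine le_trans (measure_mono fun ω (hω : √C < |√(f n ω)|) => ?_) hn
  rw [abs_of_nonneg (Real.sqrt_nonneg _)] at hω
  have := (Real.sqrt_lt_sqrt_iff hC.le).1 hω
  exact lt_of_lt_of_le this (le_abs_self _)

lemma IsBigOP.mul (hf : IsBigOP μ f) (hg : IsBigOP μ g) :
    IsBigOP μ fun n ω => f n ω * g n ω := by
  intro ε hε
  have hε2 : 0 < ε / 2 := ENNReal.half_pos hε.ne'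
  obtain ⟨C, hC, h1⟩ := hf _ hε2
  obtain ⟨C', hC', h2⟩ := hg _ hε2
  refine ⟨C * C', by positivity, ?_⟩
  filter_upwards [h1, h2] with n h1 h2
  calc μ {ω | C * C' < |f n ω * g n ω|} ≤ μ ({ω | C < |f n ω|} ∪ {ω | C' < |g n ω|}) := by
        apply measure_mono
        intro ω (hω : C * C' < |f n ω * g n ω|)
        by_contra hcon
        simp only [Set.mem_union, Set.mem_ofPred_eq, not_or, not_lt] at hcon
        rw [abs_mul] at hω
        have := mul_le_mul hcon.1 hcon.2 (abs_nonneg _) hC.le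
        linarith
    _ ≤ _ := measure_union_le _ _
    _ ≤ ε / 2 + ε / 2 := add_le_add h1 h2
    _ = ε := ENNReal.add_halves ε

/-- Markov's inequality: convergence in mean implies convergence in probability. -/
lemma isLittleOP_of_lintegral (hf : ∀ᶠ n in atTop, AEMeasurable (f n) μ)
    (h : Tendsto (fun n => ∫⁻ ω, ‖f n ω‖ₑ ∂μ) atTop (𝓝 0)) : IsLittleOP μ f := by
  rw [isLittleOP_iff]
  intro η hη ε hε
  have hη' : 0 < ENNReal.ofReal η := ENNReal.ofReal_pos.2 hη
  have h2 := ENNReal.tendsto_nhds_zero.1 h (ε * ENNReal.ofReal η)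
    (ENNReal.mul_pos hε.ne' hη'.ne')
  filter_upwards [h2, hf] with n hn hf
  have := meas_ge_le_lintegral_div (hf.enorm) hη'.ne' ENNReal.ofReal_ne_top
  refine le_trans (measure_mono fun ω (hω : η ≤ |f n ω|) => ?_) (this.trans ?_)
  · simp only [Set.mem_ofPred_eq]
    rw [Real.enorm_eq_ofReal_abs]
    exact ENNReal.ofReal_le_ofReal hω
  · exact ENNReal.div_le_of_le_mul hn

/-- Chebyshev's inequality: convergence in mean square implies convergence in probability. -/
lemma isLittleOP_of_integral_sq (hf : ∀ᶠ n in atTop, MemLp (f n) 2 μ)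
    (h : Tendsto (fun n => ∫ ω, f n ω ^ 2 ∂μ) atTop (𝓝 0)) : IsLittleOP μ f := by
  have h1 : IsLittleOP μ fun n ω => f n ω ^ 2 := by
    refine isLittleOP_of_lintegral
      (hf.mono fun n hn => hn.aestronglyMeasurable.aemeasurable.pow_const 2) ?_
    have h2 := ENNReal.tendsto_ofReal h
    rw [ENNReal.ofReal_zero] at h2
    refine h2.congr' (hf.mono fun n hn => ?_)
    rw [ofReal_integral_eq_lintegral_ofReal hn.integrable_sq
      (Eventually.of_forall fun ω => sq_nonneg _)]
    refine lintegral_congr fun ω => ?_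
    rw [Real.enorm_eq_ofReal (sq_nonneg _)]
  refine h1.sqrt.of_bound (Eventually.of_forall fun n => Eventually.of_forall fun ω => ?_)
  rw [Real.sqrt_sq_eq_abs, abs_abs]

/-- Chebyshev's inequality: sequences that are bounded in mean square are `O_p(1)`. -/
lemma isBigOP_of_integral_sq_le [IsFiniteMeasure μ] {C : ℝ} (hf : ∀ᶠ n in atTop, MemLp (f n) 2 μ)
    (h : ∀ᶠ n in atTop, ∫ ω, f n ω ^ 2 ∂μ ≤ C) : IsBigOP μ f := by
  intro ε hε
  by_cases htop : ε = ∞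
  · exact ⟨1, one_pos, Eventually.of_forall fun n => htop ▸ le_top⟩
  have hε' : 0 < ε.toReal := ENNReal.toReal_pos hε.ne' htop
  have hC : 0 < (|C| + 1) / ε.toReal := by positivity
  refine ⟨√((|C| + 1) / ε.toReal), Real.sqrt_pos.2 hC, ?_⟩
  filter_upwards [hf, h] with n hf h
  have h1 := mul_meas_ge_le_integral_of_nonneg (Eventually.of_forall fun ω => sq_nonneg (f n ω))
    hf.integrable_sq ((|C| + 1) / ε.toReal)
  have h2 : μ.real {ω | (|C| + 1) / ε.toReal ≤ f n ω ^ 2} ≤ ε.toReal := by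
    rw [← le_div_iff₀' hC] at h1
    refine h1.trans ?_
    rw [div_le_iff₀ hC, mul_div_cancel₀ _ hε'.ne']
    linarith [le_abs_self C]
  have hfin : μ {ω | (|C| + 1) / ε.toReal ≤ f n ω ^ 2} ≠ ∞ := measure_ne_top _ _
  refine le_trans (measure_mono fun ω (hω : _ < |f n ω|) => ?_)
    ((ENNReal.le_ofReal_iff_toReal_le hfin hε'.le).2 h2 |>.trans (ENNReal.ofReal_toReal htop).le)
  rw [Real.sqrt_lt' (lt_of_le_of_lt (Real.sqrt_nonneg _) hω), sq_abs] at hω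
  exact hω.le

end StochasticOrder

end SpecTest

/-! ### Second moments of U-statistics -/

namespace SpecTest

section UStatistic

variable {Ω S : Type*} {D : ℕ → Ω → S}

/-- The sum of `h (D_i, D_j)` over the ordered pairs of distinct indices below `n`. -/
def usum (D : ℕ → Ω → S) (h : S × S → ℝ) (n : ℕ) (ω : Ω) : ℝ :=
  ∑ p ∈ (Finset.range n).offDiag, h (D p.1 ω, D p.2 ω)

/-- The U-statistic of order two with kernel `h`, not necessarily symmetric:
the average of `h (D_i, D_j)` over the ordered pairs of distinct indices below `n`. -/
noncomputable def uavg (D : ℕ → Ω → S) (h : S × S → ℝ) (n : ℕ) (ω : Ω) : ℝ :=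
  ((n : ℝ) * ((n : ℝ) - 1))⁻¹ * usum D h n ω

lemma card_offDiag_range (n : ℕ) :
    (((Finset.range n).offDiag.card : ℕ) : ℝ) = (n : ℝ) * ((n : ℝ) - 1) := by
  rw [Finset.offDiag_card, Finset.card_range, Nat.cast_sub (Nat.le_mul_self n)]
  push_cast
  ring

lemma mul_pred_pos {n : ℕ} (hn : 2 ≤ n) : (0 : ℝ) < (n : ℝ) * ((n : ℝ) - 1) := by
  have : (2 : ℝ) ≤ n := by exact_mod_cast hn
  nlinarith

lemma uavg_add (h h' : S × S → ℝ) (n : ℕ) (ω : Ω) :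
    uavg D (fun p => h p + h' p) n ω = uavg D h n ω + uavg D h' n ω := by
  simp only [uavg, usum, Finset.sum_add_distrib, mul_add]

lemma uavg_sub (h h' : S × S → ℝ) (n : ℕ) (ω : Ω) :
    uavg D (fun p => h p - h' p) n ω = uavg D h n ω - uavg D h' n ω := by
  simp only [uavg, usum, Finset.sum_sub_distrib, mul_sub]

lemma uavg_const_mul (c : ℝ) (h : S × S → ℝ) (n : ℕ) (ω : Ω) :
    uavg D (fun p => c * h p) n ω = c * uavg D h n ω := by
  simp only [uavg, usum, ← Finset.mul_sum]
  ring

lemma uavg_sum_mul {ι : Type*} (s : Finset ι) (c : ι → ℝ) (h : ι → S × S → ℝ) (n : ℕ) (ω : Ω) :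
    uavg D (fun p => ∑ m ∈ s, c m * h m p) n ω = ∑ m ∈ s, c m * uavg D (h m) n ω := by
  simp only [uavg, usum]
  rw [Finset.sum_comm]
  simp only [Finset.mul_sum]
  exact Finset.sum_congr rfl fun _ _ => Finset.sum_congr rfl fun _ _ => by ring

lemma uavg_const (c : ℝ) {n : ℕ} (hn : 2 ≤ n) (ω : Ω) : uavg D (fun _ => c) n ω = c := by
  have := mul_pred_pos hn
  rw [uavg, usum, Finset.sum_const, nsmul_eq_mul, card_offDiag_range,
    inv_mul_cancel_left₀ this.ne']

lemma usum_swap (h : S × S → ℝ) (n : ℕ) (ω : Ω) :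
    usum D (fun p => h p.swap) n ω = usum D h n ω := by
  unfold usum
  refine Finset.sum_bij' (fun p _ => p.swap) (fun p _ => p.swap) ?_ ?_ ?_ ?_ ?_ <;>
    simp +contextual [eq_comm]

/-- A kernel that depends on its first argument only turns a U-statistic into a sample mean. -/
lemma uavg_fst (f : S → ℝ) {n : ℕ} (hn : 2 ≤ n) (ω : Ω) :
    uavg D (fun p => f p.1) n ω = (n : ℝ)⁻¹ * ∑ i ∈ Finset.range n, f (D i ω) := by
  have h1 := mul_pred_pos hn
  have h2 : (2 : ℝ) ≤ n := by exact_mod_cast hn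
  have h3 : usum D (fun p => f p.1) n ω = ((n : ℝ) - 1) * ∑ i ∈ Finset.range n, f (D i ω) := by
    unfold usum
    have h4 : ∑ p ∈ Finset.range n ×ˢ Finset.range n, f (D p.1 ω) =
        ∑ p ∈ (Finset.range n).diag, f (D p.1 ω) +
        ∑ p ∈ (Finset.range n).offDiag, f (D p.1 ω) := by
      rw [← Finset.sum_union (Finset.disjoint_diag_offDiag _), Finset.diag_union_offDiag]
    rw [Finset.sum_product, Finset.sum_diag] at h4
    simp only [Finset.sum_const, Finset.card_range, nsmul_eq_mul] at h4
    rw [← Finset.mul_sum] at h4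
    linarith
  rw [uavg, h3]
  have : (n : ℝ) - 1 ≠ 0 := by linarith
  field_simp

lemma uavg_snd (f : S → ℝ) {n : ℕ} (hn : 2 ≤ n) (ω : Ω) :
    uavg D (fun p => f p.2) n ω = (n : ℝ)⁻¹ * ∑ i ∈ Finset.range n, f (D i ω) := by
  rw [← uavg_fst f hn, uavg, uavg, ← usum_swap]
  rfl

variable [MeasurableSpace Ω] [MeasurableSpace S] {μ : Measure Ω} {P : Measure S}
  [IsProbabilityMeasure μ] (hlaw : ∀ i, HasLaw (D i) P μ) (hind : iIndepFun D μ)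
include hlaw hind

lemma hasLaw_pair {i j : ℕ} (hij : i ≠ j) :
    HasLaw (fun ω => (D i ω, D j ω)) (P.prod P) μ where
  aemeasurable := (hlaw i).aemeasurable.prodMk (hlaw j).aemeasurable
  map_eq := by
    rw [(indepFun_iff_map_prod_eq_prod_map_map (hlaw i).aemeasurable (hlaw j).aemeasurable).1
      (hind.indepFun hij), (hlaw i).map_eq, (hlaw j).map_eq]

lemma memLp_pair {p : ℝ≥0∞} {h : S × S → ℝ} (hm : Measurable h) (h2 : MemLp h p (P.prod P))
    {i j : ℕ} (hij : i ≠ j) : MemLp (fun ω => h (D i ω, D j ω)) p μ := by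
  have hl := hasLaw_pair hlaw hind hij
  rw [← hl.map_eq] at h2
  exact (memLp_map_measure_iff hm.aestronglyMeasurable hl.aemeasurable).1 h2

lemma memLp_usum {p : ℝ≥0∞} {h : S × S → ℝ} (hm : Measurable h) (h2 : MemLp h p (P.prod P))
    (n : ℕ) : MemLp (usum D h n) p μ := by
  unfold usum
  refine memLp_finsetSum _ fun q hq => ?_
  exact memLp_pair hlaw hind hm h2 (Finset.mem_offDiag.1 hq).2.2

omit [IsProbabilityMeasure μ] hind in
lemma aemeasurable_usum {h : S × S → ℝ} (hm : Measurable h) (n : ℕ) :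
    AEMeasurable (usum D h n) μ := by
  unfold usum
  refine Finset.aemeasurable_fun_sum _ fun q _ => ?_
  exact hm.comp_aemeasurable ((hlaw _).aemeasurable.prodMk (hlaw _).aemeasurable)

omit [IsProbabilityMeasure μ] hind in
lemma aemeasurable_uavg {h : S × S → ℝ} (hm : Measurable h) (n : ℕ) :
    AEMeasurable (uavg D h n) μ :=
  (aemeasurable_usum hlaw hm n).const_mul _

/-- The `L¹` norm of a U-statistic is at most that of its kernel. -/
lemma lintegral_enorm_uavg_le {h : S × S → ℝ} (hm : Measurable h) (n : ℕ) :
    ∫⁻ ω, ‖uavg D h n ω‖ₑ ∂μ ≤ ∫⁻ p, ‖h p‖ₑ ∂(P.prod P) := by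
  by_cases hn : 2 ≤ n
  · have hpos := mul_pred_pos hn
    calc ∫⁻ ω, ‖uavg D h n ω‖ₑ ∂μ
        ≤ ∫⁻ ω, ‖((n : ℝ) * ((n : ℝ) - 1))⁻¹‖ₑ *
          ∑ p ∈ (Finset.range n).offDiag, ‖h (D p.1 ω, D p.2 ω)‖ₑ ∂μ := by
          refine lintegral_mono fun ω => ?_
          rw [uavg, enorm_mul]
          gcongr
          exact enorm_sum_le _ _
      _ = ‖((n : ℝ) * ((n : ℝ) - 1))⁻¹‖ₑ * ∑ p ∈ (Finset.range n).offDiag,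
            ∫⁻ p, ‖h p‖ₑ ∂(P.prod P) := by
          rw [lintegral_const_mul' _ _ enorm_ne_top, lintegral_finsetSum']
          · congr 1
            refine Finset.sum_congr rfl fun p hp => ?_
            exact (hasLaw_pair hlaw hind (Finset.mem_offDiag.1 hp).2.2).lintegral_comp
              hm.enorm.aemeasurable
          · intro p _
            exact (hm.comp_aemeasurable
              ((hlaw _).aemeasurable.prodMk (hlaw _).aemeasurable)).enorm
      _ = ∫⁻ p, ‖h p‖ₑ ∂(P.prod P) := by
          rw [Finset.sum_const, nsmul_eq_mul, ← mul_assoc]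
          have : ‖((n : ℝ) * ((n : ℝ) - 1))⁻¹‖ₑ * ((Finset.range n).offDiag.card : ℝ≥0∞) = 1 := by
            have h1 : ((Finset.range n).offDiag.card : ℝ≥0∞) =
                ENNReal.ofReal ((n : ℝ) * ((n : ℝ) - 1)) := by
              rw [← card_offDiag_range, ENNReal.ofReal_natCast]
            rw [h1, Real.enorm_of_nonneg (by positivity), ← ENNReal.ofReal_mul (by positivity),
              inv_mul_cancel₀ hpos.ne', ENNReal.ofReal_one]
          rw [this, one_mul]
  · have : uavg D h n = fun _ => 0 := by
      ext ω
      have : n = 0 ∨ n = 1 := by omega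
      rcases this with rfl | rfl <;> simp [uavg]
    simp [this]

/-- The second moment of a U-statistic, when each pair of indices is correlated with at most `c`
pairs of indices. -/
lemma integral_sq_usum_le {h : S × S → ℝ} (hm : Measurable h) (h2 : MemLp h 2 (P.prod P))
    {n : ℕ} (c : ℕ) (N : ℕ × ℕ → Finset (ℕ × ℕ)) (hN : ∀ p ∈ (Finset.range n).offDiag,
      (N p).card ≤ c)
    (hc : ∀ p ∈ (Finset.range n).offDiag, ∀ q ∈ (Finset.range n).offDiag, q ∉ N p →
      ∫ ω, h (D p.1 ω, D p.2 ω) * h (D q.1 ω, D q.2 ω) ∂μ = 0) :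
    ∫ ω, usum D h n ω ^ 2 ∂μ ≤ (n : ℝ) * ((n : ℝ) - 1) * c * ∫ p, h p ^ 2 ∂(P.prod P) := by
  classical
  set I := ∫ p, h p ^ 2 ∂(P.prod P) with hI
  have hI0 : 0 ≤ I := integral_nonneg fun p => sq_nonneg _
  have hmem : ∀ p ∈ (Finset.range n).offDiag, MemLp (fun ω => h (D p.1 ω, D p.2 ω)) 2 μ :=
    fun p hp => memLp_pair hlaw hind hm h2 (Finset.mem_offDiag.1 hp).2.2
  have hint : ∀ p ∈ (Finset.range n).offDiag, ∀ q ∈ (Finset.range n).offDiag,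
      Integrable (fun ω => h (D p.1 ω, D p.2 ω) * h (D q.1 ω, D q.2 ω)) μ :=
    fun p hp q hq => (hmem p hp).integrable_mul (hmem q hq)
  have hsq : ∀ p ∈ (Finset.range n).offDiag, ∫ ω, h (D p.1 ω, D p.2 ω) ^ 2 ∂μ = I := fun p hp =>
    (hasLaw_pair hlaw hind (Finset.mem_offDiag.1 hp).2.2).integral_comp
      (f := fun p => h p ^ 2) (hm.pow_const 2).aestronglyMeasurable
  have hbound : ∀ p ∈ (Finset.range n).offDiag, ∀ q ∈ (Finset.range n).offDiag,
      ∫ ω, h (D p.1 ω, D p.2 ω) * h (D q.1 ω, D q.2 ω) ∂μ ≤ if q ∈ N p then I else 0 := by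
    intro p hp q hq
    split_ifs with hqN
    · have h3 : ∫ ω, h (D p.1 ω, D p.2 ω) * h (D q.1 ω, D q.2 ω) ∂μ ≤
          ∫ ω, (h (D p.1 ω, D p.2 ω) ^ 2 / 2 + h (D q.1 ω, D q.2 ω) ^ 2 / 2) ∂μ := by
        refine integral_mono (hint p hp q hq)
          (((hmem p hp).integrable_sq.div_const 2).add ((hmem q hq).integrable_sq.div_const 2))
          fun ω => ?_
        nlinarith [sq_nonneg (h (D p.1 ω, D p.2 ω) - h (D q.1 ω, D q.2 ω))]
      rw [integral_add ((hmem p hp).integrable_sq.div_const 2)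
        ((hmem q hq).integrable_sq.div_const 2), integral_div, integral_div, hsq p hp,
        hsq q hq] at h3
      linarith
    · exact (hc p hp q hq hqN).le
  calc ∫ ω, usum D h n ω ^ 2 ∂μ
      = ∑ p ∈ (Finset.range n).offDiag, ∑ q ∈ (Finset.range n).offDiag,
          ∫ ω, h (D p.1 ω, D p.2 ω) * h (D q.1 ω, D q.2 ω) ∂μ := by
        simp only [usum, pow_two, Finset.sum_mul_sum]
        rw [integral_finsetSum _ fun p hp => integrable_finsetSum _ fun q hq => hint p hp q hq]
        exact Finset.sum_congr rfl fun p hp => integral_finsetSum _ fun q hq => hint p hp q hq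
    _ ≤ ∑ p ∈ (Finset.range n).offDiag, (c : ℝ) * I := by
        refine Finset.sum_le_sum fun p hp => ?_
        refine (Finset.sum_le_sum fun q hq => hbound p hp q hq).trans ?_
        rw [← Finset.sum_filter, Finset.sum_const, nsmul_eq_mul]
        have h4 : ((Finset.range n).offDiag.filter (· ∈ N p)).card ≤ c :=
          (Finset.card_le_card fun q hq => (Finset.mem_filter.1 hq).2).trans (hN p hp)
        gcongr
    _ = _ := by rw [Finset.sum_const, nsmul_eq_mul, card_offDiag_range]; ring

/-- If `∫ h (x, y) dP(y) = 0` for almost all `x`, then `h (D_i, D_j)` is orthogonal to all square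
integrable functions of observations other than `D_j`. -/
lemma integral_mul_pair_eq_zero [IsProbabilityMeasure P] {h h' : S × S → ℝ}
    (hm : Measurable h) (h2 : MemLp h 2 (P.prod P)) (hm' : Measurable h')
    (h2' : MemLp h' 2 (P.prod P))
    (hdeg : ∀ᵐ x ∂P, ∫ y, h (x, y) ∂P = 0) {i j k l : ℕ} (hij : i ≠ j) (hkj : k ≠ j)
    (hlj : l ≠ j) (hkl : k ≠ l) :
    ∫ ω, h (D i ω, D j ω) * h' (D k ω, D l ω) ∂μ = 0 := by
  -- `D_j` is integrated out first, conditionally on the observations with indices in `T`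
  let T : Finset ℕ := {i, k, l}
  let iT : T := ⟨i, by simp [T]⟩
  let kT : T := ⟨k, by simp [T]⟩
  let lT : T := ⟨l, by simp [T]⟩
  let A : Ω → (T → S) := fun ω t => D t ω
  have hA : AEMeasurable A μ := aemeasurable_pi_lambda _ fun t => (hlaw t).aemeasurable
  have hind1 : IndepFun A (D j) μ := by
    have h3 := hind.indepFun_finset₀ T {j} (by simp [T, hij.symm, hkj.symm, hlj.symm])
      fun i => (hlaw i).aemeasurable
    exact h3.comp (φ := id) (ψ := fun b : (({j} : Finset ℕ) → S) => b ⟨j, by simp⟩)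
      measurable_id (measurable_pi_apply _)
  have hmap := (indepFun_iff_map_prod_eq_prod_map_map hA (hlaw j).aemeasurable).1 hind1
  rw [(hlaw j).map_eq] at hmap
  let F : (T → S) × S → ℝ := fun q => h (q.1 iT, q.2) * h' (q.1 kT, q.1 lT)
  have hF : Measurable F :=
    (hm.comp (((measurable_pi_apply iT).comp measurable_fst).prodMk measurable_snd)).mul
      (hm'.comp (((measurable_pi_apply kT).comp measurable_fst).prodMk
        ((measurable_pi_apply lT).comp measurable_fst)))
  have hAD : AEMeasurable (fun ω => (A ω, D j ω)) μ := hA.prodMk (hlaw j).aemeasurable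
  have : IsProbabilityMeasure (μ.map A) := Measure.isProbabilityMeasure_map hA
  have e1 : ∫ ω, h (D i ω, D j ω) * h' (D k ω, D l ω) ∂μ = ∫ q, F q ∂((μ.map A).prod P) := by
    rw [← hmap, integral_map hAD hF.aestronglyMeasurable]
  have hint : Integrable F ((μ.map A).prod P) := by
    rw [← hmap, integrable_map_measure hF.aestronglyMeasurable hAD]
    exact (memLp_pair hlaw hind hm h2 hij).integrable_mul (memLp_pair hlaw hind hm' h2' hkl)
  rw [e1, integral_prod _ hint]
  refine integral_eq_zero_of_ae ?_
  have hdi : ∀ᵐ b ∂(μ.map A), ∫ y, h (b iT, y) ∂P = 0 := by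
    have hset : Measurable fun x => ∫ y, h (x, y) ∂P :=
      (StronglyMeasurable.integral_prod_right (f := fun x y => h (x, y))
        hm.stronglyMeasurable).measurable
    have h4 : ∀ᵐ ω ∂μ, ∫ y, h (D i ω, y) ∂P = 0 := by
      rw [← (hlaw i).map_eq] at hdeg
      exact ae_of_ae_map (hlaw i).aemeasurable (by simpa [(hlaw i).map_eq] using hdeg)
    exact (ae_map_iff hA (measurableSet_eq_fun (hset.comp (measurable_pi_apply iT))
      measurable_const)).2 h4
  filter_upwards [hdi] with b hb
  simp only [F, integral_mul_const, hb, zero_mul, Pi.zero_apply]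

/-- Mean-zero kernels: pairs of indices are uncorrelated unless they share an index, and at most
`4 n` pairs share an index with a given one. -/
lemma integral_sq_usum_le_of_mean_zero {h : S × S → ℝ} (hm : Measurable h)
    (h2 : MemLp h 2 (P.prod P)) (h0 : ∫ p, h p ∂(P.prod P) = 0) (n : ℕ) :
    ∫ ω, usum D h n ω ^ 2 ∂μ ≤
      (n : ℝ) * ((n : ℝ) - 1) * (4 * n : ℕ) * ∫ p, h p ^ 2 ∂(P.prod P) := by
  classical
  let R := Finset.range n
  refine integral_sq_usum_le hlaw hind hm h2 (4 * n)
    (fun p => (({p.1} ×ˢ R) ∪ ({p.2} ×ˢ R)) ∪ ((R ×ˢ {p.1}) ∪ (R ×ˢ {p.2}))) ?_ ?_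
  · intro p _
    refine (Finset.card_union_le _ _).trans ?_
    have h3 := Finset.card_union_le ({p.1} ×ˢ R) ({p.2} ×ˢ R)
    have h4 := Finset.card_union_le (R ×ˢ {p.1}) (R ×ˢ {p.2})
    simp only [Finset.card_product, Finset.card_singleton, R, Finset.card_range] at h3 h4 ⊢
    omega
  · rintro ⟨i, j⟩ hp ⟨k, l⟩ hq hN
    simp only [Finset.mem_offDiag, Finset.mem_range] at hp hq
    simp only [Finset.mem_union, Finset.mem_product, Finset.mem_singleton, R,
      Finset.mem_range, not_or, not_and] at hN
    have hi := hind.indepFun_prodMk_prodMk₀ (fun i => (hlaw i).aemeasurable) i j k l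
      (by grind) (by grind) (by grind) (by grind)
    have h5 := (hi.comp hm hm).integral_mul_eq_mul_integral
      (memLp_pair hlaw hind hm h2 hp.2.2).aestronglyMeasurable
      (memLp_pair hlaw hind hm h2 hq.2.2).aestronglyMeasurable
    have h6 : ∫ ω, (h ∘ fun ω => (D i ω, D j ω)) ω ∂μ = 0 := by
      rw [← h0]
      exact (hasLaw_pair hlaw hind hp.2.2).integral_comp hm.aestronglyMeasurable
    rw [h6, zero_mul] at h5
    exact h5

/-- Degenerate kernels: pairs of indices are uncorrelated unless they agree as sets, so only `p` and
`p.swap` contribute. -/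
lemma integral_sq_usum_le_of_degenerate [IsProbabilityMeasure P] {h : S × S → ℝ} (hm : Measurable h)
    (h2 : MemLp h 2 (P.prod P)) (hr : ∀ᵐ x ∂P, ∫ y, h (x, y) ∂P = 0)
    (hl : ∀ᵐ y ∂P, ∫ x, h (x, y) ∂P = 0) (n : ℕ) :
    ∫ ω, usum D h n ω ^ 2 ∂μ ≤
      (n : ℝ) * ((n : ℝ) - 1) * (2 : ℕ) * ∫ p, h p ^ 2 ∂(P.prod P) := by
  classical
  refine integral_sq_usum_le hlaw hind hm h2 2 (fun p => {p, p.swap}) ?_ ?_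
  · intro p _
    exact Finset.card_le_two
  · rintro ⟨i, j⟩ hp ⟨k, l⟩ hq hN
    simp only [Finset.mem_offDiag, Finset.mem_range] at hp hq
    simp only [Prod.swap_prod_mk, Finset.mem_insert, Prod.mk.injEq, Finset.mem_singleton,
      not_or, not_and] at hN
    by_cases hj : k ≠ j ∧ l ≠ j
    · exact integral_mul_pair_eq_zero hlaw hind hm h2 hm h2 hr hp.2.2 hj.1 hj.2 hq.2.2
    -- otherwise the first index `i` occurs only once, and the swapped kernel is used
    · have hms : Measurable fun p : S × S => h p.swap := hm.comp measurable_swap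
      have h2s : MemLp (fun p : S × S => h p.swap) 2 (P.prod P) :=
        h2.comp_measurePreserving Measure.measurePreserving_swap
      exact integral_mul_pair_eq_zero hlaw hind hms h2s hm h2 hl (i := j) (j := i)
        hp.2.2.symm (by grind) (by grind) hq.2.2

/-- The constant absorbs the factor `4 n / (n - 1) ≤ 8`. -/
lemma integral_sq_sqrt_mul_uavg_le {h : S × S → ℝ} (hm : Measurable h)
    (h2 : MemLp h 2 (P.prod P)) (h0 : ∫ p, h p ∂(P.prod P) = 0) {n : ℕ} (hn : 2 ≤ n) :
    ∫ ω, (√(n : ℝ) * uavg D h n ω) ^ 2 ∂μ ≤ 8 * ∫ p, h p ^ 2 ∂(P.prod P) := by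
  have hpos := mul_pred_pos hn
  have hn2 : (2 : ℝ) ≤ n := by exact_mod_cast hn
  have h4 := integral_sq_usum_le_of_mean_zero hlaw hind hm h2 h0 n
  have hI0 : 0 ≤ ∫ p, h p ^ 2 ∂(P.prod P) := integral_nonneg fun p => sq_nonneg _
  have e : ∀ ω, (√(n : ℝ) * uavg D h n ω) ^ 2 =
      n * (((n : ℝ) * ((n : ℝ) - 1))⁻¹ ^ 2 * usum D h n ω ^ 2) := fun ω => by
    rw [uavg, mul_pow, mul_pow, Real.sq_sqrt (by positivity)]
  simp only [e, integral_const_mul]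
  set I := ∫ p, h p ^ 2 ∂(P.prod P)
  calc _ ≤ (n : ℝ) * (((n : ℝ) * ((n : ℝ) - 1))⁻¹ ^ 2 *
        ((n : ℝ) * ((n : ℝ) - 1) * (4 * n : ℕ) * I)) := by gcongr
    _ = 4 * n / ((n : ℝ) - 1) * I := by
      have : (n : ℝ) - 1 ≠ 0 := by linarith
      push_cast
      field_simp
    _ ≤ 8 * I := by
      gcongr
      rw [div_le_iff₀ (by linarith)]
      linarith

/-- A U-statistic with mean-zero kernels that tend to `0` in mean square is `o_p(n^{-1/2})`. -/
lemma isLittleOP_sqrt_mul_uavg_of_tendsto {h : ℕ → S × S → ℝ} (hm : ∀ n, Measurable (h n))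
    (h2 : ∀ᶠ n in atTop, MemLp (h n) 2 (P.prod P))
    (h0 : ∀ᶠ n in atTop, ∫ p, h n p ∂(P.prod P) = 0)
    (hlim : Tendsto (fun n => ∫ p, h n p ^ 2 ∂(P.prod P)) atTop (𝓝 0)) :
    IsLittleOP μ fun n ω => √(n : ℝ) * uavg D (h n) n ω := by
  refine isLittleOP_of_integral_sq ?_ ?_
  · filter_upwards [h2] with n h2
    exact ((memLp_usum hlaw hind (hm n) h2 n).const_mul _).const_mul _
  · have h3 : Tendsto (fun n => 8 * ∫ p, h n p ^ 2 ∂(P.prod P)) atTop (𝓝 0) := by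
      simpa using hlim.const_mul 8
    refine tendsto_of_tendsto_of_tendsto_of_le_of_le' tendsto_const_nhds h3
      (Eventually.of_forall fun n => integral_nonneg fun ω => sq_nonneg _) ?_
    filter_upwards [h2, h0, eventually_ge_atTop 2] with n h2 h0 hn
    exact integral_sq_sqrt_mul_uavg_le hlaw hind (hm n) h2 h0 hn

/-- The normalized sum of i.i.d. centred square integrable variables is `O_p(1)`. -/
lemma isBigOP_inv_sqrt_mul_sum [IsProbabilityMeasure P] {f : S → ℝ} (hm : Measurable f)
    (h2 : MemLp f 2 P) (h0 : ∫ x, f x ∂P = 0) :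
    IsBigOP μ fun n ω => (√(n : ℝ))⁻¹ * ∑ i ∈ Finset.range n, f (D i ω) := by
  have hm1 : Measurable fun p : S × S => f p.1 := hm.comp measurable_fst
  have h21 : MemLp (fun p : S × S => f p.1) 2 (P.prod P) := h2.comp_fst P
  have h01 : ∫ p : S × S, f p.1 ∂(P.prod P) = 0 := by
    rw [integral_fun_fst, h0, smul_zero]
  have key : IsBigOP μ fun n ω => √(n : ℝ) * uavg D (fun p => f p.1) n ω := by
    refine isBigOP_of_integral_sq_le (C := 8 * ∫ p : S × S, f p.1 ^ 2 ∂(P.prod P))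
      (Eventually.of_forall fun n =>
      ((memLp_usum hlaw hind hm1 h21 n).const_mul _).const_mul _) ?_
    filter_upwards [eventually_ge_atTop 2] with n hn
    exact integral_sq_sqrt_mul_uavg_le hlaw hind hm1 h21 h01 hn
  refine key.of_bound ?_
  filter_upwards [eventually_ge_atTop 2] with n hn
  refine Eventually.of_forall fun ω => le_of_eq ?_
  have hn0 : (0 : ℝ) < n := by exact_mod_cast (by omega : 0 < n)
  rw [uavg_fst f hn, ← mul_assoc, ← div_eq_mul_inv, Real.sqrt_div_self', one_div]

/-- A U-statistic with a degenerate kernel is `o_p(n^{-1/2})`. -/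
lemma isLittleOP_sqrt_mul_uavg_of_degenerate [IsProbabilityMeasure P] {h : S × S → ℝ}
    (hm : Measurable h) (h2 : MemLp h 2 (P.prod P)) (hr : ∀ᵐ x ∂P, ∫ y, h (x, y) ∂P = 0)
    (hl : ∀ᵐ y ∂P, ∫ x, h (x, y) ∂P = 0) :
    IsLittleOP μ fun n ω => √(n : ℝ) * uavg D h n ω := by
  refine isLittleOP_of_integral_sq ?_ ?_
  · exact Eventually.of_forall fun n => ((memLp_usum hlaw hind hm h2 n).const_mul _).const_mul _
  · set I := ∫ p, h p ^ 2 ∂(P.prod P) with hI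
    have h3 : Tendsto (fun n : ℕ => 4 * I * (n : ℝ)⁻¹) atTop (𝓝 0) := by
      simpa using (tendsto_inv_atTop_nhds_zero_nat (𝕜 := ℝ)).const_mul (4 * I)
    refine tendsto_of_tendsto_of_tendsto_of_le_of_le' tendsto_const_nhds h3
      (Eventually.of_forall fun n => integral_nonneg fun ω => sq_nonneg _) ?_
    filter_upwards [eventually_ge_atTop 2] with n hn
    have hpos := mul_pred_pos hn
    have hn2 : (2 : ℝ) ≤ n := by exact_mod_cast hn
    have h4 := integral_sq_usum_le_of_degenerate hlaw hind hm h2 hr hl n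
    have hI0 : 0 ≤ I := integral_nonneg fun p => sq_nonneg _
    have e : ∀ ω, (√(n : ℝ) * uavg D h n ω) ^ 2 =
        n * (((n : ℝ) * ((n : ℝ) - 1))⁻¹ ^ 2 * usum D h n ω ^ 2) := fun ω => by
      rw [uavg, mul_pow, mul_pow, Real.sq_sqrt (by positivity)]
    simp only [e, integral_const_mul]
    calc _ ≤ (n : ℝ) * (((n : ℝ) * ((n : ℝ) - 1))⁻¹ ^ 2 *
          ((n : ℝ) * ((n : ℝ) - 1) * (2 : ℕ) * I)) := by gcongr
      _ = I * (2 / ((n : ℝ) - 1)) := by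
        have : (n : ℝ) - 1 ≠ 0 := by linarith
        push_cast
        field_simp
      _ ≤ I * (4 / n) := by
        gcongr I * ?_
        rw [div_le_div_iff₀ (by linarith) (by linarith)]
        linarith
      _ = 4 * I * (n : ℝ)⁻¹ := by ring

end UStatistic

end SpecTest

/-! ### Hájek projection and laws of large numbers -/

namespace SpecTest

section Approximation

variable {Ω : Type*} [MeasurableSpace Ω] {μ : Measure Ω} {f : ℕ → Ω → ℝ}

/-- A sequence that is, for each `ε`, dominated by an `o_p(1)` sequence plus a sequence of
`L¹` norm at most `ε` is itself `o_p(1)`. -/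
lemma isLittleOP_of_approx (h : ∀ ε : ℝ≥0∞, 0 < ε → ∃ g d : ℕ → Ω → ℝ, IsLittleOP μ g ∧
      (∀ᶠ n in atTop, AEMeasurable (d n) μ) ∧ (∀ᶠ n in atTop, ∫⁻ ω, ‖d n ω‖ₑ ∂μ ≤ ε) ∧
      ∀ᶠ n in atTop, ∀ᵐ ω ∂μ, |f n ω| ≤ |g n ω| + |d n ω|) : IsLittleOP μ f := by
  rw [isLittleOP_iff]
  intro η hη ε hε
  have hη' : 0 < ENNReal.ofReal (η / 2) := ENNReal.ofReal_pos.2 (by positivity)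
  have hε2 : 0 < ε / 2 := ENNReal.half_pos hε.ne'
  obtain ⟨g, d, hg, hdm, hd, hb⟩ := h (ε / 2 * ENNReal.ofReal (η / 2))
    (ENNReal.mul_pos hε2.ne' hη'.ne')
  filter_upwards [hdm, hd, hb, isLittleOP_iff.1 hg (η / 2) (by positivity) _ hε2] with n h1 h2 h3 h4
  calc μ {ω | η ≤ |f n ω|}
      ≤ μ ({ω | η / 2 ≤ |g n ω|} ∪ {ω | ENNReal.ofReal (η / 2) ≤ ‖d n ω‖ₑ}) := by
        apply measure_mono_ae
        filter_upwards [h3] with ω h3 (hω : η ≤ |f n ω|)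
        change ω ∈ {ω | η / 2 ≤ |g n ω|} ∪ {ω | ENNReal.ofReal (η / 2) ≤ ‖d n ω‖ₑ}
        by_contra hcon
        simp only [Set.mem_union, Set.mem_ofPred_eq, not_or, not_le,
          Real.enorm_eq_ofReal_abs] at hcon
        have := (ENNReal.ofReal_lt_ofReal_iff (by positivity)).1 hcon.2
        linarith
    _ ≤ _ := measure_union_le _ _
    _ ≤ ε / 2 + ε / 2 := by
        refine add_le_add h4
          ((meas_ge_le_lintegral_div h1.enorm hη'.ne' ENNReal.ofReal_ne_top).trans ?_)
        exact ENNReal.div_le_of_le_mul h2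
    _ = ε := ENNReal.add_halves ε

end Approximation

section Projection

variable {S : Type*} [MeasurableSpace S] {P : Measure S} [IsProbabilityMeasure P]
  {h : S × S → ℝ}

lemma measurable_integral_snd (hm : Measurable h) : Measurable fun x => ∫ y, h (x, y) ∂P :=
  (StronglyMeasurable.integral_prod_right (f := fun x y => h (x, y))
    hm.stronglyMeasurable).measurable

/-- The projection of a square integrable kernel is square integrable, by Jensen's inequality. -/
lemma memLp_integral_snd (hm : Measurable h) (h2 : MemLp h 2 (P.prod P)) :
    MemLp (fun x => ∫ y, h (x, y) ∂P) 2 P := by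
  have hm1 := measurable_integral_snd (P := P) hm
  rw [memLp_two_iff_integrable_sq hm1.aestronglyMeasurable]
  refine Integrable.mono' h2.integrable_sq.integral_prod_left
    (hm1.pow_const 2).aestronglyMeasurable ?_
  filter_upwards [h2.integrable_sq.prod_right_ae] with x hx
  rw [Real.norm_of_nonneg (sq_nonneg _)]
  have h3 : MemLp (fun y => h (x, y)) 2 P :=
    (memLp_two_iff_integrable_sq (hm.comp measurable_prodMk_left).aestronglyMeasurable).2 hx
  have h4 := variance_nonneg (fun y => h (x, y)) P
  rw [variance_eq_sub h3] at h4
  simpa using h4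

end Projection

section UStatistic

variable {Ω S : Type*} [MeasurableSpace Ω] [MeasurableSpace S] {μ : Measure Ω} {P : Measure S}
  {D : ℕ → Ω → S} [IsProbabilityMeasure μ] [IsProbabilityMeasure P]
  (hlaw : ∀ i, HasLaw (D i) P μ) (hind : iIndepFun D μ)
include hlaw hind

/-- Hájek projection: a U-statistic with a symmetric mean-zero kernel `h` is asymptotically
equivalent to twice the sample mean of `h₁ (x) = ∫ h (x, y) dP(y)`. -/
lemma isLittleOP_uavg_sub_projection {h : S × S → ℝ} (hm : Measurable h)
    (h2 : MemLp h 2 (P.prod P)) (h0 : ∫ p, h p ∂(P.prod P) = 0) (hsymm : ∀ p, h p.swap = h p) :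
    IsLittleOP μ fun n ω => √(n : ℝ) * uavg D h n ω -
      (√(n : ℝ))⁻¹ * ∑ i ∈ Finset.range n, 2 * ∫ y, h (D i ω, y) ∂P := by
  set h1 : S → ℝ := fun x => ∫ y, h (x, y) ∂P with hh1
  have hm1 : Measurable h1 := measurable_integral_snd hm
  have h21 : MemLp h1 2 P := memLp_integral_snd hm h2
  have h01 : ∫ x, h1 x ∂P = 0 := by
    rw [← h0, integral_prod _ (h2.integrable one_le_two)]
  have hmd : Measurable fun p : S × S => h p - (h1 p.1 + h1 p.2) :=
    hm.sub ((hm1.comp measurable_fst).add (hm1.comp measurable_snd))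
  have h2d : MemLp (fun p : S × S => h p - (h1 p.1 + h1 p.2)) 2 (P.prod P) :=
    h2.sub ((h21.comp_fst P).add (h21.comp_snd P))
  have hi1 : Integrable h1 P := h21.integrable one_le_two
  -- the kernel `h (x, y) - h₁ x - h₁ y` is degenerate
  have hr : ∀ᵐ x ∂P, ∫ y, (h (x, y) - (h1 x + h1 y)) ∂P = 0 := by
    filter_upwards [(h2.integrable one_le_two).prod_right_ae] with x hx
    have e1 : ∫ y, (h1 x + h1 y) ∂P = h1 x := by
      rw [integral_add (integrable_const _) hi1, h01]
      simp
    have e2 : Integrable (fun y => h1 x + h1 y) P := (integrable_const (h1 x)).add hi1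
    rw [integral_sub hx e2, e1, sub_self]
  have hl : ∀ᵐ y ∂P, ∫ x, (h (x, y) - (h1 x + h1 y)) ∂P = 0 := by
    filter_upwards [hr] with y hy
    rw [← hy]
    refine integral_congr_ae (Eventually.of_forall fun x => ?_)
    have := hsymm (y, x)
    simp only [Prod.swap_prod_mk] at this
    simp only [this]
    ring
  refine (isLittleOP_sqrt_mul_uavg_of_degenerate hlaw hind hmd h2d hr hl).congr ?_
  filter_upwards [eventually_ge_atTop 2] with n hn
  refine Eventually.of_forall fun ω => ?_
  have hn0 : (0 : ℝ) < n := by exact_mod_cast (by omega : 0 < n)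
  rw [uavg_sub, uavg_add, uavg_fst h1 hn, uavg_snd h1 hn, ← Finset.mul_sum]
  have e : (√(n : ℝ))⁻¹ = √(n : ℝ) * (n : ℝ)⁻¹ := by
    rw [eq_mul_inv_iff_mul_eq₀ hn0.ne', inv_mul_eq_div, Real.div_sqrt]
  rw [e]
  ring

/-- The law of large numbers for U-statistics with square integrable kernels. -/
lemma isLittleOP_uavg_sub_integral_of_memLp {h : S × S → ℝ} (hm : Measurable h)
    (h2 : MemLp h 2 (P.prod P)) :
    IsLittleOP μ fun n ω => uavg D h n ω - ∫ p, h p ∂(P.prod P) := by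
  set θ := ∫ p, h p ∂(P.prod P)
  have hc : MemLp (fun p => h p - θ) 2 (P.prod P) := h2.sub (memLp_const θ)
  have key := isLittleOP_sqrt_mul_uavg_of_tendsto hlaw hind
    (h := fun n p => (√(n : ℝ))⁻¹ * (h p - θ)) (fun n => (hm.sub_const θ).const_mul _)
    (Eventually.of_forall fun n => hc.const_mul _) ?_ ?_
  · refine key.congr ?_
    filter_upwards [eventually_ge_atTop 2] with n hn
    refine Eventually.of_forall fun ω => ?_
    have hn0 : (0 : ℝ) < n := by exact_mod_cast (by omega : 0 < n)
    have : uavg D (fun p => (√(n : ℝ))⁻¹ * (h p - θ)) n ω =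
        (√(n : ℝ))⁻¹ * (uavg D h n ω - θ) := by
      rw [uavg_const_mul, uavg_sub, uavg_const θ hn]
    rw [this, mul_inv_cancel_left₀ (Real.sqrt_pos.2 hn0).ne']
  · refine Eventually.of_forall fun n => ?_
    rw [integral_const_mul, integral_sub (h2.integrable one_le_two) (integrable_const _)]
    simp [θ]
  · have : ∀ n : ℕ, ∫ p, ((√(n : ℝ))⁻¹ * (h p - θ)) ^ 2 ∂(P.prod P) =
        (n : ℝ)⁻¹ * ∫ p, (h p - θ) ^ 2 ∂(P.prod P) := fun n => by
      simp only [mul_pow, inv_pow, Real.sq_sqrt (Nat.cast_nonneg n), integral_const_mul]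
    simp only [this]
    simpa using (tendsto_inv_atTop_nhds_zero_nat (𝕜 := ℝ)).mul_const _

/-- The law of large numbers for U-statistics with integrable kernels, by approximation of the
kernel by simple functions. -/
lemma isLittleOP_uavg_sub_integral {h : S × S → ℝ} (hm : Measurable h)
    (hi : Integrable h (P.prod P)) :
    IsLittleOP μ fun n ω => uavg D h n ω - ∫ p, h p ∂(P.prod P) := by
  refine isLittleOP_of_approx fun ε hε => ?_
  have hε2 : 0 < ε / 2 := ENNReal.half_pos hε.ne'
  -- simple functions are bounded, so their U-statistics obey the square integrable law
  obtain ⟨g, hg, hgi⟩ := (memLp_one_iff_integrable.2 hi).exists_simpleFunc_eLpNorm_sub_lt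
    ENNReal.one_ne_top hε2.ne'
  have hgi := memLp_one_iff_integrable.1 hgi
  rw [eLpNorm_one_eq_lintegral_enorm] at hg
  have hg' : ∫⁻ p, ‖h p - g p‖ₑ ∂(P.prod P) ≤ ε / 2 := hg.le
  obtain ⟨C, hC⟩ := g.exists_forall_norm_le
  have hg2 : MemLp g 2 (P.prod P) := .of_bound g.measurable.aestronglyMeasurable C
    (Eventually.of_forall hC)
  refine ⟨_, fun n ω => uavg D (fun p => h p - g p) n ω -
    (∫ p, h p ∂(P.prod P) - ∫ p, g p ∂(P.prod P)),
    isLittleOP_uavg_sub_integral_of_memLp hlaw hind g.measurable hg2, ?_, ?_, ?_⟩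
  · exact Eventually.of_forall fun n =>
      (aemeasurable_uavg hlaw (hm.sub g.measurable) n).sub_const _
  · refine Eventually.of_forall fun n => ?_
    calc _ ≤ ∫⁻ ω, (‖uavg D (fun p => h p - g p) n ω‖ₑ +
          ‖∫ p, h p ∂(P.prod P) - ∫ p, g p ∂(P.prod P)‖ₑ) ∂μ :=
          lintegral_mono fun ω => enorm_sub_le
      _ ≤ ε / 2 + ε / 2 := by
          rw [lintegral_add_right _ measurable_const]
          simp only [lintegral_const, measure_univ, mul_one]
          refine add_le_add
            ((lintegral_enorm_uavg_le hlaw hind (hm.sub g.measurable) n).trans hg') ?_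
          rw [← integral_sub hi hgi]
          exact (enorm_integral_le_lintegral_enorm _).trans hg'
      _ = ε := ENNReal.add_halves ε
  · refine Eventually.of_forall fun n => Eventually.of_forall fun ω => ?_
    refine le_trans (le_of_eq ?_) (abs_add_le _ _)
    congr 1
    simp only [uavg_sub]
    ring

/-- The law of large numbers for U-statistics whose kernels converge in mean. -/
lemma isLittleOP_uavg_sub_integral_of_tendsto {h : ℕ → S × S → ℝ} {h₀ : S × S → ℝ}
    (hm : ∀ n, Measurable (h n)) (hm₀ : Measurable h₀) (hi : Integrable h₀ (P.prod P))
    (hlim : Tendsto (fun n => ∫⁻ p, ‖h n p - h₀ p‖ₑ ∂(P.prod P)) atTop (𝓝 0)) :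
    IsLittleOP μ fun n ω => uavg D (h n) n ω - ∫ p, h₀ p ∂(P.prod P) := by
  have h1 : IsLittleOP μ fun n ω => uavg D (fun p => h n p - h₀ p) n ω :=
    isLittleOP_of_lintegral
      (Eventually.of_forall fun n => aemeasurable_uavg hlaw ((hm n).sub hm₀) n)
      (tendsto_of_tendsto_of_tendsto_of_le_of_le tendsto_const_nhds hlim (fun _ => zero_le)
        fun n => lintegral_enorm_uavg_le hlaw hind ((hm n).sub hm₀) n)
  refine (h1.add (isLittleOP_uavg_sub_integral hlaw hind hm₀ hi)).congr
    (Eventually.of_forall fun n => Eventually.of_forall fun ω => ?_)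
  rw [uavg_sub]
  ring

/-- The weak law of large numbers. -/
lemma isLittleOP_mean_sub_integral {f : S → ℝ} (hm : Measurable f) (hi : Integrable f P) :
    IsLittleOP μ fun n ω => (n : ℝ)⁻¹ * ∑ i ∈ Finset.range n, f (D i ω) - ∫ x, f x ∂P := by
  refine (isLittleOP_uavg_sub_integral hlaw hind (hm.comp measurable_fst)
    (hi.comp_fst P)).congr ?_
  filter_upwards [eventually_ge_atTop 2] with n hn
  refine Eventually.of_forall fun ω => ?_
  have e : ∫ p : S × S, (f ∘ Prod.fst) p ∂(P.prod P) = ∫ x, f x ∂P := by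
    simp [integral_fun_fst]
  rw [e]
  exact congrArg (· - _) (uavg_fst f hn ω).symm

/-- For integrable `f`, the sum of the squares of `f (D_i)` is `o_p(n²)`: after truncation of `f`
the sum is `O(n)`, and the truncation error is controlled in mean because the `ℓ²` norm is at most
the `ℓ¹` norm. -/
lemma isLittleOP_inv_sq_mul_sum_sq {f : S → ℝ} (hm : Measurable f) (hi : Integrable f P) :
    IsLittleOP μ fun n ω => ((n : ℝ)⁻¹) ^ 2 * ∑ i ∈ Finset.range n, f (D i ω) ^ 2 := by
  have key : IsLittleOP μ fun n ω => (n : ℝ)⁻¹ * √(∑ i ∈ Finset.range n, f (D i ω) ^ 2) := by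
    refine isLittleOP_of_approx fun ε hε => ?_
    obtain ⟨g, hg, -⟩ := (memLp_one_iff_integrable.2 hi).exists_simpleFunc_eLpNorm_sub_lt
      ENNReal.one_ne_top hε.ne'
    rw [eLpNorm_one_eq_lintegral_enorm] at hg
    obtain ⟨C, hC⟩ := g.exists_forall_norm_le
    have hC0 : 0 ≤ C := by
      obtain ⟨x⟩ : Nonempty S := nonempty_of_isProbabilityMeasure P
      exact (norm_nonneg _).trans (hC x)
    have hdm : Measurable fun p : S × S => |f p.1 - g p.1| :=
      ((hm.sub g.measurable).comp measurable_fst).abs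
    refine ⟨fun n _ => C * (√(n : ℝ))⁻¹, fun n ω => uavg D (fun p => |f p.1 - g p.1|) n ω,
      ?_, ?_, ?_, ?_⟩
    · exact isLittleOP_inv_sqrt.const_mul C
    · exact Eventually.of_forall fun n => aemeasurable_uavg hlaw hdm n
    · refine Eventually.of_forall fun n =>
        (lintegral_enorm_uavg_le hlaw hind hdm n).trans (le_trans (le_of_eq ?_) hg.le)
      rw [lintegral_prod _ hdm.enorm.aemeasurable]
      simp
    · filter_upwards [eventually_ge_atTop 2] with n hn
      refine Eventually.of_forall fun ω => ?_
      have hn0 : (0 : ℝ) < n := by exact_mod_cast (by omega : 0 < n)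
      rw [uavg_fst (fun x => |f x - g x|) hn ω]
      set T := ∑ i ∈ Finset.range n, |f (D i ω) - g (D i ω)| with hT
      have hT0 : 0 ≤ T := Finset.sum_nonneg fun i _ => abs_nonneg _
      rw [abs_of_nonneg (by positivity), abs_of_nonneg (by positivity),
        abs_of_nonneg (by positivity)]
      have e : C * (√(n : ℝ))⁻¹ = (n : ℝ)⁻¹ * (C * √(n : ℝ)) := by
        have h5 : √(n : ℝ) * √(n : ℝ) = n := Real.mul_self_sqrt hn0.le
        have h6 : √(n : ℝ) ≠ 0 := (Real.sqrt_pos.2 hn0).ne'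
        field_simp
        linear_combination -C * h5
      rw [e, ← mul_add]
      refine mul_le_mul_of_nonneg_left ?_ (by positivity)
      rw [Real.sqrt_le_left (by positivity)]
      have h7 : ∀ i ∈ Finset.range n, f (D i ω) ^ 2 ≤
          C ^ 2 + (2 * C * |f (D i ω) - g (D i ω)| + |f (D i ω) - g (D i ω)| ^ 2) := by
        intro i _
        have h8 := hC (D i ω)
        rw [Real.norm_eq_abs] at h8
        have h9 : |f (D i ω)| ≤ C + |f (D i ω) - g (D i ω)| := by
          have := abs_add_le (g (D i ω)) (f (D i ω) - g (D i ω))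
          rw [add_sub_cancel] at this
          linarith
        have := pow_le_pow_left₀ (abs_nonneg _) h9 2
        rw [sq_abs] at this
        linarith
      have h10 : ∑ i ∈ Finset.range n, |f (D i ω) - g (D i ω)| ^ 2 ≤ T ^ 2 :=
        Finset.sum_sq_le_sq_sum_of_nonneg fun i _ => abs_nonneg _
      have h12 : 1 ≤ √(n : ℝ) := by
        rw [Real.one_le_sqrt]
        exact_mod_cast (by omega : 1 ≤ n)
      calc _ ≤ _ := Finset.sum_le_sum h7
        _ = n * C ^ 2 + (2 * C * T + ∑ i ∈ Finset.range n, |f (D i ω) - g (D i ω)| ^ 2) := by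
          rw [Finset.sum_add_distrib, Finset.sum_add_distrib, ← Finset.mul_sum]
          simp [hT]
        _ ≤ n * C ^ 2 + (2 * C * √(n : ℝ) * T + T ^ 2) := by
          have h13 : 2 * C * T ≤ 2 * C * √(n : ℝ) * T :=
            mul_le_mul_of_nonneg_right (le_mul_of_one_le_right (by positivity) h12) hT0
          linarith
        _ = (C * √(n : ℝ) + T) ^ 2 := by
          rw [add_sq, mul_pow, Real.sq_sqrt hn0.le]
          ring
  refine (key.mul_isBigOP key.isBigOP).congr
    (Eventually.of_forall fun n => Eventually.of_forall fun ω => ?_)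
  rw [mul_mul_mul_comm, Real.mul_self_sqrt (Finset.sum_nonneg fun i _ => sq_nonneg _)]
  ring

end UStatistic

end SpecTest

/-! ### The multivariate central limit theorem -/

namespace SpecTest

section CentralLimit

variable {p : ℕ} {S : Type*} [MeasurableSpace S] {P : Measure S} {W : S → Vec p}
  {C : Matrix (Fin p) (Fin p) ℝ}

lemma dotProduct_mulVec_eq_integral_sq (hW : ∀ l, MemLp (fun w => W w l) 2 P)
    (hC : ∀ l m, C l m = ∫ w, W w l * W w m ∂P) (x : Fin p → ℝ) :
    x ⬝ᵥ C *ᵥ x = ∫ w, (∑ l, x l * W w l) ^ 2 ∂P := by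
  have hint : ∀ l m, Integrable (fun w => x l * W w l * (x m * W w m)) P := fun l m =>
    ((hW l).const_mul (x l)).integrable_mul ((hW m).const_mul (x m))
  simp only [pow_two, Finset.sum_mul_sum]
  rw [integral_finsetSum _ fun l _ => integrable_finsetSum _ fun m _ => hint l m]
  simp only [dotProduct, Matrix.mulVec, Finset.mul_sum]
  refine Finset.sum_congr rfl fun l _ => ?_
  rw [integral_finsetSum _ fun m _ => hint l m]
  refine Finset.sum_congr rfl fun m _ => ?_
  rw [hC, ← integral_mul_const, ← integral_const_mul]
  refine integral_congr_ae (Eventually.of_forall fun w => ?_)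
  simp only
  ring

lemma posSemidef_of_eq_integral (hW : ∀ l, MemLp (fun w => W w l) 2 P)
    (hC : ∀ l m, C l m = ∫ w, W w l * W w m ∂P) : C.PosSemidef := by
  refine .of_dotProduct_mulVec_nonneg ?_ fun x => ?_
  · ext l m
    simp only [Matrix.conjTranspose_apply, star_trivial, hC, mul_comm]
  · rw [star_trivial, dotProduct_mulVec_eq_integral_sq hW hC]
    exact integral_nonneg fun w => sq_nonneg _

/-- The Cramér–Wold device. -/
lemma charFun_map_eq_charFun_inner {Ω : Type*} [MeasurableSpace Ω] {μ : Measure Ω} {X : Ω → Vec p}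
    (hX : AEMeasurable X μ) (t : Vec p) :
    charFun (μ.map X) t = charFun (μ.map fun ω => inner ℝ (X ω) t) 1 := by
  have h1 : AEMeasurable (fun ω => inner ℝ (X ω) t) μ :=
    (by fun_prop : Measurable fun x : Vec p => inner ℝ x t).comp_aemeasurable hX
  rw [charFun_apply, charFun_apply_real, integral_map hX (by fun_prop),
    integral_map h1 (by fun_prop)]
  simp

/-- The one-dimensional central limit theorem, in terms of the characteristic function at `1`; this
is all that the Cramér–Wold device requires. -/
lemma tendsto_charFun_inv_sqrt_mul_sum_add {Ω : Type*} [MeasurableSpace Ω] {μ : Measure Ω}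
    {D : ℕ → Ω → S} [IsProbabilityMeasure μ] (hlaw : ∀ i, HasLaw (D i) P μ) (hind : iIndepFun D μ)
    {f : S → ℝ} (hm : Measurable f) (h2 : MemLp f 2 P) (h0 : ∫ w, f w ∂P = 0) (c : ℝ) :
    Tendsto (fun n : ℕ =>
        charFun (μ.map fun ω => (√(n : ℝ))⁻¹ * ∑ i ∈ Finset.range n, f (D i ω) + c) 1) atTop
      (𝓝 (Complex.exp (c * Complex.I - (∫ w, f w ^ 2 ∂P : ℝ) / 2))) := by
  have hlawf : ∀ i, HasLaw (fun ω => f (D i ω)) (P.map f) μ := fun i =>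
    HasLaw.fun_comp ⟨hm.aemeasurable, rfl⟩ (hlaw i)
  have hident : ∀ i, IdentDistrib (fun ω => f (D i ω)) (fun ω => f (D 0 ω)) μ μ := fun i =>
    ⟨(hlawf i).aemeasurable, (hlawf 0).aemeasurable, by rw [(hlawf i).map_eq, (hlawf 0).map_eq]⟩
  have hmem : MemLp (fun ω => f (D 0 ω)) 2 μ := by
    rw [← (hlaw 0).map_eq] at h2
    exact (memLp_map_measure_iff hm.aestronglyMeasurable (hlaw 0).aemeasurable).1 h2
  have hmean : ∫ ω, f (D 0 ω) ∂μ = 0 := by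
    rw [← h0]
    exact (hlaw 0).integral_comp hm.aestronglyMeasurable
  have hvar : Var[fun ω => f (D 0 ω); μ] = ∫ w, f w ^ 2 ∂P := by
    rw [variance_eq_integral hmem.aestronglyMeasurable.aemeasurable, hmean]
    simp only [sub_zero]
    exact (hlaw 0).integral_comp (f := fun w => f w ^ 2) (hm.pow_const 2).aestronglyMeasurable
  have hclt := tendstoInDistribution_inv_sqrt_mul_sum_sub (X := fun i ω => f (D i ω)) (P := μ)
    (HasLaw.id (μ := gaussianReal 0 Var[fun ω => f (D 0 ω); μ].toNNReal)) hmem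
    (hind.comp (fun _ => f) fun _ => hm) hident
  have hshift := TendstoInDistribution.continuous_comp (g := fun x : ℝ => x + c)
    (continuous_add_const c) hclt
  have hlim := ProbabilityMeasure.tendsto_iff_tendsto_charFun.1 hshift.tendsto 1
  have e : charFun ((gaussianReal 0 Var[fun ω => f (D 0 ω); μ].toNNReal).map
      ((fun x => x + c) ∘ id)) 1 =
      Complex.exp (c * Complex.I - (∫ w, f w ^ 2 ∂P : ℝ) / 2) := by
    rw [Function.comp_id, gaussianReal_map_add_const, charFun_gaussianReal, hvar]
    simp [max_eq_left (integral_nonneg (μ := P) (f := fun w => f w ^ 2) fun w => sq_nonneg (f w))]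
  rw [← e]
  refine hlim.congr fun n => ?_
  simp only [ProbabilityMeasure.coe_mk, Function.comp_def, hmean, mul_zero, sub_zero]

/-- The central limit theorem in `ℝ^p` with a deterministic shift.  By Lévy's continuity theorem
and the Cramér–Wold device it reduces to the one-dimensional theorem. -/
lemma tendstoInDistribution_inv_sqrt_smul_sum_add {Ω : Type*} [MeasurableSpace Ω] {μ : Measure Ω}
    {D : ℕ → Ω → S} [IsProbabilityMeasure μ] (hlaw : ∀ i, HasLaw (D i) P μ) (hind : iIndepFun D μ)
    (hm : Measurable W) (hW : ∀ l, MemLp (fun w => W w l) 2 P) (h0 : ∀ l, ∫ w, W w l ∂P = 0)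
    (hC : ∀ l m, C l m = ∫ w, W w l * W w m ∂P) (b : Vec p) :
    TendstoInDistribution
      (fun (n : ℕ) ω => (√(n : ℝ))⁻¹ • ∑ i ∈ Finset.range n, W (D i ω) + b) atTop id
      (fun _ => μ) (multivariateGaussian b C) := by
  have hP : IsProbabilityMeasure P := (hlaw 0).isProbabilityMeasure_iff.1 inferInstance
  have hpsd := posSemidef_of_eq_integral hW hC
  have hWD : ∀ i, AEMeasurable (fun ω => W (D i ω)) μ :=
    fun i => hm.comp_aemeasurable (hlaw i).aemeasurable
  have hmeas : ∀ n : ℕ, AEMeasurable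
      (fun ω => (√(n : ℝ))⁻¹ • ∑ i ∈ Finset.range n, W (D i ω) + b) μ := fun n =>
    have h1 : AEMeasurable (fun ω => ∑ i ∈ Finset.range n, W (D i ω)) μ :=
      Finset.aemeasurable_fun_sum _ fun i _ => hWD i
    (h1.const_smul (√(n : ℝ))⁻¹).add_const b
  refine ⟨hmeas, by fun_prop, ?_⟩
  refine ProbabilityMeasure.tendsto_iff_tendsto_charFun.2 fun t => ?_
  simp only [ProbabilityMeasure.coe_mk, Measure.map_id]
  -- the one-dimensional sample in the direction `t`
  let ℓ : S → ℝ := fun w => inner ℝ (W w) t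
  have hℓeq : ∀ w, ℓ w = ∑ l, t l * W w l := fun w => by
    simp [ℓ, PiLp.inner_apply]
  have hℓm : Measurable ℓ := (by fun_prop : Measurable fun x : Vec p => inner ℝ x t).comp hm
  have hℓ2 : MemLp ℓ 2 P := by
    rw [show ℓ = fun w => ∑ l, t l * W w l from funext hℓeq]
    exact memLp_finsetSum _ fun l _ => (hW l).const_mul _
  have hℓ0 : ∫ w, ℓ w ∂P = 0 := by
    simp only [hℓeq]
    rw [integral_finsetSum _ fun l _ => ((hW l).integrable one_le_two).const_mul _]
    simp [integral_const_mul, h0]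
  have hlim := tendsto_charFun_inv_sqrt_mul_sum_add hlaw hind hℓm hℓ2 hℓ0 (inner ℝ b t)
  rw [charFun_multivariateGaussian hpsd, dotProduct_mulVec_eq_integral_sq hW hC, real_inner_comm]
  simp only [hℓeq] at hlim
  refine hlim.congr fun n => ?_
  rw [charFun_map_eq_charFun_inner (hmeas n)]
  congr 2
  ext ω
  rw [inner_add_left, real_inner_smul_left, sum_inner]
  simp only [← hℓeq, ℓ]

end CentralLimit

end SpecTest

/-! ### Smoothness of the regression function -/

namespace SpecTest

section Smoothness

variable {px pz pv k : ℕ} (M : Model px pz pv k)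

/-- A quantitative form of the differentiability of `g(X; ·)` at `β₀`.  The modulus `ω m` is the
supremum of the difference quotients of `b ↦ g(X; b) - g(X; β₀) - r'(b - β₀)` over a countable
dense set of points of the ball of radius `ε m` about `β₀`; countability makes it measurable, and
by continuity it controls all points of the ball.  The mean value inequality bounds it by an
integrable envelope `H`. -/
lemma exists_modulus (hst : M.Standing) (hsm : M.SmoothCondition) (hint : M.β₀ ∈ interior M.B) :
    ∃ (H : Obs px pz → ℝ) (ω : ℕ → Obs px pz → ℝ) (ε : ℕ → ℝ), Measurable H ∧
      (∀ m, Measurable (ω m)) ∧ (∀ m, 0 < ε m) ∧ (∀ w, 0 ≤ H w) ∧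
      (∀ᵐ w ∂M.P, ‖H w‖ₑ ≤ 2 * M.env w) ∧ (∀ m, ∀ᵐ w ∂M.P, |ω m w| ≤ H w) ∧
      (∀ᵐ w ∂M.P, Tendsto (fun m => ω m w) atTop (𝓝 0)) ∧ (∀ᵐ w ∂M.P, ‖M.rObs w‖ ≤ H w) ∧
      (∀ m, ∀ᵐ w ∂M.P, ∀ b, ‖b - M.β₀‖ < ε m →
        |M.g w.1 b - M.g w.1 M.β₀ - inner ℝ (M.rObs w) (b - M.β₀)| ≤ ω m w * ‖b - M.β₀‖) := by
  obtain ⟨ε₀, hε₀, hball⟩ := Metric.mem_nhds_iff.1 (mem_interior_iff_mem_nhds.1 hint)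
  let ε : ℕ → ℝ := fun m => ε₀ / (m + 1)
  have hεpos : ∀ m, 0 < ε m := fun m => by positivity
  have hεle : ∀ m, ε m ≤ ε₀ := fun m => by
    refine div_le_self hε₀.le ?_
    linarith [Nat.cast_nonneg (α := ℝ) m]
  -- the suprema are over a countable set, and `ℝ≥0∞`-valued so that none of them is a junk value
  let T : Set (Vec k) := Set.range (TopologicalSpace.denseSeq (Vec k))
  have hTc : T.Countable := Set.countable_range _
  have hTd : Dense T := TopologicalSpace.denseRange_denseSeq _
  let d : Vec k → Obs px pz → ℝ := fun b w => M.g w.1 b - M.g w.1 M.β₀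
  let l : Vec k → Obs px pz → ℝ := fun b w => d b w - inner ℝ (M.rObs w) (b - M.β₀)
  have hgm : ∀ b, Measurable fun w : Obs px pz => M.g w.1 b := fun b =>
    hst.measurable_g.comp (measurable_fst.prodMk measurable_const)
  have hrm : Measurable M.rObs := hst.measurable_dg.comp (measurable_fst.prodMk measurable_const)
  have hdm : ∀ b, Measurable (d b) := fun b => (hgm b).sub (hgm _)
  have hlm : ∀ b, Measurable (l b) := fun b =>
    (hdm b).sub ((by fun_prop : Measurable fun x : Vec k => inner ℝ x (b - M.β₀)).comp hrm)
  let ωE : ℕ → Obs px pz → ℝ≥0∞ := fun m w =>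
    ⨆ b ∈ T ∩ Metric.ball M.β₀ (ε m), ENNReal.ofReal (|l b w| / ‖b - M.β₀‖)
  let G : Obs px pz → ℝ≥0∞ := fun w =>
    ⨆ b ∈ T ∩ Metric.ball M.β₀ ε₀, ENNReal.ofReal (|d b w| / ‖b - M.β₀‖)
  let HE : Obs px pz → ℝ≥0∞ := fun w => G w + ‖M.rObs w‖ₑ
  have hωm : ∀ m, Measurable (ωE m) := fun m =>
    Measurable.biSup _ (hTc.mono Set.inter_subset_left) fun b _ =>
      ((hlm b).abs.div_const _).ennreal_ofReal
  have hGm : Measurable G := Measurable.biSup _ (hTc.mono Set.inter_subset_left) fun b _ =>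
      ((hdm b).abs.div_const _).ennreal_ofReal
  have hHm : Measurable HE := hGm.add hrm.enorm
  have hr_env : ∀ w, ‖M.rObs w‖ₑ ≤ M.env w := fun w =>
    le_iSup₂_of_le (f := fun b (_ : b ∈ M.B) => ‖M.dg w.1 b‖ₑ) M.β₀ (interior_subset hint) le_rfl
  -- the mean value inequality on the ball
  have hG_env : ∀ᵐ w ∂M.P, G w ≤ M.env w := by
    filter_upwards [hsm.gradient] with w hw
    by_cases htop : M.env w = ∞
    · rw [htop]
      exact le_top
    refine iSup₂_le fun b hb => ?_
    refine ENNReal.ofReal_le_of_le_toReal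
      (div_le_of_le_mul₀ (norm_nonneg _) ENNReal.toReal_nonneg ?_)
    refine Convex.norm_image_sub_le_of_norm_hasFDerivWithin_le (𝕜 := ℝ) (f := M.g w.1)
      (s := Metric.ball M.β₀ ε₀)
      (fun x hx => ((hw x (hball hx)).hasFDerivWithinAt).mono hball) (fun x hx => ?_)
      (convex_ball _ _) (Metric.mem_ball_self hε₀) hb.2
    rw [LinearIsometryEquiv.norm_map, ← toReal_enorm]
    exact ENNReal.toReal_mono htop
      (le_iSup₂_of_le (f := fun b (_ : b ∈ M.B) => ‖M.dg w.1 b‖ₑ) x (hball hx) le_rfl)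
  have hH_env : ∀ᵐ w ∂M.P, HE w ≤ 2 * M.env w := by
    filter_upwards [hG_env] with w hw
    rw [two_mul]
    exact add_le_add hw (hr_env w)
  have hH_top : ∀ᵐ w ∂M.P, HE w < ∞ := by
    refine ae_lt_top hHm (ne_top_of_le_ne_top ?_ (lintegral_mono_ae hH_env))
    rw [lintegral_const_mul' _ _ (by simp)]
    exact ENNReal.mul_ne_top (by simp) hsm.integrable_env.ne
  have hω_H : ∀ m w, ωE m w ≤ HE w := by
    intro m w
    refine iSup₂_le fun b hb => ?_
    -- for `b = β₀` the quotients are `0 / 0 = 0`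
    have h1 : |l b w| / ‖b - M.β₀‖ ≤ |d b w| / ‖b - M.β₀‖ + ‖M.rObs w‖ := by
      rcases (norm_nonneg (b - M.β₀)).eq_or_lt with h0 | h0
      · simp [← h0]
      · rw [div_add' _ _ _ h0.ne']
        gcongr
        exact (abs_sub _ _).trans (add_le_add_right (abs_real_inner_le_norm _ _) _)
    refine (ENNReal.ofReal_le_ofReal h1).trans ?_
    rw [ENNReal.ofReal_add (by positivity) (by positivity), ofReal_norm]
    refine add_le_add_left ?_ _
    exact le_iSup₂_of_le (f := fun b (_ : b ∈ T ∩ Metric.ball M.β₀ ε₀) =>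
      ENNReal.ofReal (|d b w| / ‖b - M.β₀‖)) b ⟨hb.1, Metric.ball_subset_ball (hεle m) hb.2⟩ le_rfl
  refine ⟨fun w => (HE w).toReal, fun m w => (ωE m w).toReal, ε, hHm.ennreal_toReal,
    fun m => (hωm m).ennreal_toReal, hεpos, fun w => ENNReal.toReal_nonneg, ?_, ?_, ?_, ?_, ?_⟩
  · filter_upwards [hH_env, hH_top] with w h1 h2
    rwa [Real.enorm_of_nonneg ENNReal.toReal_nonneg, ENNReal.ofReal_toReal h2.ne]
  · intro m
    filter_upwards [hH_top] with w h2
    rw [abs_of_nonneg ENNReal.toReal_nonneg]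
    exact ENNReal.toReal_mono h2.ne (hω_H m w)
  -- differentiability at `β₀` makes the moduli vanish
  · filter_upwards [hsm.gradient] with w hw
    have hder := ((hw M.β₀ (interior_subset hint)).hasFDerivWithinAt).hasFDerivAt
      (mem_interior_iff_mem_nhds.1 hint)
    rw [hasFDerivAt_iff_isLittleO, Asymptotics.isLittleO_iff] at hder
    rw [Metric.tendsto_atTop]
    intro c hc
    obtain ⟨ρ, hρ, hρb⟩ := Metric.eventually_nhds_iff_ball.1 (hder (half_pos hc))
    have hε0 : Tendsto ε atTop (𝓝 0) := by
      simpa [ε, div_eq_mul_inv] using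
        (tendsto_one_div_add_atTop_nhds_zero_nat (𝕜 := ℝ)).const_mul ε₀
    obtain ⟨N, hN⟩ := Filter.eventually_atTop.1 (hε0.eventually (gt_mem_nhds hρ))
    refine ⟨N, fun m hm => ?_⟩
    rw [Real.dist_eq, sub_zero, abs_of_nonneg ENNReal.toReal_nonneg]
    refine lt_of_le_of_lt (ENNReal.toReal_le_of_le_ofReal (half_pos hc).le ?_) (half_lt_self hc)
    refine iSup₂_le fun b hb => ENNReal.ofReal_le_ofReal ?_
    refine div_le_of_le_mul₀ (norm_nonneg _) (half_pos hc).le ?_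
    exact hρb b (Metric.ball_subset_ball (hN m hm).le hb.2)
  · filter_upwards [hH_top] with w h2
    rw [← toReal_enorm]
    exact ENNReal.toReal_mono h2.ne le_add_self
  -- the bound passes from the dense set to the ball by continuity of `g(X; ·)`
  · intro m
    filter_upwards [hsm.gradient, hH_top] with w hw h2 b hb
    have hcont : ∀ x ∈ Metric.ball M.β₀ (ε m), ContinuousAt (M.g w.1) x := fun x hx =>
      ((hw x (hball (Metric.ball_subset_ball (hεle m) hx))).hasFDerivWithinAt.hasFDerivAt
        (Filter.mem_of_superset (Metric.isOpen_ball.mem_nhds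
          (Metric.ball_subset_ball (hεle m) hx)) hball)).continuousAt
    have hbm : b ∈ Metric.ball M.β₀ (ε m) := by rwa [Metric.mem_ball, dist_eq_norm]
    have hclos : b ∈ closure (Metric.ball M.β₀ (ε m) ∩ T) :=
      hTd.open_subset_closure_inter Metric.isOpen_ball hbm
    refine ContinuousWithinAt.closure_le (f := fun b => |l b w|)
      (g := fun b => (ωE m w).toReal * ‖b - M.β₀‖) hclos ?_ ?_ ?_
    · refine ContinuousAt.continuousWithinAt (ContinuousAt.abs ?_)
      exact ((hcont b hbm).sub continuousAt_const).sub (by fun_prop)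
    · exact Continuous.continuousWithinAt (by fun_prop)
    · rintro y ⟨hy, hyT⟩
      have h3 : ENNReal.ofReal (|l y w| / ‖y - M.β₀‖) ≤ ωE m w :=
        le_iSup₂_of_le (f := fun b (_ : b ∈ T ∩ Metric.ball M.β₀ (ε m)) =>
          ENNReal.ofReal (|l b w| / ‖b - M.β₀‖)) y ⟨hyT, hy⟩ le_rfl
      have h4 := (ENNReal.ofReal_le_iff_le_toReal (ne_top_of_le_ne_top h2.ne (hω_H m w))).1 h3
      rcases (norm_nonneg (y - M.β₀)).eq_or_lt with h0 | h0
      · have : y = M.β₀ := by rw [← sub_eq_zero, ← norm_eq_zero, ← h0]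
        simp [l, d, this]
      · exact (div_le_iff₀ h0).1 h4

end Smoothness

/-! ### Centring of the symmetrized kernel -/

section Centring

variable {px pz pv k : ℕ} (M : Model px pz pv k)

/-- `E[ℰ | Z] = 0` in weak form, tested against bounded functions of `Z`. -/
lemma integral_comp_mul_error_eq_zero [IsProbabilityMeasure M.P] (hst : M.Standing)
    (he : Integrable (fun w : Obs px pz => w.2.2) M.P) {b : Vec pz → ℝ} (hb : Measurable b) {C : ℝ}
    (hC : ∀ z, |b z| ≤ C) : ∫ w, b w.2.1 * w.2.2 ∂M.P = 0 := by
  let m : MeasurableSpace (Obs px pz) :=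
    MeasurableSpace.comap (fun w : Obs px pz => w.2.1) inferInstance
  have hmle : m ≤ Prod.instMeasurableSpace := (measurable_fst.comp measurable_snd).comap_le
  have hbm : StronglyMeasurable[m] fun w : Obs px pz => b w.2.1 :=
    (hb.comp (comap_measurable _)).stronglyMeasurable
  have hint : Integrable ((fun w : Obs px pz => b w.2.1) * fun w => w.2.2) M.P :=
    he.bdd_mul (hbm.mono hmle).aestronglyMeasurable (c := C) (Eventually.of_forall fun w => hC _)
  have h1 := condExp_mul_of_stronglyMeasurable_left (μ := M.P) hbm hint he
  have h2 := integral_condExp (μ := M.P) (f := (fun w : Obs px pz => b w.2.1) * fun w => w.2.2) hmle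
  have h3 : ∫ w, M.P[(fun w : Obs px pz => b w.2.1) * fun w => w.2.2 | m] w ∂M.P = 0 := by
    refine integral_eq_zero_of_ae ?_
    filter_upwards [h1, hst.error_mean_zero] with w h1 h2
    rw [h1, Pi.mul_apply, h2]
    simp
  rw [h3] at h2
  exact h2.symm

/-- The symmetrized kernel has mean zero because `E[ℰ | Z] = 0`.  Only the sum of its two halves is
known to be integrable; truncation of `K` makes each half integrable, and Fubini's theorem
applies to it. -/
lemma integral_symmetrized_eq_zero [IsProbabilityMeasure M.P] (hst : M.Standing)
    (he : Integrable (fun w : Obs px pz => w.2.2) M.P) {v : Obs px pz → ℝ}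
    (hv : Integrable v M.P)
    (hi : Integrable (fun p : Obs px pz × Obs px pz =>
      M.Kpair p.1 p.2 / 2 * (p.1.2.2 * v p.2 + p.2.2.2 * v p.1)) (M.P.prod M.P)) :
    ∫ p, M.Kpair p.1 p.2 / 2 * (p.1.2.2 * v p.2 + p.2.2.2 * v p.1) ∂(M.P.prod M.P) = 0 := by
  set h : Obs px pz × Obs px pz → ℝ := fun p =>
    M.Kpair p.1 p.2 / 2 * (p.1.2.2 * v p.2 + p.2.2.2 * v p.1) with hh
  let t : ℕ → Vec pz → ℝ := fun N => {z | |M.K z| ≤ N}.indicator M.K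
  have htm : ∀ N, Measurable (t N) := fun N =>
    hst.measurable_K.indicator (measurableSet_le hst.measurable_K.abs measurable_const)
  have htb : ∀ N z, |t N z| ≤ N := fun N z => by
    by_cases hz : z ∈ {z | |M.K z| ≤ N}
    · rw [show t N z = M.K z from Set.indicator_of_mem hz _]
      exact hz
    · simp [t, hz]
  have htK : ∀ N z, |t N z| ≤ |M.K z| := fun N z => by
    by_cases hz : z ∈ {z | |M.K z| ≤ N}
    · simp [t, hz]
    · simp [t, hz]
  let zd : Obs px pz × Obs px pz → Vec pz := fun p => p.1.2.1 - p.2.2.1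
  have hzd : Measurable zd := by fun_prop
  let hN : ℕ → Obs px pz × Obs px pz → ℝ := fun N p =>
    t N (zd p) / 2 * (p.1.2.2 * v p.2 + p.2.2.2 * v p.1)
  have hi1 : Integrable (fun p : Obs px pz × Obs px pz => p.1.2.2 * v p.2) (M.P.prod M.P) :=
    he.mul_prod hv
  have hi2 : Integrable (fun p : Obs px pz × Obs px pz => p.2.2.2 * v p.1) (M.P.prod M.P) := by
    simpa only [mul_comm] using hv.mul_prod he
  have hb1 : ∀ N, Integrable (fun p => t N (zd p) / 2 * (p.1.2.2 * v p.2)) (M.P.prod M.P) :=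
    fun N => hi1.bdd_mul (((htm N).comp hzd).div_const 2).aestronglyMeasurable (c := N)
      (Eventually.of_forall fun p => by
        rw [Real.norm_eq_abs, abs_div, abs_two]
        have := htb N (zd p)
        have := abs_nonneg (t N (zd p))
        linarith)
  have hb2 : ∀ N, Integrable (fun p => t N (zd p) / 2 * (p.2.2.2 * v p.1)) (M.P.prod M.P) :=
    fun N => hi2.bdd_mul (((htm N).comp hzd).div_const 2).aestronglyMeasurable (c := N)
      (Eventually.of_forall fun p => by
        rw [Real.norm_eq_abs, abs_div, abs_two]
        have := htb N (zd p)
        have := abs_nonneg (t N (zd p))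
        linarith)
  -- the error of one observation is integrated out with the other observation fixed
  have hzero : ∀ N, ∫ p, hN N p ∂(M.P.prod M.P) = 0 := by
    intro N
    simp only [hN, mul_add]
    rw [integral_add (hb1 N) (hb2 N), integral_prod_symm _ (hb1 N), integral_prod _ (hb2 N)]
    have e1 : ∀ y : Obs px pz, ∫ x, t N (zd (x, y)) / 2 * (x.2.2 * v y) ∂M.P = 0 := fun y => by
      have := integral_comp_mul_error_eq_zero M hst he (b := fun z => t N (z - y.2.1))
        ((htm N).comp (measurable_id.sub_const _)) (fun z => htb N _)
      calc _ = ∫ x, t N (x.2.1 - y.2.1) * x.2.2 * (v y / 2) ∂M.P :=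
            integral_congr_ae (Eventually.of_forall fun x => by simp only [zd]; ring)
        _ = 0 := by rw [integral_mul_const, this, zero_mul]
    have e2 : ∀ x : Obs px pz, ∫ y, t N (zd (x, y)) / 2 * (y.2.2 * v x) ∂M.P = 0 := fun x => by
      have := integral_comp_mul_error_eq_zero M hst he (b := fun z => t N (x.2.1 - z))
        ((htm N).comp (measurable_id.const_sub _)) (fun z => htb N _)
      calc _ = ∫ y, t N (x.2.1 - y.2.1) * y.2.2 * (v x / 2) ∂M.P :=
            integral_congr_ae (Eventually.of_forall fun y => by simp only [zd]; ring)
        _ = 0 := by rw [integral_mul_const, this, zero_mul]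
    simp [e1, e2]
  have hlim : Tendsto (fun N => ∫ p, hN N p ∂(M.P.prod M.P)) atTop
      (𝓝 (∫ p, h p ∂(M.P.prod M.P))) := by
    refine tendsto_integral_of_dominated_convergence (fun p => |h p|) (fun N => ?_) hi.abs
      (fun N => Eventually.of_forall fun p => ?_) (Eventually.of_forall fun p => ?_)
    · have := (hb1 N).add (hb2 N)
      refine this.aestronglyMeasurable.congr (Eventually.of_forall fun p => ?_)
      simp only [hN, Pi.add_apply, mul_add]
    · simp only [hN, h, Real.norm_eq_abs, abs_mul, abs_div]
      exact mul_le_mul_of_nonneg_right (div_le_div_of_nonneg_right (htK N _) (abs_nonneg _))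
        (abs_nonneg _)
    · refine tendsto_const_nhds.congr' ?_
      filter_upwards [eventually_ge_atTop ⌈|M.K (zd p)|⌉₊] with N hNge
      have : zd p ∈ {z | |M.K z| ≤ N} := Nat.ceil_le.1 hNge
      simp only [hN, h, t, Set.indicator_of_mem this]
      rfl
  simp only [hzero] at hlim
  exact (tendsto_nhds_unique hlim tendsto_const_nhds)

end Centring

end SpecTest

/-! ### The plug-in expansion -/

namespace SpecTest

/-- The Cauchy–Schwarz inequality for a weighted average of products over pairs of distinct
indices. -/
lemma abs_offDiag_average_le (κ : ℕ × ℕ → ℝ) (x y : ℕ → ℝ) {n : ℕ} (hn : 2 ≤ n) :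
    |((n : ℝ) * ((n : ℝ) - 1))⁻¹ * ∑ p ∈ (Finset.range n).offDiag, κ p * (x p.1 * y p.2)| ≤
      √2 * √(((n : ℝ) * ((n : ℝ) - 1))⁻¹ * ∑ p ∈ (Finset.range n).offDiag, κ p ^ 2) *
        √((n : ℝ)⁻¹ * ∑ i ∈ Finset.range n, x i ^ 2) *
        √((n : ℝ)⁻¹ * ∑ i ∈ Finset.range n, y i ^ 2) := by
  have hpos := mul_pred_pos hn
  have hn2 : (2 : ℝ) ≤ n := by exact_mod_cast hn
  set c := ((n : ℝ) * ((n : ℝ) - 1))⁻¹ with hc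
  have hc0 : 0 ≤ c := by positivity
  have hcle : c ≤ 2 * ((n : ℝ)⁻¹ * (n : ℝ)⁻¹) := by
    rw [hc, ← mul_inv, ← div_eq_mul_inv, inv_eq_one_div, div_le_div_iff₀ hpos (by positivity)]
    nlinarith
  set A := ∑ p ∈ (Finset.range n).offDiag, κ p ^ 2
  set X := ∑ i ∈ Finset.range n, x i ^ 2
  set Y := ∑ i ∈ Finset.range n, y i ^ 2
  have hA : 0 ≤ A := Finset.sum_nonneg fun _ _ => sq_nonneg _
  have hX : 0 ≤ X := Finset.sum_nonneg fun _ _ => sq_nonneg _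
  have hY : 0 ≤ Y := Finset.sum_nonneg fun _ _ => sq_nonneg _
  rw [← Real.sqrt_mul (by positivity), ← Real.sqrt_mul (by positivity),
    ← Real.sqrt_mul (by positivity)]
  refine Real.abs_le_sqrt ?_
  have h1 : (∑ p ∈ (Finset.range n).offDiag, κ p * (x p.1 * y p.2)) ^ 2 ≤ A * (X * Y) := by
    refine (Finset.sum_mul_sq_le_sq_mul_sq _ _ _).trans ?_
    refine mul_le_mul_of_nonneg_left ?_ hA
    rw [Finset.sum_mul_sum, ← Finset.sum_product']
    simp only [mul_pow]
    exact Finset.sum_le_sum_of_subset_of_nonneg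
      (by rw [← Finset.diag_union_offDiag]; exact Finset.subset_union_right)
      fun p _ _ => by positivity
  calc _ = c * (c * (∑ p ∈ (Finset.range n).offDiag, κ p * (x p.1 * y p.2)) ^ 2) := by ring
    _ ≤ 2 * ((n : ℝ)⁻¹ * (n : ℝ)⁻¹) * (c * (A * (X * Y))) := by gcongr
    _ = _ := by ring

section PlugIn

variable {Ω S : Type*} [MeasurableSpace Ω] [MeasurableSpace S] {μ : Measure Ω} {P : Measure S}
  {D : ℕ → Ω → S} [IsProbabilityMeasure μ] [IsProbabilityMeasure P]
  (hlaw : ∀ i, HasLaw (D i) P μ) (hind : iIndepFun D μ)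
include hlaw hind

omit [IsProbabilityMeasure μ] [IsProbabilityMeasure P] hind in
lemma ae_forall_sample {q : S → Prop} (h : ∀ᵐ x ∂P, q x) : ∀ᵐ ω ∂μ, ∀ i, q (D i ω) := by
  rw [ae_all_iff]
  intro i
  rw [← (hlaw i).map_eq] at h
  exact ae_of_ae_map (hlaw i).aemeasurable h

/-- The mean square of `n^{-1/2} a (D_i) - Δ_i` vanishes when `|Δ_i| ≤ H (D_i) ‖d_n‖` on events of
probability tending to one and `√n ‖d_n‖ = O_p(1)`. -/
lemma isLittleOP_mean_sq_perturbation {a H : S → ℝ} (ham : Measurable a) (ha : Integrable a P)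
    (hHm : Measurable H) (hH : Integrable H P) (hH0 : ∀ x, 0 ≤ H x) {ρ : ℕ → Ω → ℝ}
    (hρ0 : ∀ n ω, 0 ≤ ρ n ω) (hρ : IsBigOP μ fun n ω => √(n : ℝ) * ρ n ω) {Δ : ℕ → ℕ → Ω → ℝ}
    (s : ℕ → Set Ω) (hs : Tendsto (fun n => μ (s n)) atTop (𝓝 0))
    (hΔ : ∀ᵐ ω ∂μ, ∀ n i, ω ∉ s n → |Δ n i ω| ≤ H (D i ω) * ρ n ω) :
    IsLittleOP μ fun n ω => (n : ℝ)⁻¹ *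
      ∑ i ∈ Finset.range n, ((√(n : ℝ))⁻¹ * a (D i ω) - Δ n i ω) ^ 2 := by
  have h1 := isLittleOP_inv_sq_mul_sum_sq hlaw hind (ham.abs.add hHm) (ha.abs.add hH)
  have h2 : IsBigOP μ fun n ω => (1 + √(n : ℝ) * ρ n ω) * (1 + √(n : ℝ) * ρ n ω) :=
    ((isBigOP_const 1).add hρ).mul ((isBigOP_const 1).add hρ)
  refine (h1.mul_isBigOP h2).of_bound_of_measure s hs ?_
  filter_upwards [eventually_ge_atTop 1] with n hn
  filter_upwards [hΔ] with ω hω hωs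
  have hn0 : (0 : ℝ) < n := by exact_mod_cast hn
  have hsq : (0 : ℝ) < √(n : ℝ) := Real.sqrt_pos.2 hn0
  have hr := hρ0 n ω
  have hb : ∀ i ∈ Finset.range n, ((√(n : ℝ))⁻¹ * a (D i ω) - Δ n i ω) ^ 2 ≤
      (n : ℝ)⁻¹ * (1 + √(n : ℝ) * ρ n ω) ^ 2 * (|a (D i ω)| + H (D i ω)) ^ 2 := by
    intro i _
    have h3 : |(√(n : ℝ))⁻¹ * a (D i ω) - Δ n i ω| ≤
        (√(n : ℝ))⁻¹ * (1 + √(n : ℝ) * ρ n ω) * (|a (D i ω)| + H (D i ω)) := by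
      have h4 : (√(n : ℝ))⁻¹ * (1 + √(n : ℝ) * ρ n ω) = (√(n : ℝ))⁻¹ + ρ n ω := by
        field_simp
      rw [h4]
      refine (abs_sub _ _).trans ((add_le_add_right (hω n i hωs) _).trans ?_)
      rw [abs_mul, abs_of_pos (inv_pos.2 hsq)]
      have h5 := abs_nonneg (a (D i ω))
      have h6 := hH0 (D i ω)
      have h7 : 0 ≤ (√(n : ℝ))⁻¹ := by positivity
      nlinarith [mul_nonneg h7 h6, mul_nonneg hr h5]
    calc _ = |(√(n : ℝ))⁻¹ * a (D i ω) - Δ n i ω| ^ 2 := (sq_abs _).symm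
      _ ≤ _ := pow_le_pow_left₀ (abs_nonneg _) h3 2
      _ = _ := by rw [mul_pow, mul_pow, inv_pow, Real.sq_sqrt hn0.le]
  have hnn : 0 ≤ ∑ i ∈ Finset.range n, ((√(n : ℝ))⁻¹ * a (D i ω) - Δ n i ω) ^ 2 :=
    Finset.sum_nonneg fun _ _ => sq_nonneg _
  rw [abs_of_nonneg (by positivity)]
  refine le_trans ?_ (le_abs_self _)
  calc _ ≤ (n : ℝ)⁻¹ * ∑ i ∈ Finset.range n,
        (n : ℝ)⁻¹ * (1 + √(n : ℝ) * ρ n ω) ^ 2 * (|a (D i ω)| + H (D i ω)) ^ 2 := by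
        gcongr
        exact hb _ ‹_›
    _ = _ := by
      rw [← Finset.mul_sum]
      simp only [Pi.add_apply]
      ring

/-- The kernel-weighted average of `(Δ_i - r_i' d_n) v_j` is `o_p(n^{-1/2})`, when the moduli
`w m` of the linearization `Δ_i ≈ r_i' d_n` on the balls of radius `ε m` tend to `0` and are
dominated in the kernel-weighted mean.  The average divided by `‖d_n‖` is at most the U-statistic
with kernel `|κ w_m v|` when `‖d_n‖ < ε m`, and the mean of this U-statistic is small for large
`m`. -/
lemma isLittleOP_linearization_error {k : ℕ} {κ : S × S → ℝ} (hκ : Measurable κ)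
    {v : ℕ → S → ℝ} {v₀ : S → ℝ} (hv : ∀ n, Measurable (v n)) (hv₀ : Measurable v₀)
    {H : S → ℝ} (hH0 : ∀ x, 0 ≤ H x) {w : ℕ → S → ℝ}
    (hwm : ∀ m, Measurable (w m))
    (hwH : ∀ m, ∀ᵐ x ∂P, |w m x| ≤ H x) (hw0 : ∀ᵐ x ∂P, Tendsto (fun m => w m x) atTop (𝓝 0))
    {r : S → Vec k} {ε : ℕ → ℝ} (hε : ∀ m, 0 < ε m)
    (hHv : Integrable (fun p : S × S => κ p * H p.1 * v₀ p.2) (P.prod P))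
    (hlim : Tendsto (fun n => ∫⁻ p, ‖κ p * H p.1 * (v n p.2 - v₀ p.2)‖ₑ ∂(P.prod P)) atTop (𝓝 0))
    {d : ℕ → Ω → Vec k} (hd : IsBigOP μ fun n ω => √(n : ℝ) * ‖d n ω‖)
    (hd0 : ∀ m, Tendsto (fun n => μ {ω | ε m ≤ ‖d n ω‖}) atTop (𝓝 0))
    {Δ : ℕ → ℕ → Ω → ℝ}
    (hΔ : ∀ m, ∀ᵐ ω ∂μ, ∀ n i, ‖d n ω‖ < ε m →
      |Δ n i ω - inner ℝ (r (D i ω)) (d n ω)| ≤ w m (D i ω) * ‖d n ω‖) :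
    IsLittleOP μ fun n ω => √(n : ℝ) * (((n : ℝ) * ((n : ℝ) - 1))⁻¹ *
      ∑ p ∈ (Finset.range n).offDiag, κ (D p.1 ω, D p.2 ω) *
        ((Δ n p.1 ω - inner ℝ (r (D p.1 ω)) (d n ω)) * v n (D p.2 ω))) := by
  set B : ℕ → Ω → ℝ := fun n ω => ((n : ℝ) * ((n : ℝ) - 1))⁻¹ *
      ∑ p ∈ (Finset.range n).offDiag, κ (D p.1 ω, D p.2 ω) *
        ((Δ n p.1 ω - inner ℝ (r (D p.1 ω)) (d n ω)) * v n (D p.2 ω)) with hB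
  have hbound : ∀ m, ∀ᵐ ω ∂μ, ∀ n, 2 ≤ n → ‖d n ω‖ < ε m →
      |B n ω| ≤ ‖d n ω‖ * uavg D (fun p => |κ p * w m p.1 * v n p.2|) n ω := by
    intro m
    filter_upwards [hΔ m] with ω hω n hn hdn
    have hpos := mul_pred_pos hn
    rw [hB, uavg, usum, abs_mul, abs_of_nonneg (by positivity : (0 : ℝ) ≤ _), mul_left_comm,
      Finset.mul_sum]
    refine mul_le_mul_of_nonneg_left ((Finset.abs_sum_le_sum_abs _ _).trans
      (Finset.sum_le_sum fun p _ => ?_)) (by positivity)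
    rw [abs_mul, abs_mul, abs_mul, abs_mul]
    have h1 := (hω n p.1 hdn).trans (mul_le_mul_of_nonneg_right (le_abs_self _) (norm_nonneg _))
    calc _ ≤ |κ (D p.1 ω, D p.2 ω)| * ((|w m (D p.1 ω)| * ‖d n ω‖) * |v n (D p.2 ω)|) := by gcongr
      _ = _ := by ring
  have hquot : IsLittleOP μ fun n ω => B n ω / ‖d n ω‖ := by
    refine isLittleOP_of_approx fun η hη => ?_
    have hη2 : 0 < η / 2 := ENNReal.half_pos hη.ne'
    have hdct : Tendsto (fun m => ∫⁻ p, ‖κ p * w m p.1 * v₀ p.2‖ₑ ∂(P.prod P)) atTop (𝓝 0) := by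
      have := tendsto_lintegral_of_dominated_convergence (μ := P.prod P)
        (F := fun m p => ‖κ p * w m p.1 * v₀ p.2‖ₑ) (f := fun _ => 0)
        (fun p => ‖κ p * H p.1 * v₀ p.2‖ₑ)
        (fun m => ((hκ.mul ((hwm m).comp measurable_fst)).mul (hv₀.comp measurable_snd)).enorm)
        (fun m => ?_) hHv.2.ne ?_
      · simpa using this
      · filter_upwards [Measure.quasiMeasurePreserving_fst.ae (hwH m)] with p hp
        simp only [enorm_mul]
        gcongr
        rw [Real.enorm_eq_ofReal_abs, Real.enorm_eq_ofReal (hH0 _)]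
        exact ENNReal.ofReal_le_ofReal hp
      · filter_upwards [Measure.quasiMeasurePreserving_fst.ae hw0] with p hp
        have : Tendsto (fun m => κ p * w m p.1 * v₀ p.2) atTop (𝓝 0) := by
          simpa using (hp.const_mul (κ p)).mul_const (v₀ p.2)
        simpa using this.enorm
    obtain ⟨m, hm⟩ := (ENNReal.tendsto_nhds_zero.1 hdct _ hη2).exists
    have hUm : ∀ n, Measurable fun p : S × S => |κ p * w m p.1 * v n p.2| := fun n =>
      ((hκ.mul ((hwm m).comp measurable_fst)).mul ((hv n).comp measurable_snd)).abs
    refine ⟨fun n => {ω | ε m ≤ ‖d n ω‖}.indicator fun ω => B n ω / ‖d n ω‖,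
      fun n ω => uavg D (fun p => |κ p * w m p.1 * v n p.2|) n ω, ?_, ?_, ?_, ?_⟩
    · refine isLittleOP_zero.of_bound_of_measure _ (hd0 m) (Eventually.of_forall fun n =>
        Eventually.of_forall fun ω hω => ?_)
      rw [Set.indicator_of_notMem hω]
    · exact Eventually.of_forall fun n => aemeasurable_uavg hlaw (hUm n) n
    · filter_upwards [ENNReal.tendsto_nhds_zero.1 hlim _ hη2] with n hn
      refine (lintegral_enorm_uavg_le hlaw hind (hUm n) n).trans ?_
      calc ∫⁻ p, ‖|κ p * w m p.1 * v n p.2|‖ₑ ∂(P.prod P)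
          ≤ ∫⁻ p, (‖κ p * w m p.1 * v₀ p.2‖ₑ + ‖κ p * H p.1 * (v n p.2 - v₀ p.2)‖ₑ)
              ∂(P.prod P) := by
            refine lintegral_mono_ae ?_
            filter_upwards [Measure.quasiMeasurePreserving_fst.ae (hwH m)] with p hp
            have e : κ p * w m p.1 * v n p.2 = κ p * w m p.1 * v₀ p.2 +
              κ p * w m p.1 * (v n p.2 - v₀ p.2) := by ring
            rw [Real.enorm_abs, e]
            refine (enorm_add_le _ _).trans (add_le_add_right ?_ _)
            simp only [enorm_mul]
            gcongr
            rw [Real.enorm_eq_ofReal_abs, Real.enorm_eq_ofReal (hH0 _)]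
            exact ENNReal.ofReal_le_ofReal hp
        _ ≤ η / 2 + η / 2 := by
            rw [lintegral_add_left (f := fun p : S × S => ‖κ p * w m p.1 * v₀ p.2‖ₑ)
              ((hκ.mul ((hwm m).comp measurable_fst)).mul (hv₀.comp measurable_snd)).enorm]
            exact add_le_add hm hn
        _ = η := ENNReal.add_halves η
    · filter_upwards [eventually_ge_atTop 2] with n hn
      filter_upwards [hbound m] with ω hω
      by_cases hdn : ε m ≤ ‖d n ω‖
      · rw [Set.indicator_of_mem (show ω ∈ {ω | ε m ≤ ‖d n ω‖} from hdn)]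
        exact le_add_of_nonneg_right (abs_nonneg _)
      · refine le_trans ?_ (le_add_of_nonneg_left (abs_nonneg _))
        rw [abs_div, abs_norm]
        refine div_le_of_le_mul₀ (norm_nonneg _) (abs_nonneg _) ?_
        rw [mul_comm]
        exact (hω n hn (not_le.1 hdn)).trans
          (mul_le_mul_of_nonneg_left (le_abs_self _) (norm_nonneg _))
  refine (hquot.mul_isBigOP hd).congr ?_
  filter_upwards [eventually_ge_atTop 2] with n hn
  filter_upwards [hbound 0] with ω hω
  change √(n : ℝ) * B n ω = B n ω / ‖d n ω‖ * (√(n : ℝ) * ‖d n ω‖)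
  -- if `d_n = 0` then `B_n = 0`, so the division by zero is harmless
  by_cases h0 : ‖d n ω‖ = 0
  · have h1 := hω n hn (h0 ▸ hε 0)
    rw [h0, zero_mul] at h1
    rw [abs_nonpos_iff.1 h1]
    simp
  · field_simp

/-- The plug-in expansion.  A U-statistic with kernel `κ e v` is evaluated at perturbed factors
`e_i + n^{-1/2} a_i - Δ_i` and `v_j + ξ_j' d_n + R_j`.  To the order `o_p(n^{-1/2})` the
perturbations contribute their first-order terms, and these may be replaced by their means; the
products of two perturbations and the remainders `R_j` are negligible by the Cauchy–Schwarz
inequality. -/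
lemma isLittleOP_plugIn {k : ℕ} {κ : S × S → ℝ} (hκ : Measurable κ) (hκ2 : MemLp κ 2 (P.prod P))
    {e a : S → ℝ} (hem : Measurable e) (he : MemLp e 2 P) (ham : Measurable a) (ha : MemLp a 2 P)
    {v : ℕ → S → ℝ} {v₀ : S → ℝ} (hv : ∀ n, Measurable (v n)) (hv₀ : Measurable v₀)
    {H : S → ℝ} (hHm : Measurable H) (hH : Integrable H P) (hH0 : ∀ x, 0 ≤ H x) {w : ℕ → S → ℝ}
    (hwm : ∀ m, Measurable (w m))
    (hwH : ∀ m, ∀ᵐ x ∂P, |w m x| ≤ H x) (hw0 : ∀ᵐ x ∂P, Tendsto (fun m => w m x) atTop (𝓝 0))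
    {r ξ : S → Vec k} (hrm : Measurable r) (hrH : ∀ᵐ x ∂P, ‖r x‖ ≤ H x)
    (hξm : Measurable ξ) (hξ : ∀ m, MemLp (fun x => ξ x m) 2 P)
    {ε : ℕ → ℝ} (hε : ∀ m, 0 < ε m)
    (hav : Integrable (fun p : S × S => κ p * a p.1 * v₀ p.2) (P.prod P))
    (hHv : Integrable (fun p : S × S => κ p * H p.1 * v₀ p.2) (P.prod P))
    (hlima : Tendsto (fun n => ∫⁻ p, ‖κ p * a p.1 * (v n p.2 - v₀ p.2)‖ₑ ∂(P.prod P)) atTop (𝓝 0))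
    (hlim : Tendsto (fun n => ∫⁻ p, ‖κ p * H p.1 * (v n p.2 - v₀ p.2)‖ₑ ∂(P.prod P)) atTop (𝓝 0))
    {d : ℕ → Ω → Vec k} (hd : IsBigOP μ fun n ω => √(n : ℝ) * ‖d n ω‖)
    {Δ R : ℕ → ℕ → Ω → ℝ}
    (hΔ : ∀ m, ∀ᵐ ω ∂μ, ∀ n i, ‖d n ω‖ < ε m →
      |Δ n i ω - inner ℝ (r (D i ω)) (d n ω)| ≤ w m (D i ω) * ‖d n ω‖)
    (hR : IsLittleOP μ fun n ω => ∑ i ∈ Finset.range n, R n i ω ^ 2) :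
    IsLittleOP μ fun n ω => √(n : ℝ) * (((n : ℝ) * ((n : ℝ) - 1))⁻¹ *
      ∑ p ∈ (Finset.range n).offDiag, κ (D p.1 ω, D p.2 ω) *
        ((e (D p.1 ω) + (√(n : ℝ))⁻¹ * a (D p.1 ω) - Δ n p.1 ω) *
          (v n (D p.2 ω) + inner ℝ (ξ (D p.2 ω)) (d n ω) + R n p.2 ω))) -
      (√(n : ℝ) * uavg D (fun p => κ p * e p.1 * v n p.2) n ω +
        ∫ p, κ p * a p.1 * v₀ p.2 ∂(P.prod P) +
        ∑ m, √(n : ℝ) * d n ω m *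
          ∫ p, κ p * (e p.1 * ξ p.2 m - v₀ p.2 * r p.1 m) ∂(P.prod P)) := by
  have hrmm : ∀ m, Measurable fun x => r x m := fun m =>
    (by fun_prop : Measurable fun y : Vec k => y m).comp hrm
  have hξmm : ∀ m, Measurable fun x => ξ x m := fun m =>
    (by fun_prop : Measurable fun y : Vec k => y m).comp hξm
  have hrmH : ∀ m, ∀ᵐ x ∂P, |r x m| ≤ H x := fun m => hrH.mono fun x hx =>
    (PiLp.norm_apply_le (r x) m).trans hx
  have hdm : ∀ m, IsBigOP μ fun n ω => √(n : ℝ) * d n ω m := fun m => by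
    refine hd.of_bound (Eventually.of_forall fun n => Eventually.of_forall fun ω => ?_)
    rw [abs_mul, abs_mul, abs_norm]
    gcongr
    exact PiLp.norm_apply_le (d n ω) m
  have hd_op : IsLittleOP μ fun n ω => ‖d n ω‖ := by
    refine (isLittleOP_inv_sqrt.mul_isBigOP hd).congr ?_
    filter_upwards [eventually_ge_atTop 1] with n hn
    refine Eventually.of_forall fun ω => ?_
    have : (0 : ℝ) < √(n : ℝ) := Real.sqrt_pos.2 (by exact_mod_cast hn)
    field_simp
  have hd0 : ∀ m, Tendsto (fun n => μ {ω | ε m ≤ ‖d n ω‖}) atTop (𝓝 0) := fun m => by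
    simpa using tendstoInMeasure_iff_norm.1 hd_op (ε m) (hε m)
  -- the perturbation of the first factor is negligible in mean square
  have hW : IsLittleOP μ fun n ω => (n : ℝ)⁻¹ *
      ∑ i ∈ Finset.range n, ((√(n : ℝ))⁻¹ * a (D i ω) - Δ n i ω) ^ 2 := by
    refine isLittleOP_mean_sq_perturbation hlaw hind ham (ha.integrable one_le_two)
      (H := fun x => 2 * H x) (hHm.const_mul 2) (hH.const_mul 2)
      (fun x => mul_nonneg zero_le_two (hH0 x)) (fun n ω => norm_nonneg (d n ω)) hd _ (hd0 0) ?_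
    filter_upwards [hΔ 0, ae_forall_sample hlaw hrH, ae_forall_sample hlaw (hwH 0)]
      with ω h1 h2 h3 n i hs
    have h4 := h1 n i (not_le.1 hs)
    have h5 := (abs_real_inner_le_norm (r (D i ω)) (d n ω)).trans
      (mul_le_mul_of_nonneg_right (h2 i) (norm_nonneg _))
    have h6 := mul_le_mul_of_nonneg_right ((le_abs_self _).trans (h3 i)) (norm_nonneg (d n ω))
    have h7 := abs_add_le (Δ n i ω - inner ℝ (r (D i ω)) (d n ω)) (inner ℝ (r (D i ω)) (d n ω))
    rw [sub_add_cancel] at h7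
    linarith
  have hκ_O : IsBigOP μ fun n ω => √(((n : ℝ) * ((n : ℝ) - 1))⁻¹ *
      ∑ p ∈ (Finset.range n).offDiag, κ (D p.1 ω, D p.2 ω) ^ 2) :=
    (isLittleOP_uavg_sub_integral hlaw hind (hκ.pow_const 2)
      hκ2.integrable_sq).isBigOP_of_sub.sqrt
  -- products of two perturbations, by the Cauchy–Schwarz inequality
  have h6 : IsLittleOP μ fun n ω => √(n : ℝ) * (((n : ℝ) * ((n : ℝ) - 1))⁻¹ *
      ∑ p ∈ (Finset.range n).offDiag, κ (D p.1 ω, D p.2 ω) *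
        (((√(n : ℝ))⁻¹ * a (D p.1 ω) - Δ n p.1 ω) * inner ℝ (ξ (D p.2 ω)) (d n ω))) := by
    have hξ_O : IsBigOP μ fun n ω => √((n : ℝ)⁻¹ * ∑ i ∈ Finset.range n, ‖ξ (D i ω)‖ ^ 2) := by
      refine (isLittleOP_mean_sub_integral hlaw hind (f := fun x => ‖ξ x‖ ^ 2)
        (hξm.norm.pow_const 2) ?_).isBigOP_of_sub.sqrt
      simp only [EuclideanSpace.real_norm_sq_eq]
      exact integrable_finsetSum _ fun m _ => (hξ m).integrable_sq
    refine (hW.sqrt.mul_isBigOP (((isBigOP_const √2).mul hκ_O).mul (hξ_O.mul hd))).of_bound ?_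
    filter_upwards [eventually_ge_atTop 2] with n hn
    refine Eventually.of_forall fun ω => ?_
    have h7 := abs_offDiag_average_le (fun p => κ (D p.1 ω, D p.2 ω))
      (fun i => (√(n : ℝ))⁻¹ * a (D i ω) - Δ n i ω) (fun i => inner ℝ (ξ (D i ω)) (d n ω)) hn
    have h8 : √((n : ℝ)⁻¹ * ∑ i ∈ Finset.range n, (inner ℝ (ξ (D i ω)) (d n ω)) ^ 2) ≤
        √((n : ℝ)⁻¹ * ∑ i ∈ Finset.range n, ‖ξ (D i ω)‖ ^ 2) * ‖d n ω‖ := by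
      rw [← Real.sqrt_sq (norm_nonneg (d n ω)), ← Real.sqrt_mul (by positivity), mul_assoc,
        Finset.sum_mul]
      refine Real.sqrt_le_sqrt (mul_le_mul_of_nonneg_left (Finset.sum_le_sum fun i _ => ?_)
        (by positivity))
      rw [← mul_pow, ← sq_abs]
      exact pow_le_pow_left₀ (abs_nonneg _) (abs_real_inner_le_norm _ _) 2
    rw [abs_mul, abs_of_nonneg (Real.sqrt_nonneg (n : ℝ))]
    refine (mul_le_mul_of_nonneg_left (h7.trans (mul_le_mul_of_nonneg_left h8
      (by positivity))) (Real.sqrt_nonneg _)).trans (le_trans (le_of_eq ?_) (le_abs_self _))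
    ring
  -- the remainder of the second factor, by the Cauchy–Schwarz inequality
  have h7 : IsLittleOP μ fun n ω => √(n : ℝ) * (((n : ℝ) * ((n : ℝ) - 1))⁻¹ *
      ∑ p ∈ (Finset.range n).offDiag, κ (D p.1 ω, D p.2 ω) *
        ((e (D p.1 ω) + ((√(n : ℝ))⁻¹ * a (D p.1 ω) - Δ n p.1 ω)) * R n p.2 ω)) := by
    have hE_O : IsBigOP μ fun n ω => √((n : ℝ)⁻¹ * ∑ i ∈ Finset.range n,
        (e (D i ω) + ((√(n : ℝ))⁻¹ * a (D i ω) - Δ n i ω)) ^ 2) := by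
      have h8 := (isLittleOP_mean_sub_integral hlaw hind (f := fun x => e x ^ 2) (hem.pow_const 2)
        he.integrable_sq).isBigOP_of_sub
      refine (((isBigOP_const 2).mul (h8.add hW.isBigOP)).of_bound ?_).sqrt
      refine Eventually.of_forall fun n => Eventually.of_forall fun ω => ?_
      have hnn : 0 ≤ ∑ i ∈ Finset.range n,
          (e (D i ω) + ((√(n : ℝ))⁻¹ * a (D i ω) - Δ n i ω)) ^ 2 :=
        Finset.sum_nonneg fun _ _ => sq_nonneg _
      rw [abs_of_nonneg (mul_nonneg (by positivity) hnn)]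
      refine le_trans ?_ (le_abs_self _)
      have hle : ∑ i ∈ Finset.range n, (e (D i ω) + ((√(n : ℝ))⁻¹ * a (D i ω) - Δ n i ω)) ^ 2 ≤
          ∑ i ∈ Finset.range n,
            (2 * e (D i ω) ^ 2 + 2 * ((√(n : ℝ))⁻¹ * a (D i ω) - Δ n i ω) ^ 2) :=
        Finset.sum_le_sum fun i _ => by
          nlinarith [sq_nonneg (e (D i ω) - ((√(n : ℝ))⁻¹ * a (D i ω) - Δ n i ω))]
      rw [Finset.sum_add_distrib, ← Finset.mul_sum, ← Finset.mul_sum] at hle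
      refine (mul_le_mul_of_nonneg_left hle (inv_nonneg.2 n.cast_nonneg)).trans (le_of_eq ?_)
      ring
    refine (hR.sqrt.mul_isBigOP (((isBigOP_const √2).mul hκ_O).mul hE_O)).of_bound ?_
    filter_upwards [eventually_ge_atTop 2] with n hn
    refine Eventually.of_forall fun ω => ?_
    have hn0 : (0 : ℝ) < n := by exact_mod_cast (by omega : 0 < n)
    have h8 := abs_offDiag_average_le (fun p => κ (D p.1 ω, D p.2 ω))
      (fun i => e (D i ω) + ((√(n : ℝ))⁻¹ * a (D i ω) - Δ n i ω)) (fun i => R n i ω) hn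
    rw [abs_mul, abs_of_nonneg (Real.sqrt_nonneg (n : ℝ))]
    refine (mul_le_mul_of_nonneg_left h8 (Real.sqrt_nonneg _)).trans
      (le_trans (le_of_eq ?_) (le_abs_self _))
    rw [Real.sqrt_mul (by positivity : (0 : ℝ) ≤ (n : ℝ)⁻¹) (∑ i ∈ Finset.range n, R n i ω ^ 2),
      Real.sqrt_inv]
    have : (0 : ℝ) < √(n : ℝ) := Real.sqrt_pos.2 hn0
    field_simp
  -- first-order terms: linearization of `Δ`, then laws of large numbers for U-statistics
  have h4 := isLittleOP_linearization_error hlaw hind hκ hv hv₀ hH0 hwm hwH hw0 (r := r) hε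
    hHv hlim hd hd0 hΔ
  have h2 : IsLittleOP μ fun n ω => uavg D (fun p => κ p * a p.1 * v n p.2) n ω -
      ∫ p, κ p * a p.1 * v₀ p.2 ∂(P.prod P) := by
    refine isLittleOP_uavg_sub_integral_of_tendsto hlaw hind
      (h := fun n p => κ p * a p.1 * v n p.2)
      (fun n => (hκ.mul (ham.comp measurable_fst)).mul ((hv n).comp measurable_snd))
      ((hκ.mul (ham.comp measurable_fst)).mul (hv₀.comp measurable_snd)) hav ?_
    simpa only [mul_sub] using hlima
  have hirv : ∀ m, Integrable (fun p : S × S => κ p * r p.1 m * v₀ p.2) (P.prod P) := fun m => by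
    refine hHv.mono ((hκ.mul ((hrmm m).comp measurable_fst)).mul
      (hv₀.comp measurable_snd)).aestronglyMeasurable ?_
    filter_upwards [Measure.quasiMeasurePreserving_fst.ae (hrmH m)] with p hp
    simp only [norm_mul, Real.norm_eq_abs]
    exact mul_le_mul_of_nonneg_right (mul_le_mul_of_nonneg_left (hp.trans (le_abs_self _))
      (abs_nonneg _)) (abs_nonneg _)
  have h3 : ∀ m, IsLittleOP μ fun n ω => uavg D (fun p => κ p * r p.1 m * v n p.2) n ω -
      ∫ p, κ p * r p.1 m * v₀ p.2 ∂(P.prod P) := fun m => by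
    refine isLittleOP_uavg_sub_integral_of_tendsto hlaw hind
      (h := fun n p => κ p * r p.1 m * v n p.2)
      (fun n => (hκ.mul ((hrmm m).comp measurable_fst)).mul ((hv n).comp measurable_snd))
      ((hκ.mul ((hrmm m).comp measurable_fst)).mul (hv₀.comp measurable_snd)) (hirv m) ?_
    refine tendsto_of_tendsto_of_tendsto_of_le_of_le tendsto_const_nhds hlim (fun _ => zero_le)
      fun n => lintegral_mono_ae ?_
    filter_upwards [Measure.quasiMeasurePreserving_fst.ae (hrmH m)] with p hp
    rw [← mul_sub]
    simp only [enorm_mul]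
    gcongr
    rw [Real.enorm_eq_ofReal_abs, Real.enorm_eq_ofReal (hH0 _)]
    exact ENNReal.ofReal_le_ofReal hp
  have hieξ : ∀ m, Integrable (fun p : S × S => κ p * e p.1 * ξ p.2 m) (P.prod P) := fun m => by
    have h8 : MemLp (fun p : S × S => e p.1 * ξ p.2 m) 2 (P.prod P) := by
      have hm8 : Measurable fun p : S × S => e p.1 * ξ p.2 m :=
        (hem.comp measurable_fst).mul ((hξmm m).comp measurable_snd)
      rw [memLp_two_iff_integrable_sq hm8.aestronglyMeasurable]
      simpa only [mul_pow] using he.integrable_sq.mul_prod (hξ m).integrable_sq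
    simpa only [Pi.mul_def, mul_assoc] using hκ2.integrable_mul h8
  have h5 : ∀ m, IsLittleOP μ fun n ω => uavg D (fun p => κ p * e p.1 * ξ p.2 m) n ω -
      ∫ p, κ p * e p.1 * ξ p.2 m ∂(P.prod P) := fun m =>
    isLittleOP_uavg_sub_integral hlaw hind
      ((hκ.mul (hem.comp measurable_fst)).mul ((hξmm m).comp measurable_snd)) (hieξ m)
  have h35 : IsLittleOP μ fun n ω => ∑ m : Fin k,
      ((uavg D (fun p => κ p * e p.1 * ξ p.2 m) n ω -
        ∫ p, κ p * e p.1 * ξ p.2 m ∂(P.prod P)) -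
      (uavg D (fun p => κ p * r p.1 m * v n p.2) n ω -
        ∫ p, κ p * r p.1 m * v₀ p.2 ∂(P.prod P))) * (√(n : ℝ) * d n ω m) :=
    IsLittleOP.sum _ fun m _ => ((h5 m).sub (h3 m)).mul_isBigOP (hdm m)
  have hc : ∀ m, ∫ p, κ p * (e p.1 * ξ p.2 m - v₀ p.2 * r p.1 m) ∂(P.prod P) =
      ∫ p, κ p * e p.1 * ξ p.2 m ∂(P.prod P) - ∫ p, κ p * r p.1 m * v₀ p.2 ∂(P.prod P) :=
    fun m => by
      rw [← integral_sub (hieξ m) (hirv m)]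
      exact integral_congr_ae (Eventually.of_forall fun p => by simp only; ring)
  refine ((((h2.sub h4).add h6).add h7).add h35).congr ?_
  filter_upwards [eventually_ge_atTop 2] with n hn
  refine Eventually.of_forall fun ω => ?_
  have hsq : (0 : ℝ) < √(n : ℝ) := Real.sqrt_pos.2 (by exact_mod_cast (by omega : 0 < n))
  have e3 : ∑ m, d n ω m * uavg D (fun p => κ p * r p.1 m * v n p.2) n ω =
      uavg D (fun p => κ p * inner ℝ (r p.1) (d n ω) * v n p.2) n ω := by
    rw [← uavg_sum_mul]
    congr 1
    ext p
    rw [PiLp.inner_apply, Finset.mul_sum, Finset.sum_mul]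
    refine Finset.sum_congr rfl fun m _ => ?_
    simp only [RCLike.inner_apply, conj_trivial]
    ring
  have e5 : ∑ m, d n ω m * uavg D (fun p => κ p * e p.1 * ξ p.2 m) n ω =
      uavg D (fun p => κ p * e p.1 * inner ℝ (ξ p.2) (d n ω)) n ω := by
    rw [← uavg_sum_mul]
    congr 1
    ext p
    rw [PiLp.inner_apply, Finset.mul_sum]
    refine Finset.sum_congr rfl fun m _ => ?_
    simp only [RCLike.inner_apply, conj_trivial]
    ring
  have e35 : ∑ m : Fin k,
      ((uavg D (fun p => κ p * e p.1 * ξ p.2 m) n ω -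
        ∫ p, κ p * e p.1 * ξ p.2 m ∂(P.prod P)) -
      (uavg D (fun p => κ p * r p.1 m * v n p.2) n ω -
        ∫ p, κ p * r p.1 m * v₀ p.2 ∂(P.prod P))) * (√(n : ℝ) * d n ω m) =
      √(n : ℝ) * (uavg D (fun p => κ p * e p.1 * inner ℝ (ξ p.2) (d n ω)) n ω -
        uavg D (fun p => κ p * inner ℝ (r p.1) (d n ω) * v n p.2) n ω) -
      ∑ m, √(n : ℝ) * d n ω m *
          ∫ p, κ p * (e p.1 * ξ p.2 m - v₀ p.2 * r p.1 m) ∂(P.prod P) := by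
    rw [← e3, ← e5, ← Finset.sum_sub_distrib, Finset.mul_sum, ← Finset.sum_sub_distrib]
    refine Finset.sum_congr rfl fun m _ => ?_
    rw [hc]
    ring
  have e2 : uavg D (fun p => κ p * a p.1 * v n p.2) n ω =
      √(n : ℝ) * uavg D (fun p => (√(n : ℝ))⁻¹ * (κ p * a p.1 * v n p.2)) n ω := by
    rw [uavg_const_mul, mul_inv_cancel_left₀ hsq.ne']
  rw [e35, e2]
  have main : ((n : ℝ) * ((n : ℝ) - 1))⁻¹ *
      ∑ p ∈ (Finset.range n).offDiag, κ (D p.1 ω, D p.2 ω) *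
        ((e (D p.1 ω) + (√(n : ℝ))⁻¹ * a (D p.1 ω) - Δ n p.1 ω) *
          (v n (D p.2 ω) + inner ℝ (ξ (D p.2 ω)) (d n ω) + R n p.2 ω)) =
      uavg D (fun p => κ p * e p.1 * v n p.2) n ω +
      uavg D (fun p => (√(n : ℝ))⁻¹ * (κ p * a p.1 * v n p.2)) n ω -
      ((n : ℝ) * ((n : ℝ) - 1))⁻¹ *
        ∑ p ∈ (Finset.range n).offDiag, κ (D p.1 ω, D p.2 ω) *
          ((Δ n p.1 ω - inner ℝ (r (D p.1 ω)) (d n ω)) * v n (D p.2 ω)) +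
      ((n : ℝ) * ((n : ℝ) - 1))⁻¹ *
        ∑ p ∈ (Finset.range n).offDiag, κ (D p.1 ω, D p.2 ω) *
          (((√(n : ℝ))⁻¹ * a (D p.1 ω) - Δ n p.1 ω) * inner ℝ (ξ (D p.2 ω)) (d n ω)) +
      ((n : ℝ) * ((n : ℝ) - 1))⁻¹ *
        ∑ p ∈ (Finset.range n).offDiag, κ (D p.1 ω, D p.2 ω) *
          ((e (D p.1 ω) + ((√(n : ℝ))⁻¹ * a (D p.1 ω) - Δ n p.1 ω)) * R n p.2 ω) +
      (uavg D (fun p => κ p * e p.1 * inner ℝ (ξ p.2) (d n ω)) n ω -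
        uavg D (fun p => κ p * inner ℝ (r p.1) (d n ω) * v n p.2) n ω) := by
    simp only [uavg, usum]
    simp only [← mul_add, ← mul_sub, ← Finset.sum_add_distrib, ← Finset.sum_sub_distrib]
    congr 1
    refine Finset.sum_congr rfl fun p _ => ?_
    ring
  rw [main]
  ring

end PlugIn

end SpecTest

/-! ### Measurability and moments of the primitives -/

namespace SpecTest

lemma enorm_apply_le {p : ℕ} (x : Vec p) (l : Fin p) : ‖x l‖ₑ ≤ ‖x‖ₑ := by
  rw [enorm_le_iff_norm_le]
  exact PiLp.norm_apply_le x l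

lemma norm_le_sum_abs {p : ℕ} (x : Vec p) : ‖x‖ ≤ ∑ l, |x l| := by
  rw [EuclideanSpace.norm_eq, Real.sqrt_le_left (Finset.sum_nonneg fun _ _ => abs_nonneg _)]
  exact Finset.sum_sq_le_sq_sum_of_nonneg fun _ _ => abs_nonneg _


section Primitives

variable {px pz pv k : ℕ} {M : Model px pz pv k}

lemma measurable_Kpair (hst : M.Standing) :
    Measurable fun p : Obs px pz × Obs px pz => M.Kpair p.1 p.2 := by
  have h : Measurable fun p : Obs px pz × Obs px pz => p.1.2.1 - p.2.2.1 := by fun_prop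
  exact hst.measurable_K.comp h

lemma measurable_aObs (hst : M.Standing) : Measurable M.aObs := by
  have h : Measurable fun w : Obs px pz => (w.1, w.2.1) := by fun_prop
  exact hst.measurable_a.comp h

lemma measurable_VObs (hst : M.Standing) (t : ℝ) : Measurable (M.VObs t) := by
  have h : Measurable fun w : Obs px pz => w.2.2 + t * M.aObs w :=
    (by fun_prop : Measurable fun w : Obs px pz => w.2.2).add
      ((measurable_aObs hst).const_mul t)
  have h' : Measurable fun w : Obs px pz => w.2.1 := by fun_prop
  exact hst.measurable_V.comp (h.prodMk h')

lemma measurable_rObs (hst : M.Standing) : Measurable M.rObs :=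
  hst.measurable_dg.comp (measurable_fst.prodMk measurable_const)

lemma measurable_φObs (hst : M.Standing) : Measurable M.φObs := by
  have h : Measurable fun w : Obs px pz => (w.1, w.2.1) := by fun_prop
  exact hst.measurable_φ.comp h

lemma measurable_ξObs (hst : M.Standing) (m : Fin k) (l : Fin pv) :
    Measurable fun w => M.ξObs w m l := by
  have h : Measurable fun w : Obs px pz => (w.1, w.2.1) := by fun_prop
  exact (hst.measurable_ξ m l).comp h

lemma measurable_ψ (hst : M.Standing) (t : ℝ) :
    Measurable fun p : Obs px pz × Obs px pz => M.ψ t p.1 p.2 := by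
  have hV := measurable_VObs hst t
  have h1 : Measurable fun p : Obs px pz × Obs px pz => p.1.2.2 • M.VObs t p.2 :=
    (by fun_prop : Measurable fun p : Obs px pz × Obs px pz => p.1.2.2).smul
      (hV.comp measurable_snd)
  have h2 : Measurable fun p : Obs px pz × Obs px pz => p.2.2.2 • M.VObs t p.1 :=
    (by fun_prop : Measurable fun p : Obs px pz × Obs px pz => p.2.2.2).smul
      (hV.comp measurable_fst)
  exact ((measurable_Kpair hst).div_const 2).smul (h1.add h2)

lemma measurable_ψ1 [IsProbabilityMeasure M.P] (hst : M.Standing) : Measurable M.ψ1 :=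
  (measurable_ψ hst 0).stronglyMeasurable.integral_prod_right'.measurable

lemma ψ_apply (t : ℝ) (w w' : Obs px pz) (l : Fin pv) :
    M.ψ t w w' l = M.Kpair w w' / 2 * (w.2.2 * M.VObs t w' l + w'.2.2 * M.VObs t w l) := by
  simp [Model.ψ, mul_add]

lemma Kpair_swap (hst : M.Standing) (w w' : Obs px pz) : M.Kpair w w' = M.Kpair w' w := by
  rw [Model.Kpair, Model.Kpair, ← hst.K_even, neg_sub]

lemma ψ_swap (hst : M.Standing) (t : ℝ) (w w' : Obs px pz) : M.ψ t w w' = M.ψ t w' w := by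
  rw [Model.ψ, Model.ψ, Kpair_swap hst, add_comm]

/-- The errors are square integrable: `ℰ` is a combination of the model errors `U` at the sample
sizes `1` and `4`. -/
lemma memLp_error (hmom : M.MomentCondition) : MemLp (fun w : Obs px pz => w.2.2) 2 M.P := by
  have h1 := hmom.U_sq 1 le_rfl
  have h4 := hmom.U_sq 4 (by norm_num)
  have h := (h4.const_mul 2).sub h1
  refine (memLp_congr_ae (Eventually.of_forall fun w => ?_)).1 h
  simp only [Pi.sub_apply, Model.UObs, rate]
  simp
  ring

/-- The direction of misspecification is square integrable: it is the difference of the model error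
`U` at sample size `1` and the error `ℰ`. -/
lemma memLp_aObs (hmom : M.MomentCondition) : MemLp M.aObs 2 M.P := by
  have h1 := hmom.U_sq 1 le_rfl
  have h := h1.sub (memLp_error hmom)
  refine (memLp_congr_ae (Eventually.of_forall fun w => ?_)).1 h
  simp [Model.UObs, rate]

lemma ψ1_apply [IsProbabilityMeasure M.P] (hdom : M.DominanceCondition) (l : Fin pv) :
    ∀ᵐ w ∂M.P, M.ψ1 w l = ∫ w', M.ψ 0 w w' l ∂M.P := by
  have h : Integrable (fun p : Obs px pz × Obs px pz => M.ψ 0 p.1 p.2) (M.P.prod M.P) :=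
    MemLp.integrable one_le_two (μ := M.P.prod M.P) hdom.ψ_sq
  filter_upwards [h.prod_right_ae] with w hw
  exact ((EuclideanSpace.proj (𝕜 := ℝ) l).integral_comp_comm hw).symm

lemma memLp_apply {α : Type*} [MeasurableSpace α] {ν : Measure α} {q : ℝ≥0∞} {p : ℕ}
    {f : α → Vec p} (hf : MemLp f q ν) (l : Fin p) : MemLp (fun x => f x l) q ν :=
  (EuclideanSpace.proj (𝕜 := ℝ) l).comp_memLp' hf

lemma integral_apply {α : Type*} [MeasurableSpace α] {ν : Measure α} {p : ℕ}
    {f : α → Vec p} (hf : Integrable f ν) (l : Fin p) : (∫ x, f x ∂ν) l = ∫ x, f x l ∂ν :=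
  ((EuclideanSpace.proj (𝕜 := ℝ) l).integral_comp_comm hf).symm

lemma integral_ψ_apply_eq_zero [IsProbabilityMeasure M.P] (hst : M.Standing)
    (hmom : M.MomentCondition) {t : ℝ} (hv : Integrable (M.VObs t) M.P)
    (h2 : MemLp (fun p : Obs px pz × Obs px pz => M.ψ t p.1 p.2) 2 (M.P.prod M.P)) (l : Fin pv) :
    ∫ p : Obs px pz × Obs px pz, M.ψ t p.1 p.2 l ∂(M.P.prod M.P) = 0 := by
  have h := (memLp_apply h2 l).integrable one_le_two
  simp only [ψ_apply] at h ⊢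
  exact integral_symmetrized_eq_zero M hst ((memLp_error hmom).integrable one_le_two)
    ((EuclideanSpace.proj (𝕜 := ℝ) l).integrable_comp hv) h

end Primitives

end SpecTest

/-! ### The influence function and the limit covariance -/

namespace SpecTest

lemma integral_add_add_add {S : Type*} [MeasurableSpace S] {P : Measure S} {f₁ f₂ f₃ f₄ : S → ℝ}
    (h₁ : Integrable f₁ P) (h₂ : Integrable f₂ P) (h₃ : Integrable f₃ P) (h₄ : Integrable f₄ P) :
    ∫ x, (f₁ x + f₂ x + f₃ x + f₄ x) ∂P =
      ∫ x, f₁ x ∂P + ∫ x, f₂ x ∂P + ∫ x, f₃ x ∂P + ∫ x, f₄ x ∂P := by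
  have h₁₂ : Integrable (fun x => f₁ x + f₂ x) P := h₁.add h₂
  have h₁₂₃ : Integrable (fun x => f₁ x + f₂ x + f₃ x) P := h₁₂.add h₃
  rw [integral_add h₁₂₃ h₄, integral_add h₁₂ h₃, integral_add h₁ h₂]

section Influence

variable {px pz pv k : ℕ} {M : Model px pz pv k}

/-- The influence function `2 ψ⁽¹⁾ + Ξ₁ φ ℰ` of the statistic. -/
noncomputable def influence (M : Model px pz pv k) (w : Obs px pz) : Vec pv :=
  WithLp.toLp 2 fun l => 2 * M.ψ1 w l + ∑ m, M.Ξ1 l m * (w.2.2 * M.φObs w m)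

variable [IsProbabilityMeasure M.P]

lemma measurable_influence (hst : M.Standing) : Measurable (influence M) := by
  have h1 : ∀ l, Measurable fun w => M.ψ1 w l := fun l =>
    (by fun_prop : Measurable fun y : Vec pv => y l).comp (measurable_ψ1 hst)
  have h2 : ∀ m, Measurable fun w : Obs px pz => w.2.2 * M.φObs w m := fun m =>
    (by fun_prop : Measurable fun w : Obs px pz => w.2.2).mul
      ((by fun_prop : Measurable fun y : Vec k => y m).comp (measurable_φObs hst))
  refine (WithLp.measurable_toLp 2 _).comp (measurable_pi_iff.2 fun l => ?_)
  exact ((h1 l).const_mul 2).add (Finset.measurable_fun_sum _ fun m _ => (h2 m).const_mul _)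

lemma memLp_ψ1 (hst : M.Standing) (hdom : M.DominanceCondition) (l : Fin pv) :
    MemLp (fun w => M.ψ1 w l) 2 M.P := by
  have hm : Measurable fun p : Obs px pz × Obs px pz => M.ψ 0 p.1 p.2 l :=
    (by fun_prop : Measurable fun y : Vec pv => y l).comp (measurable_ψ hst 0)
  refine (memLp_congr_ae (ψ1_apply hdom l)).2 ?_
  exact memLp_integral_snd hm (memLp_apply (ν := M.P.prod M.P) hdom.ψ_sq l)

lemma integral_ψ1_eq_zero (hst : M.Standing) (hmom : M.MomentCondition)
    (hdom : M.DominanceCondition) (l : Fin pv) : ∫ w, M.ψ1 w l ∂M.P = 0 := by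
  have h := integral_ψ_apply_eq_zero hst hmom hdom.V_integrable.1 hdom.ψ_sq l
  rw [integral_prod _ ((memLp_apply (ν := M.P.prod M.P) hdom.ψ_sq l).integrable one_le_two)] at h
  rw [integral_congr_ae (ψ1_apply hdom l), h]

omit [IsProbabilityMeasure M.P] in
lemma memLp_error_mul_φ (h : MemLp (fun w : Obs px pz => w.2.2 • M.φObs w) 2 M.P) (m : Fin k) :
    MemLp (fun w => w.2.2 * M.φObs w m) 2 M.P := memLp_apply h m

lemma integral_error_mul_φ (h : MemLp (fun w : Obs px pz => w.2.2 • M.φObs w) 2 M.P)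
    (h0 : ∫ w : Obs px pz, w.2.2 • M.φObs w ∂M.P = 0) (m : Fin k) :
    ∫ w, w.2.2 * M.φObs w m ∂M.P = 0 := by
  have h1 := integral_apply (h.integrable one_le_two) m
  rw [h0] at h1
  exact h1.symm

lemma memLp_influence (hst : M.Standing) (hdom : M.DominanceCondition)
    (h : MemLp (fun w : Obs px pz => w.2.2 • M.φObs w) 2 M.P) (l : Fin pv) :
    MemLp (fun w => influence M w l) 2 M.P :=
  ((memLp_ψ1 hst hdom l).const_mul 2).add
    (memLp_finsetSum _ fun m _ => (memLp_error_mul_φ h m).const_mul _)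

lemma integral_influence (hst : M.Standing) (hmom : M.MomentCondition)
    (hdom : M.DominanceCondition) (h : MemLp (fun w : Obs px pz => w.2.2 • M.φObs w) 2 M.P)
    (h0 : ∫ w : Obs px pz, w.2.2 • M.φObs w ∂M.P = 0) (l : Fin pv) :
    ∫ w, influence M w l ∂M.P = 0 := by
  have h1 : ∀ m, Integrable (fun w => M.Ξ1 l m * (w.2.2 * M.φObs w m)) M.P := fun m =>
    ((memLp_error_mul_φ h m).integrable one_le_two).const_mul _
  calc ∫ w, influence M w l ∂M.P
      = ∫ w, (2 * M.ψ1 w l + ∑ m, M.Ξ1 l m * (w.2.2 * M.φObs w m)) ∂M.P := rfl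
    _ = 0 := by
      rw [integral_add (((memLp_ψ1 hst hdom l).integrable one_le_two).const_mul 2)
        (integrable_finsetSum _ fun m _ => h1 m), integral_finsetSum _ fun m _ => h1 m]
      simp only [integral_const_mul, integral_ψ1_eq_zero hst hmom hdom,
        integral_error_mul_φ h h0, mul_zero, Finset.sum_const_zero, add_zero]

/-- `Ω_δ` is the second-moment matrix of the influence function: the four summands of `Ω_δ` come
from multiplying out the product. -/
lemma Ωδ_apply (hst : M.Standing) (hmom : M.MomentCondition) (hdom : M.DominanceCondition)
    (h : MemLp (fun w : Obs px pz => w.2.2 • M.φObs w) 2 M.P) (l l' : Fin pv) :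
    M.Ωδ l l' = ∫ w, influence M w l * influence M w l' ∂M.P := by
  have hA := memLp_ψ1 (M := M) hst hdom
  have hB := memLp_error_mul_φ (M := M) h
  have iAA : Integrable (fun w => M.ψ1 w l * M.ψ1 w l') M.P := (hA l).integrable_mul (hA l')
  have iAB : ∀ l m, Integrable (fun w => M.ψ1 w l * (w.2.2 * M.φObs w m)) M.P :=
    fun l m => (hA l).integrable_mul (hB m)
  have iBB : ∀ m m', Integrable (fun w => w.2.2 * M.φObs w m * (w.2.2 * M.φObs w m')) M.P :=
    fun m m' => (hB m).integrable_mul (hB m')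
  have e : ∀ w, influence M w l * influence M w l' = 4 * (M.ψ1 w l * M.ψ1 w l') +
      ∑ m', ∑ m, M.Ξ1 l m * M.Ξ1 l' m' * (w.2.2 * M.φObs w m * (w.2.2 * M.φObs w m')) +
      2 * ∑ m, M.Ξ1 l m * (M.ψ1 w l' * (w.2.2 * M.φObs w m)) +
      2 * ∑ m, M.Ξ1 l' m * (M.ψ1 w l * (w.2.2 * M.φObs w m)) := fun w => by
    have e1 : ∑ m', ∑ m, M.Ξ1 l m * M.Ξ1 l' m' * (w.2.2 * M.φObs w m * (w.2.2 * M.φObs w m')) =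
        (∑ m, M.Ξ1 l m * (w.2.2 * M.φObs w m)) * ∑ m, M.Ξ1 l' m * (w.2.2 * M.φObs w m) := by
      rw [Finset.sum_mul_sum, Finset.sum_comm]
      exact Finset.sum_congr rfl fun _ _ => Finset.sum_congr rfl fun _ _ => by ring
    have e2 : ∀ i j, ∑ m, M.Ξ1 i m * (M.ψ1 w j * (w.2.2 * M.φObs w m)) =
        M.ψ1 w j * ∑ m, M.Ξ1 i m * (w.2.2 * M.φObs w m) := fun i j => by
      rw [Finset.mul_sum]
      exact Finset.sum_congr rfl fun _ _ => by ring
    rw [e1, e2, e2]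
    simp only [influence]
    ring
  have i2 : Integrable (fun w => ∑ m', ∑ m,
      M.Ξ1 l m * M.Ξ1 l' m' * (w.2.2 * M.φObs w m * (w.2.2 * M.φObs w m'))) M.P :=
    integrable_finsetSum _ fun m' _ => integrable_finsetSum _ fun m _ => (iBB m m').const_mul _
  have i3 : ∀ i j, Integrable (fun w =>
      2 * ∑ m, M.Ξ1 i m * (M.ψ1 w j * (w.2.2 * M.φObs w m))) M.P := fun i j =>
    (integrable_finsetSum _ fun m _ => (iAB j m).const_mul _).const_mul 2
  have i1 := iAA.const_mul 4
  simp only [e]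
  rw [integral_add_add_add i1 i2 (i3 l l') (i3 l' l), integral_finsetSum _ fun m' _ =>
      integrable_finsetSum _ fun m _ => (iBB m m').const_mul _]
  simp only [integral_const_mul]
  rw [integral_finsetSum _ fun m _ => (iAB l' m).const_mul _,
    integral_finsetSum _ fun m _ => (iAB l m).const_mul _]
  have hcov : M.ΩV l l' = 4 * ∫ w, M.ψ1 w l * M.ψ1 w l' ∂M.P := by
    simp only [Model.ΩV, Matrix.of_apply]
    rw [covariance_eq_sub (hA l) (hA l'), integral_ψ1_eq_zero hst hmom hdom]
    simp
  have h0 : ∀ m m', M.Ξ0 m m' = ∫ w, w.2.2 * M.φObs w m * (w.2.2 * M.φObs w m') ∂M.P :=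
    fun m m' => integral_congr_ae (Eventually.of_forall fun w => by ring)
  have h2 : ∀ j m, M.Ξ2 j m = ∫ w, M.ψ1 w j * (w.2.2 * M.φObs w m) ∂M.P :=
    fun j m => integral_congr_ae (Eventually.of_forall fun w => by ring)
  have e3 : ∀ m', ∫ w, ∑ m, M.Ξ1 l m * M.Ξ1 l' m' *
      (w.2.2 * M.φObs w m * (w.2.2 * M.φObs w m')) ∂M.P =
      (∑ m, M.Ξ1 l m * M.Ξ0 m m') * M.Ξ1 l' m' := fun m' => by
    rw [integral_finsetSum _ fun m _ => (iBB m m').const_mul _, Finset.sum_mul]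
    refine Finset.sum_congr rfl fun m _ => ?_
    rw [integral_const_mul, ← h0]
    ring
  simp only [e3, integral_const_mul, ← h2]
  simp only [Model.Ωδ, Matrix.add_apply, Matrix.smul_apply, Matrix.mul_apply,
    Matrix.transpose_apply, smul_eq_mul, hcov, mul_comm (M.Ξ2 _ _)]

end Influence

end SpecTest

/-! ### Convergence along the local alternatives -/

namespace SpecTest

lemma tendsto_integral_sq_of_tendsto_eLpNorm {S : Type*} [MeasurableSpace S] {ν : Measure S}
    {f : ℕ → S → ℝ} (hm : ∀ n, AEStronglyMeasurable (f n) ν)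
    (h : Tendsto (fun n => eLpNorm (f n) 2 ν) atTop (𝓝 0)) :
    Tendsto (fun n => ∫ x, f n x ^ 2 ∂ν) atTop (𝓝 0) := by
  have e : ∀ n, ∫ x, f n x ^ 2 ∂ν = (eLpNorm (f n) 2 ν ^ (2 : ℝ)).toReal := fun n => by
    have h1 := eLpNorm_nnreal_pow_eq_lintegral (f := f n) (μ := ν) (p := 2) two_ne_zero
    simp only [ENNReal.coe_ofNat, NNReal.coe_ofNat] at h1
    rw [h1, integral_eq_lintegral_of_nonneg_ae (Eventually.of_forall fun x => sq_nonneg _)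
      ((hm n).pow 2)]
    congr 1
    refine lintegral_congr fun x => ?_
    rw [ENNReal.rpow_two, ← Real.enorm_of_nonneg (sq_nonneg _), enorm_pow]
  simp only [e]
  have h2 : Tendsto (fun n => eLpNorm (f n) 2 ν ^ (2 : ℝ)) atTop (𝓝 0) := by
    simpa using h.ennrpow_const 2
  exact (ENNReal.tendsto_toReal ENNReal.zero_ne_top).comp h2

/-- The U-statistic with kernel `K(Z - Z†) ℰ V†` has the symmetrized kernel `ψ`. -/
lemma uavg_error_mul_V {px pz pv k : ℕ} {M : Model px pz pv k} {Ω : Type*}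
    {D : ℕ → Ω → Obs px pz} (hst : M.Standing) (t : ℝ) (l : Fin pv) (n : ℕ) (ω : Ω) :
    uavg D (fun p => M.Kpair p.1 p.2 * p.1.2.2 * M.VObs t p.2 l) n ω =
      uavg D (fun p => M.ψ t p.1 p.2 l) n ω := by
  have h : usum D (fun p => M.ψ t p.1 p.2 l) n ω =
      1 / 2 * usum D (fun p => M.Kpair p.1 p.2 * p.1.2.2 * M.VObs t p.2 l) n ω +
      1 / 2 * usum D (fun p => M.Kpair p.swap.1 p.swap.2 * p.swap.1.2.2 *
        M.VObs t p.swap.2 l) n ω := by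
    simp only [usum, Finset.mul_sum]
    rw [← Finset.sum_add_distrib]
    refine Finset.sum_congr rfl fun q _ => ?_
    simp only [ψ_apply, Prod.swap, Kpair_swap hst (D q.2 ω)]
    ring
  rw [uavg, uavg, h, usum_swap fun p => M.Kpair p.1 p.2 * p.1.2.2 * M.VObs t p.2 l]
  ring

section LocalAlternatives

variable {px pz pv k : ℕ} {M : Model px pz pv k} {Ω : Type*} [MeasurableSpace Ω] {μ : Measure Ω}
  [IsProbabilityMeasure μ] [IsProbabilityMeasure M.P] {D : ℕ → Ω → Obs px pz}
  (hlaw : ∀ i, HasLaw (D i) M.P μ) (hind : iIndepFun D μ)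

include hlaw hind in
/-- The leading U-statistic along the local alternatives is asymptotically linear with the
influence function `2 ψ⁽¹⁾` of the null hypothesis. -/
lemma isLittleOP_uavg_error_mul_V (hst : M.Standing) (hmom : M.MomentCondition)
    (hdom : M.DominanceCondition) (l : Fin pv) :
    IsLittleOP μ fun n ω =>
      √(n : ℝ) * uavg D (fun p => M.Kpair p.1 p.2 * p.1.2.2 * M.VObs (rate n) p.2 l) n ω -
        (√(n : ℝ))⁻¹ * ∑ i ∈ Finset.range n, 2 * M.ψ1 (D i ω) l := by
  have hψm : ∀ t, Measurable fun p : Obs px pz × Obs px pz => M.ψ t p.1 p.2 l := fun t =>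
    (by fun_prop : Measurable fun y : Vec pv => y l).comp (measurable_ψ hst t)
  have h02 := memLp_apply (ν := M.P.prod M.P) hdom.ψ_sq l
  have h00 := integral_ψ_apply_eq_zero hst hmom hdom.V_integrable.1 hdom.ψ_sq l
  -- the local alternatives enter through the difference of the kernels
  have hd2 : ∀ᶠ n : ℕ in atTop, MemLp (fun p : Obs px pz × Obs px pz =>
      M.ψ (rate n) p.1 p.2 - M.ψ 0 p.1 p.2) 2 (M.P.prod M.P) := by
    filter_upwards [hdom.ψ_tendsto.eventually (gt_mem_nhds ENNReal.zero_lt_top)] with n hn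
    exact ⟨((measurable_ψ hst _).sub (measurable_ψ hst _)).aestronglyMeasurable, hn⟩
  have h1 : IsLittleOP μ fun n ω => √(n : ℝ) *
      uavg D (fun p => M.ψ (rate n) p.1 p.2 l - M.ψ 0 p.1 p.2 l) n ω := by
    refine isLittleOP_sqrt_mul_uavg_of_tendsto hlaw hind
      (fun n => (hψm _).sub (hψm _)) (hd2.mono fun n hn => memLp_apply hn l) ?_ ?_
    · filter_upwards [hd2, eventually_ge_atTop 1] with n hn hn1
      have h2 : MemLp (fun p : Obs px pz × Obs px pz => M.ψ (rate n) p.1 p.2) 2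
          (M.P.prod M.P) := by
        refine (memLp_congr_ae (Eventually.of_forall fun p => ?_)).1
          (hn.add (MemLp.mono_measure (μ := M.P.prod M.P) le_rfl hdom.ψ_sq))
        exact sub_add_cancel _ _
      have h3 := integral_ψ_apply_eq_zero hst hmom (hdom.V_integrable.2 n hn1) h2 l
      rw [integral_sub ((memLp_apply h2 l).integrable one_le_two)
        (h02.integrable one_le_two), h3, h00, sub_zero]
    · refine tendsto_integral_sq_of_tendsto_eLpNorm
        (fun n => ((hψm _).sub (hψm _)).aestronglyMeasurable) ?_
      refine tendsto_of_tendsto_of_tendsto_of_le_of_le tendsto_const_nhds hdom.ψ_tendsto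
        (fun _ => zero_le) fun n => eLpNorm_mono fun p => ?_
      exact PiLp.norm_apply_le (M.ψ (rate n) p.1 p.2 - M.ψ 0 p.1 p.2) l
  have h2 := isLittleOP_uavg_sub_projection hlaw hind (hψm 0) h02 h00
    fun p => by rw [Prod.fst_swap, Prod.snd_swap, ψ_swap hst]
  refine (h1.add h2).congr (Eventually.of_forall fun n => ?_)
  filter_upwards [ae_forall_sample hlaw (ψ1_apply hdom l)] with ω hω
  simp only [uavg_error_mul_V hst, uavg_sub, hω]
  ring

omit [IsProbabilityMeasure M.P] in
/-- The errors of the auxiliary variable along the local alternatives, weighted by a function that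
is dominated by `|a| + sup ‖∂g/∂β‖`, vanish in the mean. -/
lemma tendsto_lintegral_mul_sub (hdom : M.DominanceCondition) {f : Obs px pz → ℝ}
    (hf : ∀ᵐ w ∂M.P, ‖f w‖ₑ ≤ 2 * (‖M.aObs w‖ₑ + M.env w)) (l : Fin pv) :
    Tendsto (fun n : ℕ => ∫⁻ p, ‖M.Kpair p.1 p.2 * f p.1 *
      (M.VObs (rate n) p.2 l - M.VObs 0 p.2 l)‖ₑ ∂(M.P.prod M.P)) atTop (𝓝 0) := by
  have h : Tendsto (fun n : ℕ => 2 * ∫⁻ p, ‖M.Kpair p.1 p.2‖ₑ * (‖M.aObs p.1‖ₑ + M.env p.1) *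
      ‖M.VObs (rate n) p.2 - M.VObs 0 p.2‖ₑ ∂(M.P.prod M.P)) atTop (𝓝 0) := by
    have h0 := ENNReal.Tendsto.const_mul (a := 2) hdom.KV_tendsto (Or.inr ENNReal.ofNat_ne_top)
    rw [mul_zero] at h0
    exact h0
  refine tendsto_of_tendsto_of_tendsto_of_le_of_le tendsto_const_nhds h (fun _ => zero_le)
    fun n => ?_
  rw [← lintegral_const_mul' _ _ ENNReal.ofNat_ne_top]
  refine lintegral_mono_ae ?_
  filter_upwards [Measure.quasiMeasurePreserving_fst.ae hf] with p hp
  rw [enorm_mul, enorm_mul]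
  calc ‖M.Kpair p.1 p.2‖ₑ * ‖f p.1‖ₑ * ‖M.VObs (rate n) p.2 l - M.VObs 0 p.2 l‖ₑ
      ≤ ‖M.Kpair p.1 p.2‖ₑ * (2 * (‖M.aObs p.1‖ₑ + M.env p.1)) *
        ‖M.VObs (rate n) p.2 - M.VObs 0 p.2‖ₑ := by
        gcongr
        exact enorm_apply_le (M.VObs (rate n) p.2 - M.VObs 0 p.2) l
    _ = _ := by ring

end LocalAlternatives

/-! ### The estimator -/

section Estimator

variable {Ω : Type*} [MeasurableSpace Ω] {μ : Measure Ω}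

lemma isLittleOP_apply {p : ℕ} {F : ℕ → Ω → Vec p}
    (h : TendstoInMeasure μ F atTop fun _ => 0) (l : Fin p) :
    IsLittleOP μ fun n ω => F n ω l := by
  rw [tendstoInMeasure_iff_norm] at h
  rw [IsLittleOP, tendstoInMeasure_iff_norm]
  intro ε hε
  refine tendsto_of_tendsto_of_tendsto_of_le_of_le tendsto_const_nhds (h ε hε)
    (fun _ => zero_le) fun n => measure_mono fun ω hω => ?_
  simp only [sub_zero] at hω ⊢
  exact le_trans hω (PiLp.norm_apply_le (F n ω) l)

lemma tendstoInMeasure_of_apply {p : ℕ} {F : ℕ → Ω → Vec p}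
    (h : ∀ l, IsLittleOP μ fun n ω => F n ω l) : TendstoInMeasure μ F atTop fun _ => 0 := by
  have h1 : ∀ l, IsLittleOP μ fun n ω => |F n ω l| := fun l =>
    (h l).of_bound (Eventually.of_forall fun n => Eventually.of_forall fun ω => (abs_abs _).le)
  have h2 : IsLittleOP μ fun n ω => ‖F n ω‖ := by
    refine (IsLittleOP.sum Finset.univ fun l _ => h1 l).of_bound
      (Eventually.of_forall fun n => Eventually.of_forall fun ω => ?_)
    rw [abs_norm, abs_of_nonneg (Finset.sum_nonneg fun _ _ => abs_nonneg _)]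
    exact norm_le_sum_abs _
  rw [IsLittleOP, tendstoInMeasure_iff_norm] at h2
  rw [tendstoInMeasure_iff_norm]
  simpa using h2

variable {px pz pv k : ℕ} {M : Model px pz pv k} [IsProbabilityMeasure μ]
  [IsProbabilityMeasure M.P] {X : ℕ → Ω → Vec px} {Z : ℕ → Ω → Vec pz} {e : ℕ → Ω → ℝ}
  {βhat : ℕ → Ω → Vec k}

omit [IsProbabilityMeasure μ] [IsProbabilityMeasure M.P] in
lemma isLittleOP_estimator_apply (hβ : BahadurCondition M μ X Z e βhat) (m : Fin k) :
    IsLittleOP μ fun n ω => √(n : ℝ) * (βhat n ω - M.β₀) m -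
      (M.ζa m + (√(n : ℝ))⁻¹ * ∑ i ∈ Finset.range n, e i ω * M.φ (X i ω) (Z i ω) M.β₀ m) := by
  have h := isLittleOP_apply hβ.expansion m
  refine h.congr (Eventually.of_forall fun n => Eventually.of_forall fun ω => ?_)
  simp [rate]

/-- The estimator is `√n`-consistent. -/
lemma isBigOP_sqrt_mul_norm_estimator (hst : M.Standing) (hs : Sampling M μ X Z e)
    (hβ : BahadurCondition M μ X Z e βhat) :
    IsBigOP μ fun n ω => √(n : ℝ) * ‖βhat n ω - M.β₀‖ := by
  have h1 : ∀ m, IsBigOP μ fun n ω => |√(n : ℝ) * (βhat n ω - M.β₀) m| := fun m => by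
    have hm : Measurable fun w : Obs px pz => w.2.2 * M.φObs w m :=
      (by fun_prop : Measurable fun w : Obs px pz => w.2.2).mul
        ((by fun_prop : Measurable fun y : Vec k => y m).comp (measurable_φObs hst))
    have h2 := isBigOP_inv_sqrt_mul_sum hs.hasLaw hs.indep hm (memLp_error_mul_φ hβ.eφ_sq m)
      (integral_error_mul_φ hβ.eφ_sq hβ.eφ_mean_zero m)
    refine ((isLittleOP_estimator_apply hβ m).isBigOP.add
      ((isBigOP_const (M.ζa m)).add h2)).of_bound
      (Eventually.of_forall fun n => Eventually.of_forall fun ω => ?_)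
    rw [abs_abs]
    refine le_of_eq (congrArg abs ?_)
    simp only [Model.φObs]
    ring
  refine (IsBigOP.sum Finset.univ fun m _ => h1 m).of_bound
    (Eventually.of_forall fun n => Eventually.of_forall fun ω => ?_)
  rw [abs_of_nonneg (by positivity), abs_of_nonneg (Finset.sum_nonneg fun _ _ => abs_nonneg _)]
  simp only [abs_mul, ← Finset.mul_sum, abs_of_nonneg (Real.sqrt_nonneg _)]
  exact mul_le_mul_of_nonneg_left (norm_le_sum_abs _) (Real.sqrt_nonneg _)

end Estimator

end SpecTest

/-! ### Asymptotic linearity of the statistic -/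

namespace SpecTest

section Main

variable {px pz pv k : ℕ} {M : Model px pz pv k} {Ω : Type*} [MeasurableSpace Ω] {μ : Measure Ω}
  {X : ℕ → Ω → Vec px} {Z : ℕ → Ω → Vec pz} {e : ℕ → Ω → ℝ} {Y : ℕ → ℕ → Ω → ℝ}
  {βhat : ℕ → Ω → Vec k}

omit [MeasurableSpace Ω] in
lemma δhat_apply (n : ℕ) (ω : Ω) (l : Fin pv) :
    δhat M X Z Y βhat n ω l = ((n : ℝ) * ((n : ℝ) - 1))⁻¹ *
      ∑ p ∈ (Finset.range n).offDiag, M.K (Z p.1 ω - Z p.2 ω) *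
        (resid M X Y βhat n p.1 ω * auxV M X Z Y βhat n p.2 ω l) := by
  have h : ∀ f : ℕ → ℕ → ℝ, ∑ p ∈ (Finset.range n).offDiag, f p.1 p.2 =
      ∑ i ∈ Finset.range n, ∑ j ∈ (Finset.range n).erase i, f i j := fun f => by
    rw [Finset.sum_sigma']
    refine Finset.sum_bij' (fun p _ => ⟨p.1, p.2⟩) (fun p _ => (p.1, p.2)) ?_ ?_ ?_ ?_ ?_ <;>
      simp +contextual [eq_comm]
  rw [h fun i j => M.K (Z i ω - Z j ω) * (resid M X Y βhat n i ω * auxV M X Z Y βhat n j ω l)]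
  simp [δhat, mul_assoc]

lemma ae_eq_of_localAlternative (halt : LocalAlternative M μ X Z e Y) (n : ℕ) :
    ∀ᵐ ω ∂μ, ∀ i < n,
      Y n i ω = M.g (X i ω) M.β₀ + rate n * M.a (X i ω) (Z i ω) + e i ω := by
  rw [ae_all_iff]
  intro i
  by_cases hi : i < n
  · filter_upwards [halt n i hi] with ω h _ using h
  · exact Eventually.of_forall fun ω h => absurd h hi

omit [MeasurableSpace Ω] in
lemma auxV_of_localAlternative {n i : ℕ} {ω : Ω}
    (h : Y n i ω = M.g (X i ω) M.β₀ + rate n * M.a (X i ω) (Z i ω) + e i ω) :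
    auxV M X Z Y (fun _ _ => M.β₀) n i ω = M.VObs (rate n) (X i ω, Z i ω, e i ω) := by
  simp only [auxV, resid, Model.VObs, Model.UObs, Model.aObs, h]
  congr 1
  ring

variable [IsProbabilityMeasure μ]

lemma isProbabilityMeasure_P (hs : Sampling M μ X Z e) : IsProbabilityMeasure M.P :=
  (hs.hasLaw 0).isProbabilityMeasure_iff.1 inferInstance

lemma limitMean_apply [IsProbabilityMeasure M.P] (hdom : M.DominanceCondition) (l : Fin pv) :
    M.limitMean l = ∫ p : Obs px pz × Obs px pz,
      M.Kpair p.1 p.2 * M.aObs p.1 * M.VObs 0 p.2 l ∂(M.P.prod M.P) +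
        ∑ m, M.Ξ1 l m * M.ζa m := by
  have h : M.Ξa l = ∫ p : Obs px pz × Obs px pz,
      M.Kpair p.1 p.2 * M.aObs p.1 * M.VObs 0 p.2 l ∂(M.P.prod M.P) :=
    integral_apply hdom.KaV_integrable l
  rw [← h]
  rfl

/-- The statistic is asymptotically linear, with the influence function `influence` and a
deterministic shift by the limit mean. -/
lemma isLittleOP_δhat_apply (hst : M.Standing) (hs : Sampling M μ X Z e)
    (hmom : M.MomentCondition) (hsm : M.SmoothCondition) (hdom : M.DominanceCondition)
    (hβ : BahadurCondition M μ X Z e βhat) (hV : VExpansionCondition M μ X Z Y βhat)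
    (halt : LocalAlternative M μ X Z e Y) (l : Fin pv) :
    IsLittleOP μ fun n ω => √(n : ℝ) * δhat M X Z Y βhat n ω l -
      ((√(n : ℝ))⁻¹ * ∑ i ∈ Finset.range n, influence M (X i ω, Z i ω, e i ω) l +
        M.limitMean l) := by
  have hP := isProbabilityMeasure_P hs
  obtain ⟨H, w, ε, hHm, hwm, hε, hH0, hHenv, hwH, hw0, hrH, hmod⟩ :=
    exists_modulus M hst hsm hβ.interior
  have hH : Integrable H M.P := by
    refine ⟨hHm.aestronglyMeasurable, (lintegral_mono_ae hHenv).trans_lt ?_⟩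
    rw [lintegral_const_mul' _ _ ENNReal.ofNat_ne_top]
    exact ENNReal.mul_lt_top ENNReal.ofNat_lt_top hsm.integrable_env
  have hvm : ∀ t, Measurable fun x => M.VObs t x l := fun t =>
    (by fun_prop : Measurable fun y : Vec pv => y l).comp (measurable_VObs hst t)
  let ξ : Obs px pz → Vec k := fun x => WithLp.toLp 2 fun m => M.ξObs x m l
  have hξm : Measurable ξ := (WithLp.measurable_toLp 2 _).comp
    (measurable_pi_iff.2 fun m => measurable_ξObs hst m l)
  have hHv : Integrable (fun p : Obs px pz × Obs px pz =>
      M.Kpair p.1 p.2 * H p.1 * M.VObs 0 p.2 l) (M.P.prod M.P) := by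
    have hm : Measurable fun p : Obs px pz × Obs px pz =>
        M.Kpair p.1 p.2 * H p.1 * M.VObs 0 p.2 l :=
      ((measurable_Kpair hst).mul (hHm.comp measurable_fst)).mul ((hvm 0).comp measurable_snd)
    have hle : ∀ᵐ p ∂(M.P.prod M.P), ‖M.Kpair p.1 p.2 * H p.1 * M.VObs 0 p.2 l‖ₑ ≤
        2 * (‖M.Kpair p.1 p.2‖ₑ * M.env p.1 * ‖M.VObs 0 p.2‖ₑ) := by
      filter_upwards [Measure.quasiMeasurePreserving_fst.ae hHenv] with p hp
      rw [enorm_mul, enorm_mul]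
      calc ‖M.Kpair p.1 p.2‖ₑ * ‖H p.1‖ₑ * ‖M.VObs 0 p.2 l‖ₑ
          ≤ ‖M.Kpair p.1 p.2‖ₑ * (2 * M.env p.1) * ‖M.VObs 0 p.2‖ₑ := by
            gcongr
            exact enorm_apply_le _ l
        _ = _ := by ring
    refine ⟨hm.aestronglyMeasurable, (lintegral_mono_ae hle).trans_lt ?_⟩
    rw [lintegral_const_mul' _ _ ENNReal.ofNat_ne_top]
    exact ENNReal.mul_lt_top ENNReal.ofNat_lt_top hdom.KgV_integrable
  have hR : IsLittleOP μ fun n ω => ∑ i ∈ Finset.range n,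
      (auxV M X Z Y βhat n i ω l - M.VObs (rate n) (X i ω, Z i ω, e i ω) l -
        inner ℝ (ξ (X i ω, Z i ω, e i ω)) (βhat n ω - M.β₀)) ^ 2 := by
    refine IsLittleOP.of_bound hV.expansion (Eventually.of_forall fun n => ?_)
    filter_upwards [ae_eq_of_localAlternative halt n] with ω hω
    rw [abs_of_nonneg (Finset.sum_nonneg fun _ _ => sq_nonneg _),
      abs_of_nonneg (Finset.sum_nonneg fun _ _ => sq_nonneg _)]
    refine Finset.sum_le_sum fun i hi => ?_
    rw [auxV_of_localAlternative (hω i (Finset.mem_range.1 hi)), ← sq_abs]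
    refine pow_le_pow_left₀ (abs_nonneg _) (le_trans (le_of_eq ?_) (PiLp.norm_apply_le _ l)) 2
    simp [ξ, PiLp.inner_apply, Matrix.mulVec, dotProduct, Model.ξObs, mul_comm]
  have hΔ : ∀ m, ∀ᵐ ω ∂μ, ∀ n i, ‖βhat n ω - M.β₀‖ < ε m →
      |(M.g (X i ω) (βhat n ω) - M.g (X i ω) M.β₀) -
        inner ℝ (M.rObs (X i ω, Z i ω, e i ω)) (βhat n ω - M.β₀)| ≤
      w m (X i ω, Z i ω, e i ω) * ‖βhat n ω - M.β₀‖ := fun m => by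
    filter_upwards [ae_forall_sample hs.hasLaw (hmod m)] with ω hω n i
    exact hω i (βhat n ω)
  -- plug-in expansion, projection of the leading U-statistic, and expansion of the estimator
  have h1 := isLittleOP_plugIn hs.hasLaw hs.indep (measurable_Kpair hst) hmom.K_sq
    (e := fun x => x.2.2) (by fun_prop) (memLp_error hmom) (measurable_aObs hst) (memLp_aObs hmom)
    (v := fun n x => M.VObs (rate n) x l) (v₀ := fun x => M.VObs 0 x l) (fun n => hvm _) (hvm 0)
    hHm hH hH0 hwm hwH hw0 (measurable_rObs hst) hrH hξm (fun m => hV.ξ_sq m l) hε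
    (memLp_one_iff_integrable.1
      (memLp_apply (memLp_one_iff_integrable.2 hdom.KaV_integrable) l)) hHv
    (tendsto_lintegral_mul_sub hdom (Eventually.of_forall fun x => by
      refine le_trans (le_add_right (le_refl _)) (le_mul_of_one_le_left zero_le one_le_two)) l)
    (tendsto_lintegral_mul_sub hdom
      (hHenv.mono fun x hx => hx.trans (by gcongr; exact le_add_self)) l)
    (isBigOP_sqrt_mul_norm_estimator hst hs hβ) hΔ hR
  have h2 := isLittleOP_uavg_error_mul_V hs.hasLaw hs.indep hst hmom hdom l
  have h3 := IsLittleOP.sum Finset.univ fun m _ =>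
    (isLittleOP_estimator_apply hβ m).const_mul (M.Ξ1 l m)
  refine ((h1.add h2).add h3).congr (Eventually.of_forall fun n => ?_)
  filter_upwards [ae_eq_of_localAlternative halt n] with ω hω
  have e1 : δhat M X Z Y βhat n ω l = ((n : ℝ) * ((n : ℝ) - 1))⁻¹ *
      ∑ p ∈ (Finset.range n).offDiag, M.K (Z p.1 ω - Z p.2 ω) *
        ((e p.1 ω + (√(n : ℝ))⁻¹ * M.a (X p.1 ω) (Z p.1 ω) -
            (M.g (X p.1 ω) (βhat n ω) - M.g (X p.1 ω) M.β₀)) *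
          (M.VObs (rate n) (X p.2 ω, Z p.2 ω, e p.2 ω) l +
            inner ℝ (ξ (X p.2 ω, Z p.2 ω, e p.2 ω)) (βhat n ω - M.β₀) +
            (auxV M X Z Y βhat n p.2 ω l - M.VObs (rate n) (X p.2 ω, Z p.2 ω, e p.2 ω) l -
              inner ℝ (ξ (X p.2 ω, Z p.2 ω, e p.2 ω)) (βhat n ω - M.β₀)))) := by
    rw [δhat_apply]
    refine congrArg _ (Finset.sum_congr rfl fun p hp => ?_)
    rw [resid, hω p.1 (Finset.mem_range.1 (Finset.mem_offDiag.1 hp).1), rate]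
    ring
  have e2 : (√(n : ℝ))⁻¹ * ∑ i ∈ Finset.range n, influence M (X i ω, Z i ω, e i ω) l =
      (√(n : ℝ))⁻¹ * ∑ i ∈ Finset.range n, 2 * M.ψ1 (X i ω, Z i ω, e i ω) l +
      ∑ m, M.Ξ1 l m * ((√(n : ℝ))⁻¹ *
        ∑ i ∈ Finset.range n, e i ω * M.φ (X i ω) (Z i ω) M.β₀ m) := by
    simp only [influence, Finset.sum_add_distrib, mul_add, Model.φObs]
    rw [Finset.sum_comm]
    simp only [Finset.mul_sum]
    congr 1
    exact Finset.sum_congr rfl fun _ _ => Finset.sum_congr rfl fun _ _ => by ring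
  have e3 : ∀ m, M.Ξ1 l m = ∫ p : Obs px pz × Obs px pz, M.Kpair p.1 p.2 *
      (p.1.2.2 * ξ p.2 m - M.VObs 0 p.2 l * M.rObs p.1 m) ∂(M.P.prod M.P) := fun m => rfl
  have e4 : ∑ m, √(n : ℝ) * (βhat n ω - M.β₀) m * M.Ξ1 l m =
      ∑ m, M.Ξ1 l m * (√(n : ℝ) * (βhat n ω - M.β₀) m -
        (M.ζa m + (√(n : ℝ))⁻¹ * ∑ i ∈ Finset.range n, e i ω * M.φ (X i ω) (Z i ω) M.β₀ m)) +
      ∑ m, M.Ξ1 l m * M.ζa m + ∑ m, M.Ξ1 l m * ((√(n : ℝ))⁻¹ *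
        ∑ i ∈ Finset.range n, e i ω * M.φ (X i ω) (Z i ω) M.β₀ m) := by
    rw [← Finset.sum_add_distrib, ← Finset.sum_add_distrib]
    exact Finset.sum_congr rfl fun _ _ => by ring
  simp only [← e3]
  rw [e4, e2, limitMean_apply hdom, e1]
  simp only [Model.Kpair, Model.aObs]
  ring

omit [IsProbabilityMeasure μ] in
lemma aemeasurable_δhat (hst : M.Standing) (hs : Sampling M μ X Z e)
    (hβ : BahadurCondition M μ X Z e βhat) (halt : LocalAlternative M μ X Z e Y) (n : ℕ) :
    AEMeasurable (δhat M X Z Y βhat n) μ := by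
  have hX : ∀ i, AEMeasurable (X i) μ := fun i =>
    measurable_fst.comp_aemeasurable (hs.hasLaw i).aemeasurable
  have hZ : ∀ i, AEMeasurable (Z i) μ := fun i =>
    (measurable_fst.comp measurable_snd).comp_aemeasurable (hs.hasLaw i).aemeasurable
  have he : ∀ i, AEMeasurable (e i) μ := fun i =>
    (measurable_snd.comp measurable_snd).comp_aemeasurable (hs.hasLaw i).aemeasurable
  have hY : ∀ i < n, AEMeasurable (Y n i) μ := fun i hi => by
    have h : AEMeasurable (fun ω =>
        M.g (X i ω) M.β₀ + rate n * M.a (X i ω) (Z i ω) + e i ω) μ :=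
      ((hst.measurable_g.comp_aemeasurable ((hX i).prodMk aemeasurable_const)).add
        ((hst.measurable_a.comp_aemeasurable ((hX i).prodMk (hZ i))).const_mul _)).add (he i)
    exact h.congr ((halt n i hi).mono fun ω hω => hω.symm)
  have hres : ∀ i < n, AEMeasurable (resid M X Y βhat n i) μ := fun i hi =>
    (hY i hi).sub (hst.measurable_g.comp_aemeasurable ((hX i).prodMk (hβ.measurable n)))
  have haux : ∀ i < n, AEMeasurable (auxV M X Z Y βhat n i) μ := fun i hi =>
    hst.measurable_V.comp_aemeasurable ((hres i hi).prodMk (hZ i))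
  have hsum : AEMeasurable (fun ω => ∑ i ∈ Finset.range n, ∑ j ∈ (Finset.range n).erase i,
      (M.K (Z i ω - Z j ω) * resid M X Y βhat n i ω) • auxV M X Z Y βhat n j ω) μ := by
    refine Finset.aemeasurable_fun_sum _ fun i hi => Finset.aemeasurable_fun_sum _ fun j hj => ?_
    have hK : AEMeasurable (fun ω => M.K (Z i ω - Z j ω)) μ :=
      hst.measurable_K.comp_aemeasurable ((hZ i).sub (hZ j))
    exact (hK.mul (hres i (Finset.mem_range.1 hi))).smul
      (haux j (Finset.mem_range.1 (Finset.mem_erase.1 hj).2))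
  exact hsum.const_smul ((n : ℝ) * ((n : ℝ) - 1))⁻¹

omit [IsProbabilityMeasure μ] in
/-- If the null hypothesis and the local alternatives hold simultaneously, then `a(X, Z) = 0`
almost surely; sample size one is enough to see this. -/
lemma aObs_ae_eq_zero (hst : M.Standing) (hs : Sampling M μ X Z e)
    (halt : LocalAlternative M μ X Z e Y) (hnull : NullHypothesis M μ X e Y) :
    ∀ᵐ w ∂M.P, M.aObs w = 0 := by
  rw [← (hs.hasLaw 0).map_eq]
  refine (ae_map_iff (hs.hasLaw 0).aemeasurable
    (measurableSet_eq_fun (measurable_aObs hst) measurable_const)).2 ?_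
  filter_upwards [halt 1 0 one_pos, hnull 1 0 one_pos] with ω h1 h2
  rw [h1, rate, Nat.cast_one, Real.sqrt_one, inv_one, one_mul] at h2
  simp only [Model.aObs]
  linarith

lemma limitMean_eq_zero [IsProbabilityMeasure M.P] (ha : ∀ᵐ w ∂M.P, M.aObs w = 0) :
    M.limitMean = 0 := by
  have hζ : M.ζa = 0 := integral_eq_zero_of_ae (ha.mono fun w hw => by simp [hw])
  have hΞ : M.Ξa = 0 := by
    refine integral_eq_zero_of_ae ?_
    filter_upwards [Measure.quasiMeasurePreserving_fst.ae ha] with p hp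
    simp [hp]
  simp [Model.limitMean, hζ, hΞ]

end Main

end SpecTest

theorem mainTheorem2 {px pz pv k : ℕ} {Ω : Type*} [MeasurableSpace Ω] (μ : Measure Ω)
    [IsProbabilityMeasure μ] (M : SpecTest.Model px pz pv k)
    (X : ℕ → Ω → SpecTest.Vec px) (Z : ℕ → Ω → SpecTest.Vec pz) (e : ℕ → Ω → ℝ)
    (Y : ℕ → ℕ → Ω → ℝ) (βhat : ℕ → Ω → SpecTest.Vec k)
    (hstanding : M.Standing)
    (hsampling : SpecTest.Sampling M μ X Z e)
    (hmoment : M.MomentCondition)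
    (hsmooth : M.SmoothCondition)
    (hdom : M.DominanceCondition)
    (hβ : SpecTest.BahadurCondition M μ X Z e βhat)
    (hV : SpecTest.VExpansionCondition M μ X Z Y βhat)
    (halt : SpecTest.LocalAlternative M μ X Z e Y) :
    M.Ωδ.PosSemidef ∧
    TendstoInDistribution (fun (n : ℕ) ω => √(n : ℝ) • SpecTest.δhat M X Z Y βhat n ω) atTop id
      (fun _ => μ) (multivariateGaussian M.limitMean M.Ωδ) ∧
    (SpecTest.NullHypothesis M μ X e Y →
      TendstoInDistribution (fun (n : ℕ) ω => √(n : ℝ) • SpecTest.δhat M X Z Y βhat n ω) atTop id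
        (fun _ => μ) (multivariateGaussian 0 M.Ωδ)) := by
  have hP := SpecTest.isProbabilityMeasure_P hsampling
  have hW := SpecTest.memLp_influence hstanding hdom hβ.eφ_sq
  have hC := SpecTest.Ωδ_apply hstanding hmoment hdom hβ.eφ_sq
  have hclt := SpecTest.tendstoInDistribution_inv_sqrt_smul_sum_add hsampling.hasLaw
    hsampling.indep (SpecTest.measurable_influence hstanding) hW
    (SpecTest.integral_influence hstanding hmoment hdom hβ.eφ_sq hβ.eφ_mean_zero) hC M.limitMean
  have hmain : TendstoInDistribution
      (fun (n : ℕ) ω => √(n : ℝ) • SpecTest.δhat M X Z Y βhat n ω) atTop id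
      (fun _ => μ) (multivariateGaussian M.limitMean M.Ωδ) := by
    refine tendstoInDistribution_of_tendstoInMeasure_sub
      (X := fun (n : ℕ) ω => (√(n : ℝ))⁻¹ • ∑ i ∈ Finset.range n,
        SpecTest.influence M (X i ω, Z i ω, e i ω) + M.limitMean) _ _ hclt ?_ fun n => ?_
    · refine SpecTest.tendstoInMeasure_of_apply fun l => ?_
      refine (SpecTest.isLittleOP_δhat_apply hstanding hsampling hmoment hsmooth hdom hβ hV halt
        l).congr (Eventually.of_forall fun n => Eventually.of_forall fun ω => ?_)
      simp
    · exact (SpecTest.aemeasurable_δhat hstanding hsampling hβ halt n).const_smul (√(n : ℝ))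
  refine ⟨SpecTest.posSemidef_of_eq_integral hW hC, hmain, fun hnull => ?_⟩
  rwa [SpecTest.limitMean_eq_zero (SpecTest.aObs_ae_eq_zero hstanding hsampling halt hnull)]
    at hmain
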